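/- Let $S$ be a simply connected real Lie group with a left-invariant Riemannian metric, let $\mathfrak s$ be its Lie algebra, and let $\langle\ ,\ \rangle$ be the inner product that the metric induces on $\mathfrak s$. Suppose that $\mathfrak s$ has a subalgebra $\mathfrak a$ and an ideal $\mathfrak n$ such that (i) $\mathfrak s=\mathfrak a+\mathfrak n$, and $\mathfrak s$ is completely solvable, i.e. $\mathfrak s$ is solvable and for every $X\in\mathfrak s$ all eigenvalues of $\operatorname{ad}X$ are real; (ii) $\mathfrak n$ is the nilradical of $\mathfrak s$ (its largest nilpotent ideal); (iii) $\mathfrak a$ is abelian and acts fully reducibly on $\mathfrak n$, i.e. every $\operatorname{ad}\mathfrak a$-invariant subspace of $\mathfrak n$ has an $\operatorname{ad}\mathfrak a$-invariant complement in $\mathfrak n$; (iv) for every $A\in\mathfrak a$ the map $\operatorname{ad}A:\mathfrak s\to\mathfrak s$ is symmetric with respect to $\langle\ ,\ \rangle$; (v) there is some $A\in\mathfrak a$ such that all eigenvalues of $\operatorname{ad}A|_{\mathfrak n}$ are positive. For $n\in\mathbb N$ let $T(n,\mathbb R)$ be the Lie group of real lower triangular $n\times n$ matrices with positive diagonal entries,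 and let $\mathfrak t(n,\mathbb R)$ be its Lie algebra, consisting of all real lower triangular $n\times n$ matrices. Let $\langle\ ,\ \rangle_{\mathfrak t(n,\mathbb R)}$ be the inner product on $\mathfrak t(n,\mathbb R)$ that equals $2\operatorname{tr}(XY^t)$ on diagonal matrices and $\operatorname{tr}(XY^t)$ on strictly lower triangular matrices, and for which these two subspaces are orthogonal. (The corresponding left-invariant metric on $T(n,\mathbb R)$ is the one usually called the Einstein metric; it is isometric to the symmetric metric on $GL(n,\mathbb R)/O(n,\mathbb R)$.) Then there are $n\in\mathbb N$, a real number $c>0$ and a group homomorphism $\phi:S\to T(n,\mathbb R)$ that is an isometric embedding of Riemannian manifolds (a smooth map which is a homeomorphism onto its image, in particular injective, and which pulls the target metric back to the metric of $S$), where $T(n,\mathbb R)$ carries the left-invariant metric with inner product $c\,\langle\ ,\ \rangle_{\mathfrak t(n,\mathbb R)}$. -/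

import Mathlib

open Bundle
open scoped Manifold ContDiff Topology

noncomputable section

/-! ### Lie groups with left-invariant Riemannian metrics -/

/-- Smooth Lie groups have the regularity needed for their Lie algebra. -/
instance leInftyMinSmoothnessThree : ENat.LEInfty (minSmoothness ℝ 3) :=
  ⟨by simp; exact WithTop.coe_le_coe.2 le_top⟩

/-- Tangent spaces of finite-dimensional manifolds are finite-dimensional. -/
instance finiteDimensionalTangentSpace {E : Type*} [NormedAddCommGroup E] [NormedSpace ℝ E]
    [h : FiniteDimensional ℝ E] {H : Type*} [TopologicalSpace H] (I : ModelWithCorners ℝ E H)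
    {M : Type*} [TopologicalSpace M] [ChartedSpace H M] (x : M) :
    FiniteDimensional ℝ (TangentSpace I x) := h

/-- A smooth Riemannian metric on a manifold. -/
abbrev SmoothMetric {E : Type*} [NormedAddCommGroup E] [NormedSpace ℝ E]
    {H : Type*} [TopologicalSpace H] (I : ModelWithCorners ℝ E H)
    (M : Type*) [TopologicalSpace M] [ChartedSpace H M] [IsManifold I ∞ M] : Type _ :=
  ContMDiffRiemannianMetric I ∞ E (fun x : M => TangentSpace I x)

/-- Left translations preserve the metric. -/
def IsLeftInvariant {E : Type*} [NormedAddCommGroup E] [NormedSpace ℝ E]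
    {H : Type*} [TopologicalSpace H] {I : ModelWithCorners ℝ E H}
    {G : Type*} [Group G] [TopologicalSpace G] [ChartedSpace H G] [LieGroup I ∞ G]
    (g : SmoothMetric I G) : Prop :=
  ∀ (a x : G) (v w : TangentSpace I x),
    g.inner (a * x) (mfderiv I I (fun y : G => a * y) x v) (mfderiv I I (fun y : G => a * y) x w) =
      g.inner x v w

/-- `f : (M, g) → (N, h)` is an isometric embedding of Riemannian manifolds: it is smooth, a
homeomorphism onto its image, and pulls `h` back to `g` (so that its derivatives are injective). -/
structure IsIsometricEmbedding {E E' : Type*} [NormedAddCommGroup E] [NormedSpace ℝ E]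
    [NormedAddCommGroup E'] [NormedSpace ℝ E'] {H H' : Type*} [TopologicalSpace H]
    [TopologicalSpace H'] {I : ModelWithCorners ℝ E H} {I' : ModelWithCorners ℝ E' H'}
    {M N : Type*} [TopologicalSpace M] [ChartedSpace H M] [IsManifold I ∞ M]
    [TopologicalSpace N] [ChartedSpace H' N] [IsManifold I' ∞ N]
    (g : SmoothMetric I M) (h : SmoothMetric I' N) (f : M → N) : Prop where
  contMDiff : ContMDiff I I' ∞ f
  isEmbedding : Topology.IsEmbedding f
  pullback_eq : ∀ (x : M) (v w : TangentSpace I x),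
    h.inner (f x) (mfderiv I I' f x v) (mfderiv I I' f x w) = g.inner x v w

theorem isVonNBounded_of_pos {E : Type*} [NormedAddCommGroup E] [NormedSpace ℝ E]
    [FiniteDimensional ℝ E] (B : E →L[ℝ] E →L[ℝ] ℝ) (hB : ∀ v, v ≠ 0 → 0 < B v v) :
    Bornology.IsVonNBounded ℝ {v : E | B v v < 1} := by
  rw [NormedSpace.isVonNBounded_iff]
  have hc : Continuous fun v : E => B v v := by fun_prop
  rcases (Metric.sphere (0 : E) 1).eq_empty_or_nonempty with he | hne
  · have : ∀ v : E, v = 0 := by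
      intro v
      by_contra hv
      have : ‖v‖⁻¹ • v ∈ Metric.sphere (0 : E) 1 := by
        simp [norm_smul, hv]
      rw [he] at this
      exact this
    refine (Bornology.isBounded_singleton (x := (0 : E))).subset fun v _ => this v
  · obtain ⟨u, hu, hmin⟩ := (isCompact_sphere (0 : E) 1).exists_isMinOn hne hc.continuousOn
    have hu0 : u ≠ 0 := by
      rintro rfl
      simp at hu
    have hm := hB u hu0
    set m := B u u with hm'
    refine (Metric.isBounded_closedBall (x := (0 : E)) (r := m⁻¹ + 1)).subset fun v hv => ?_
    rw [mem_closedBall_zero_iff]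
    by_contra hlt
    push Not at hlt
    have hpos : 0 < m⁻¹ := inv_pos.2 hm
    have hv0 : 0 < ‖v‖ := by linarith
    have h1 : m ≤ B (‖v‖⁻¹ • v) (‖v‖⁻¹ • v) := by
      refine hmin (a := ‖v‖⁻¹ • v) ?_
      simp [norm_smul, hv0.ne']
    have h2 : B (‖v‖⁻¹ • v) (‖v‖⁻¹ • v) = ‖v‖⁻¹ * (‖v‖⁻¹ * B v v) := by
      simp
    have hv' : B v v < 1 := hv
    have h3 : m * (‖v‖ * ‖v‖) ≤ B v v := by
      rw [h2] at h1
      have := mul_le_mul_of_nonneg_right h1 (mul_pos hv0 hv0).le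
      calc _ ≤ _ := this
        _ = B v v := by field_simp
    have h4 : 1 ≤ m * ‖v‖ := by
      have := mul_le_mul_of_nonneg_left hlt.le hm.le
      rw [mul_add, mul_inv_cancel₀ hm.ne'] at this
      linarith
    nlinarith

theorem contDiff_bilinearComp_self {E : Type*} [NormedAddCommGroup E] [NormedSpace ℝ E]
    [FiniteDimensional ℝ E] (B : E →L[ℝ] E →L[ℝ] ℝ) :
    ContDiff ℝ ∞ fun A : E →L[ℝ] E => B.bilinearComp A A := by
  rw [contDiff_clm_apply_iff]
  intro v
  rw [contDiff_clm_apply_iff]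
  intro w
  simp only [ContinuousLinearMap.bilinearComp_apply]
  fun_prop

/-- Translation of tangent vectors at `g` to the Lie algebra, the derivative of `x ↦ g⁻¹ * x`. -/
def toLieAlg {E : Type*} [NormedAddCommGroup E] [NormedSpace ℝ E]
    {H : Type*} [TopologicalSpace H] (I : ModelWithCorners ℝ E H)
    {G : Type*} [Group G] [TopologicalSpace G] [ChartedSpace H G]
    (g : G) : TangentSpace I g →L[ℝ] TangentSpace I (1 : G) :=
  mfderiv I I (fun x : G => g⁻¹ * x) g


/-- The left-invariant field of bilinear forms with value `B` at the identity. -/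
def leftForm {E : Type*} [NormedAddCommGroup E] [NormedSpace ℝ E]
    {H : Type*} [TopologicalSpace H] (I : ModelWithCorners ℝ E H)
    {G : Type*} [Group G] [TopologicalSpace G] [ChartedSpace H G]
    (B : GroupLieAlgebra I G →L[ℝ] GroupLieAlgebra I G →L[ℝ] ℝ) (g : G) :
    TangentSpace I g →L[ℝ] TangentSpace I g →L[ℝ] ℝ :=
  ContinuousLinearMap.bilinearComp (E := E) (F := E) (E' := E) (F' := E) (G := ℝ) B
    (toLieAlg I g) (toLieAlg I g)

theorem leftForm_apply {E : Type*} [NormedAddCommGroup E] [NormedSpace ℝ E]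
    {H : Type*} [TopologicalSpace H] (I : ModelWithCorners ℝ E H)
    {G : Type*} [Group G] [TopologicalSpace G] [ChartedSpace H G]
    (B : GroupLieAlgebra I G →L[ℝ] GroupLieAlgebra I G →L[ℝ] ℝ) (g : G)
    (v w : TangentSpace I g) : leftForm I B g v w = B (toLieAlg I g v) (toLieAlg I g w) := rfl

theorem toLieAlg_injective {E : Type*} [NormedAddCommGroup E] [NormedSpace ℝ E]
    {H : Type*} [TopologicalSpace H] (I : ModelWithCorners ℝ E H)
    {G : Type*} [Group G] [TopologicalSpace G] [ChartedSpace H G] [LieGroup I ∞ G]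
    (g : G) : Function.Injective (toLieAlg I g) := by
  have h : (mfderiv I I (fun x : G => g * x) (g⁻¹ * g)).comp (toLieAlg I g) =
      ContinuousLinearMap.id ℝ (TangentSpace I g) := by
    unfold toLieAlg
    rw [← mfderiv_comp (I' := I) g
      ((contMDiff_mul_left (n := ∞)).contMDiffAt.mdifferentiableAt (by simp))
      ((contMDiff_mul_left (n := ∞)).contMDiffAt.mdifferentiableAt (by simp))]
    have : (fun x : G => g * x) ∘ (fun x : G => g⁻¹ * x) = id := by
      funext x
      simp
    rw [this, mfderiv_id]
  intro v w hvw
  have h1 : mfderiv I I (fun x : G => g * x) (g⁻¹ * g) (toLieAlg I g v) = v := DFunLike.congr_fun h v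
  have h2 : mfderiv I I (fun x : G => g * x) (g⁻¹ * g) (toLieAlg I g w) = w := DFunLike.congr_fun h w
  exact h1.symm.trans ((congrArg _ hvw).trans h2)

theorem exists_toLieAlg_coordinates {E : Type*} [NormedAddCommGroup E] [NormedSpace ℝ E]
    {H : Type*} [TopologicalSpace H] (I : ModelWithCorners ℝ E H)
    {G : Type*} [Group G] [TopologicalSpace G] [ChartedSpace H G] [LieGroup I ∞ G]
    (x₀ : G) : ∃ A : G → E →L[ℝ] E,
    ContMDiffAt I 𝓘(ℝ, E →L[ℝ] E) ∞ A x₀ ∧ ∀ x ∈ (chartAt H x₀).source, ∀ u : E,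
      A x u = toLieAlg I x ((trivializationAt E (TangentSpace I : G → Type _) x₀).symm x u) := by
  refine ⟨inTangentCoordinates I I (id : G → G) (fun x : G => x⁻¹ * x)
    (fun x : G => mfderiv I I (fun y : G => x⁻¹ * y) x) x₀, ?_, ?_⟩
  · refine ContMDiffAt.mfderiv (n := ∞) (m := ∞) (fun x y : G => x⁻¹ * y) id ?_
      contMDiffAt_id (by simp)
    exact (contMDiffAt_fst.inv).mul contMDiffAt_snd
  · intro x hx u
    have h1 : achart H (x⁻¹ * x) = achart H (x₀⁻¹ * x₀) := by simp
    have h2 : x⁻¹ * x ∈ (chartAt H (x₀⁻¹ * x₀)).source := by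
      rw [inv_mul_cancel, inv_mul_cancel]
      exact mem_chart_source H 1
    have h3 : (trivializationAt E (TangentSpace I : G → Type _) x₀).symm x u =
        (tangentBundleCore I G).coordChange (achart H x₀) (achart H x) x u := by
      rw [← TangentBundle.symmL_trivializationAt_eq_core hx]
      exact (Bundle.Trivialization.symmL_apply (R := ℝ) _ (by simpa using hx) u).symm
    have e := inTangentCoordinates_eq (I := I) (I' := I) (id : G → G) (fun x : G => x⁻¹ * x)
      (fun x : G => mfderiv I I (fun y : G => x⁻¹ * y) x) (x₀ := x₀) (x := x) hx h2
    refine (DFunLike.congr_fun e u).trans ?_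
    rw [h1, h3]
    exact (tangentBundleCore I G).coordChange_self _ _ h2 _

/-- The left-invariant Riemannian metric whose inner product on the Lie algebra is `B`. -/
def leftInvariantMetric {E : Type*} [NormedAddCommGroup E] [NormedSpace ℝ E] [FiniteDimensional ℝ E]
    {H : Type*} [TopologicalSpace H] (I : ModelWithCorners ℝ E H)
    {G : Type*} [Group G] [TopologicalSpace G] [ChartedSpace H G] [LieGroup I ∞ G]
    (B : GroupLieAlgebra I G →L[ℝ] GroupLieAlgebra I G →L[ℝ] ℝ)
   (symm : ∀ v w, B v w = B w v) (pos : ∀ v, v ≠ 0 → 0 < B v v) :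
   ContMDiffRiemannianMetric I ∞ E (fun x : G => TangentSpace I x) where
  inner := leftForm I B
  symm g v w := by rw [leftForm_apply, leftForm_apply, symm]
  pos g v hv := by
    rw [leftForm_apply]
    exact pos _ fun h => hv (toLieAlg_injective I g (h.trans (map_zero _).symm))
  isVonNBounded g := isVonNBounded_of_pos (E := E) (leftForm I B g) fun v hv => by
    refine pos _ fun h => hv (toLieAlg_injective I g (h.trans (map_zero _).symm))
  contMDiff := by
    intro x₀
    rw [contMDiffAt_hom_bundle]
    refine ⟨contMDiffAt_id, ?_⟩
    obtain ⟨A, hA, hkey⟩ := exists_toLieAlg_coordinates I x₀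
    let B' : E →L[ℝ] E →L[ℝ] ℝ := B
    have hB := (contDiff_bilinearComp_self B').contMDiff.contMDiffAt.comp x₀ hA
    refine hB.congr_of_eventuallyEq ?_
    have hs : (chartAt H x₀).source ∈ 𝓝 x₀ :=
      (chartAt H x₀).open_source.mem_nhds (mem_chart_source H x₀)
    filter_upwards [hs] with x hx
    ext v w
    have hb : x ∈ (trivializationAt E (TangentSpace I : G → Type _) x₀).baseSet := by
      simpa using hx
    rw [inCoordinates_apply_eq₂ hb hb (Set.mem_univ _)]
    change _ = B' (A x v) (A x w)
    rw [hkey x hx v, hkey x hx w]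
    simp only [Trivial.fiberBundle_trivializationAt', Trivial.linearMapAt_trivialization,
      LinearMap.id_coe, id_eq]
    rfl

/-! ### The lower triangular group and its Einstein metric -/

/-- The group `T(n, ℝ)` of real lower triangular `n × n` matrices with positive diagonal entries
(the simply connected group with Lie algebra the lower triangular matrices). -/
def LowerTriangularGroup (n : ℕ) : Subgroup (GL (Fin n) ℝ) where
  carrier := {g | (∀ i j : Fin n, i < j → g i j = 0) ∧ ∀ i : Fin n, 0 < g i i}
  one_mem' := by
    refine ⟨fun i j h => ?_, fun i => ?_⟩
    · simp [h.ne]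
    · simp
  mul_mem' := by
    rintro a b ⟨ha, ha'⟩ ⟨hb, hb'⟩
    refine ⟨fun i j h => ?_, fun i => ?_⟩
    · rw [Matrix.GeneralLinearGroup.coe_mul, Matrix.mul_apply]
      refine Finset.sum_eq_zero fun k _ => ?_
      rcases lt_or_ge i k with hk | hk
      · rw [ha i k hk, zero_mul]
      · rw [hb k j (lt_of_le_of_lt hk h), mul_zero]
    · rw [Matrix.GeneralLinearGroup.coe_mul, Matrix.mul_apply,
        Finset.sum_eq_single i]
      · exact mul_pos (ha' i) (hb' i)
      · intro k _ hk
        rcases lt_or_gt_of_ne hk with hk | hk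
        · rw [hb k i hk, mul_zero]
        · rw [ha i k hk, zero_mul]
      · simp
  inv_mem' := by
    rintro a ⟨ha, ha'⟩
    have hinv : ∀ i j : Fin n, i < j → (a⁻¹ : GL (Fin n) ℝ) i j = 0 := by
      intro i j h
      have h1 : (a : Matrix (Fin n) (Fin n) ℝ).BlockTriangular OrderDual.toDual :=
        fun i j h => ha i j h
      have : Invertible (a : Matrix (Fin n) (Fin n) ℝ) := a.invertible
      have h2 := Matrix.blockTriangular_inv_of_blockTriangular h1
      rw [Matrix.coe_units_inv]
      exact h2 h
    refine ⟨hinv, fun i => ?_⟩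
    have h1 : ((a * a⁻¹ : GL (Fin n) ℝ) : Matrix (Fin n) (Fin n) ℝ) i i = 1 := by simp
    rw [Matrix.GeneralLinearGroup.coe_mul, Matrix.mul_apply, Finset.sum_eq_single i] at h1
    · exact pos_of_mul_pos_right (by rw [h1]; exact one_pos) (ha' i).le
    · intro k _ hk
      rcases lt_or_gt_of_ne hk with hk | hk
      · rw [hinv k i hk, mul_zero]
      · rw [ha i k hk, zero_mul]
    · simp

namespace LowerTriangularGroup

/-- The positions on or below the diagonal of an `n × n` matrix. -/
abbrev Pos (n : ℕ) : Type := {p : Fin n × Fin n // p.2 ≤ p.1}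

/-- The vector space of lower triangular matrices, written through their entries on or below the
diagonal. It is the model space of the manifold `T(n, ℝ)`. -/
abbrev Model (n : ℕ) : Type := EuclideanSpace ℝ (Pos n)

/-- The lower triangular matrix with the given entries. -/
def toMatrix {n : ℕ} (x : Model n) : Matrix (Fin n) (Fin n) ℝ :=
  Matrix.of fun i j => if h : j ≤ i then x ⟨(i, j), h⟩ else 0

/-- The global chart of `T(n, ℝ)`: a matrix is sent to its entries on or below the diagonal. -/
def coords {n : ℕ} (g : LowerTriangularGroup n) : Model n :=
  WithLp.toLp 2 fun p => (g : GL (Fin n) ℝ) p.1.1 p.1.2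

theorem toMatrix_coords {n : ℕ} (g : LowerTriangularGroup n) :
    toMatrix (coords g) = ((g : GL (Fin n) ℝ) : Matrix (Fin n) (Fin n) ℝ) := by
  ext i j
  by_cases h : j ≤ i
  · simp [toMatrix, coords, h]
  · simp only [toMatrix, Matrix.of_apply, h, dite_false]
    exact (g.2.1 i j (not_le.mp h)).symm

theorem contDiff_toMatrix_apply {n : ℕ} (i j : Fin n) :
    ContDiff ℝ ∞ fun x : Model n => toMatrix x i j := by
  by_cases h : j ≤ i
  · simp only [toMatrix, Matrix.of_apply, h, dite_true]
    fun_prop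
  · simp only [toMatrix, Matrix.of_apply, h, dite_false]
    fun_prop

theorem contDiff_det_toMatrix {n m : ℕ} (f : Model n → Matrix (Fin m) (Fin m) ℝ)
    (hf : ∀ i j, ContDiff ℝ ∞ fun x => f x i j) :
    ContDiff ℝ ∞ fun x : Model n => (f x).det := by
  simp only [Matrix.det_apply]
  refine ContDiff.sum fun σ _ => ?_
  refine ContDiff.const_smul _ (contDiff_prod fun i _ => hf _ _)

theorem det_toMatrix {n : ℕ} (x : Model n) :
    (toMatrix x).det = ∏ i, x ⟨(i, i), le_rfl⟩ := by
  rw [Matrix.det_of_isLowerTriangular]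
  · simp [toMatrix]
  · intro i j h
    have : ¬ j ≤ i := not_le.mpr h
    simp [toMatrix, this]

theorem contDiffAt_inv_toMatrix_apply {n : ℕ} (x : Model n)
    (hx : (toMatrix x).det ≠ 0) (i j : Fin n) :
    ContDiffAt ℝ ∞ (fun x : Model n => (toMatrix x)⁻¹ i j) x := by
  have h1 : ContDiff ℝ ∞ fun x : Model n => (toMatrix x).det :=
    contDiff_det_toMatrix _ contDiff_toMatrix_apply
  have h2 : ContDiff ℝ ∞ fun x : Model n => (toMatrix x).adjugate i j := by
    simp only [Matrix.adjugate_apply]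
    refine contDiff_det_toMatrix _ fun k l => ?_
    by_cases hk : k = j
    · subst hk
      simp only [Matrix.updateRow_self]
      fun_prop
    · simp only [Matrix.updateRow_ne hk]
      exact contDiff_toMatrix_apply k l
  have h3 : (fun x : Model n => (toMatrix x)⁻¹ i j) =
      fun x : Model n => ((toMatrix x).det)⁻¹ * (toMatrix x).adjugate i j := by
    funext x
    rw [Matrix.inv_def, Matrix.smul_apply, Ring.inverse_eq_inv', smul_eq_mul]
  rw [h3]
  exact (h1.contDiffAt.inv hx).mul h2.contDiffAt

theorem det_coords_ne_zero {n : ℕ} (g : LowerTriangularGroup n) :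
    (toMatrix (coords g)).det ≠ 0 := by
  rw [toMatrix_coords]
  exact ((Matrix.isUnit_iff_isUnit_det _).mp (g : GL (Fin n) ℝ).isUnit).ne_zero

theorem continuous_coords {n : ℕ} : Continuous (coords (n := n)) := by
  refine (PiLp.continuous_toLp 2 _).comp (continuous_pi fun p => ?_)
  have h : Continuous fun g : LowerTriangularGroup n =>
      ((g : GL (Fin n) ℝ) : Matrix (Fin n) (Fin n) ℝ) :=
    Units.continuous_val.comp continuous_subtype_val
  exact h.matrix_elem p.1.1 p.1.2

theorem injective_coords {n : ℕ} : Function.Injective (coords (n := n)) := by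
  intro g h e
  apply Subtype.ext
  apply Units.ext
  rw [← toMatrix_coords, ← toMatrix_coords, e]

theorem range_coords {n : ℕ} :
    Set.range (coords (n := n)) = {x | ∀ i : Fin n, 0 < x ⟨(i, i), le_rfl⟩} := by
  ext x
  constructor
  · rintro ⟨g, rfl⟩ i
    exact g.2.2 i
  · intro hx
    have hdet : (toMatrix x).det ≠ 0 := by
      rw [det_toMatrix]
      exact (Finset.prod_pos fun i _ => hx i).ne'
    refine ⟨⟨Matrix.GeneralLinearGroup.mkOfDetNeZero (toMatrix x) hdet, ?_, ?_⟩, ?_⟩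
    · intro i j h
      change toMatrix x i j = 0
      simp [toMatrix, not_le.mpr h]
    · intro i
      change 0 < toMatrix x i i
      simpa [toMatrix] using hx i
    · ext p
      change toMatrix x p.1.1 p.1.2 = x p
      have := p.2
      simp [toMatrix, this]

theorem isOpenEmbedding_coords {n : ℕ} :
    Topology.IsOpenEmbedding (coords (n := n)) := by
  refine ⟨⟨⟨le_antisymm continuous_coords.le_induced ?_⟩, injective_coords⟩, ?_⟩
  · rw [← continuous_id_iff_le]
    have hc : Continuous[TopologicalSpace.induced (coords (n := n)) inferInstance, _]
      (coords (n := n)) := continuous_induced_dom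
    generalize TopologicalSpace.induced (coords (n := n)) inferInstance = t at hc ⊢
    refine continuous_induced_rng.2 (Units.continuous_iff.2 ⟨?_, ?_⟩)
    · refine continuous_matrix fun i j => ?_
      have := (contDiff_toMatrix_apply (n := n) i j).continuous.comp hc
      simpa [Function.comp_def, toMatrix_coords] using this
    · refine continuous_matrix fun i j => ?_
      rw [continuous_iff_continuousAt]
      intro g
      have := ContinuousAt.comp (f := coords (n := n)) (x := g)
        (contDiffAt_inv_toMatrix_apply _ (det_coords_ne_zero g) i j).continuousAt hc.continuousAt
      simpa [Function.comp_def, toMatrix_coords] using this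
  · rw [range_coords, Set.ofPred_forall]
    exact isOpen_iInter_of_finite fun i => isOpen_lt continuous_const (by fun_prop)

/-- `T(n, ℝ)` carries the topology induced from `GL(n, ℝ)`, and the smooth structure of an open
subset of the vector space of lower triangular matrices. -/
instance (n : ℕ) : ChartedSpace (Model n) (LowerTriangularGroup n) :=
  isOpenEmbedding_coords.singletonChartedSpace

theorem contMDiff_coords {n : ℕ} :
    ContMDiff 𝓘(ℝ, Model n) 𝓘(ℝ, Model n) ∞ (coords (n := n)) :=
  contMDiff_isOpenEmbedding isOpenEmbedding_coords

instance (n : ℕ) : IsManifold 𝓘(ℝ, Model n) ∞ (LowerTriangularGroup n) :=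
  isOpenEmbedding_coords.isManifold_singleton

theorem coords_mul {n : ℕ} (g h : LowerTriangularGroup n) (p : Pos n) :
    coords (g * h) p = (toMatrix (coords g) * toMatrix (coords h)) p.1.1 p.1.2 := by
  rw [toMatrix_coords, toMatrix_coords]
  rfl

theorem coords_inv {n : ℕ} (g : LowerTriangularGroup n) (p : Pos n) :
    coords g⁻¹ p = (toMatrix (coords g))⁻¹ p.1.1 p.1.2 := by
  rw [toMatrix_coords, ← Matrix.coe_units_inv]
  rfl

instance (n : ℕ) : LieGroup 𝓘(ℝ, Model n) ∞ (LowerTriangularGroup n) where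
  contMDiff_mul := by
    apply ContMDiff.of_comp_isOpenEmbedding isOpenEmbedding_coords
    have h1 : ContMDiff (𝓘(ℝ, Model n).prod 𝓘(ℝ, Model n)) 𝓘(ℝ, Model n × Model n) ∞
        (fun x : LowerTriangularGroup n × LowerTriangularGroup n => (coords x.1, coords x.2)) :=
      (contMDiff_coords.comp contMDiff_fst).prodMk_space (contMDiff_coords.comp contMDiff_snd)
    have h2 : ContDiff ℝ ∞ (fun x : Model n × Model n =>
        (WithLp.toLp 2 fun p : Pos n => (toMatrix x.1 * toMatrix x.2) p.1.1 p.1.2 : Model n)) := by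
      rw [contDiff_euclidean]
      intro p
      simp only [Matrix.mul_apply]
      exact ContDiff.sum fun k _ => ((contDiff_toMatrix_apply _ _).comp contDiff_fst).mul
        ((contDiff_toMatrix_apply _ _).comp contDiff_snd)
    have h3 := h2.contMDiff.comp h1
    refine h3.congr fun x => ?_
    ext p
    exact coords_mul _ _ _
  contMDiff_inv := by
    apply ContMDiff.of_comp_isOpenEmbedding isOpenEmbedding_coords
    intro g
    have h2 : ContDiffAt ℝ ∞ (fun x : Model n =>
        (WithLp.toLp 2 fun p : Pos n => (toMatrix x)⁻¹ p.1.1 p.1.2 : Model n)) (coords g) := by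
      rw [contDiffAt_euclidean]
      intro p
      exact contDiffAt_inv_toMatrix_apply _ (det_coords_ne_zero g) _ _
    have h3 := h2.contMDiffAt.comp g contMDiff_coords.contMDiffAt
    refine h3.congr_of_eventuallyEq (Filter.Eventually.of_forall fun x => ?_)
    ext p
    exact coords_inv _ _


/-- The Frobenius inner product `tr (X Yᵗ)`. -/
def frobenius {n : ℕ} (X Y : Matrix (Fin n) (Fin n) ℝ) : ℝ := (X * Y.transpose).trace

/-- The diagonal part of a matrix. -/
def diagPart {n : ℕ} (X : Matrix (Fin n) (Fin n) ℝ) : Matrix (Fin n) (Fin n) ℝ :=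
  Matrix.diagonal X.diag

/-- The inner product on lower triangular matrices which is twice the Frobenius inner product on
diagonal matrices and the Frobenius inner product on strictly lower triangular matrices, with
these two subspaces orthogonal. -/
def einsteinForm {n : ℕ} (X Y : Matrix (Fin n) (Fin n) ℝ) : ℝ :=
  2 * frobenius (diagPart X) (diagPart Y) + frobenius (X - diagPart X) (Y - diagPart Y)

theorem frobenius_eq {n : ℕ} (X Y : Matrix (Fin n) (Fin n) ℝ) :
    frobenius X Y = ∑ i, ∑ j, X i j * Y i j := by
  simp [frobenius, Matrix.trace, Matrix.mul_apply]

theorem frobenius_comm {n : ℕ} (X Y : Matrix (Fin n) (Fin n) ℝ) :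
    frobenius X Y = frobenius Y X := by
  simp only [frobenius_eq, mul_comm]

theorem frobenius_self_nonneg {n : ℕ} (X : Matrix (Fin n) (Fin n) ℝ) : 0 ≤ frobenius X X := by
  rw [frobenius_eq]
  exact Finset.sum_nonneg fun i _ => Finset.sum_nonneg fun j _ => mul_self_nonneg _

theorem eq_zero_of_frobenius_self {n : ℕ} {X : Matrix (Fin n) (Fin n) ℝ}
    (h : frobenius X X = 0) : X = 0 := by
  rw [frobenius_eq] at h
  ext i j
  have h1 := (Finset.sum_eq_zero_iff_of_nonneg (f := fun i => ∑ j, X i j * X i j)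
    fun i _ => Finset.sum_nonneg fun j _ => mul_self_nonneg (X i j)).1 h i (Finset.mem_univ i)
  have h2 := (Finset.sum_eq_zero_iff_of_nonneg (f := fun j => X i j * X i j)
    fun j _ => mul_self_nonneg (X i j)).1 h1 j (Finset.mem_univ j)
  exact mul_self_eq_zero.1 h2

theorem einsteinForm_comm {n : ℕ} (X Y : Matrix (Fin n) (Fin n) ℝ) :
    einsteinForm X Y = einsteinForm Y X := by
  rw [einsteinForm, einsteinForm, frobenius_comm, frobenius_comm (_ - _)]

theorem einsteinForm_add {n : ℕ} (X X' Y : Matrix (Fin n) (Fin n) ℝ) :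
    einsteinForm (X + X') Y = einsteinForm X Y + einsteinForm X' Y := by
  have h1 : diagPart (X + X') = diagPart X + diagPart X' := by simp [diagPart]
  have h2 : X + X' - (diagPart X + diagPart X') = X - diagPart X + (X' - diagPart X') := by abel
  simp only [einsteinForm, h1, h2, frobenius, add_mul, Matrix.trace_add]
  ring

theorem einsteinForm_smul {n : ℕ} (r : ℝ) (X Y : Matrix (Fin n) (Fin n) ℝ) :
    einsteinForm (r • X) Y = r * einsteinForm X Y := by
  have h1 : diagPart (r • X) = r • diagPart X := by simp [diagPart]
  simp only [einsteinForm, h1, ← smul_sub, frobenius, Matrix.smul_mul, Matrix.trace_smul,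
    smul_eq_mul]
  ring

theorem toMatrix_add {n : ℕ} (x y : Model n) : toMatrix (x + y) = toMatrix x + toMatrix y := by
  ext i j
  by_cases h : j ≤ i <;> simp [toMatrix, h]

theorem toMatrix_smul {n : ℕ} (r : ℝ) (x : Model n) : toMatrix (r • x) = r • toMatrix x := by
  ext i j
  by_cases h : j ≤ i <;> simp [toMatrix, h]

/-- The inner product `einsteinForm`, multiplied by `c`, on the Lie algebra of `T(n, ℝ)`. Because
`T(n, ℝ)` has the global chart `coords`, a tangent vector at the identity is the list `x` of the
entries of a lower triangular matrix `toMatrix x`. -/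
def einsteinInner (n : ℕ) (c : ℝ) : Model n →L[ℝ] Model n →L[ℝ] ℝ :=
  LinearMap.toContinuousBilinearMap (LinearMap.mk₂ ℝ
    (fun x y : Model n => c * einsteinForm (toMatrix x) (toMatrix y))
    (fun x x' y => by rw [toMatrix_add, einsteinForm_add, mul_add])
    (fun r x y => by rw [toMatrix_smul, einsteinForm_smul, smul_eq_mul, mul_left_comm])
    (fun x y y' => by
      rw [toMatrix_add, einsteinForm_comm, einsteinForm_add, mul_add, einsteinForm_comm,
        einsteinForm_comm (toMatrix y')])
    (fun r x y => by
      rw [toMatrix_smul, einsteinForm_comm, einsteinForm_smul, smul_eq_mul, mul_left_comm,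
        einsteinForm_comm]))

theorem einsteinInner_apply (n : ℕ) (c : ℝ) (x y : Model n) :
    einsteinInner n c x y = c * einsteinForm (toMatrix x) (toMatrix y) := rfl

theorem einsteinInner_comm (n : ℕ) (c : ℝ) (x y : Model n) :
    einsteinInner n c x y = einsteinInner n c y x := by
  rw [einsteinInner_apply, einsteinInner_apply, einsteinForm_comm]

theorem einsteinInner_pos (n : ℕ) {c : ℝ} (hc : 0 < c)
    (x : Model n) (hx : x ≠ 0) :
    0 < einsteinInner n c x x := by
  rw [einsteinInner_apply]
  refine mul_pos hc (lt_of_le_of_ne ?_ fun h => hx ?_)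
  · exact add_nonneg (mul_nonneg zero_le_two (frobenius_self_nonneg _)) (frobenius_self_nonneg _)
  · have h1 := frobenius_self_nonneg (diagPart (toMatrix x))
    have h2 := frobenius_self_nonneg (toMatrix x - diagPart (toMatrix x))
    rw [einsteinForm] at h
    have h3 := eq_zero_of_frobenius_self (le_antisymm (by linarith) h1)
    have h4 := eq_zero_of_frobenius_self (le_antisymm (by linarith) h2)
    rw [h3, sub_zero] at h4
    refine PiLp.ext fun p => ?_
    have h5 := congrFun (congrFun h4 p.1.1) p.1.2
    have hp := p.2
    simpa [toMatrix, hp] using h5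

/-- The left-invariant Einstein (symmetric space) metric on `T(n, ℝ)`, scaled by `c`. -/
def einsteinMetric (n : ℕ) (c : ℝ) (hc : 0 < c) :
    SmoothMetric 𝓘(ℝ, Model n) (LowerTriangularGroup n) :=
  leftInvariantMetric 𝓘(ℝ, Model n) (einsteinInner n c) (einsteinInner_comm n c)
    (einsteinInner_pos n hc)

end LowerTriangularGroup

/-! ### Conditions on a metric Lie algebra -/

/-- A finite-dimensional real Lie algebra is completely solvable if it is solvable and all
eigenvalues of all `ad X` are real. -/
def IsCompletelySolvable (L : Type*) [LieRing L] [LieAlgebra ℝ L] [FiniteDimensional ℝ L] : Prop :=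
  LieAlgebra.IsSolvable L ∧ ∀ X : L, (LieAlgebra.ad ℝ L X).charpoly.Splits

/-- `N` is the nilradical of `L`, the largest ideal that is nilpotent as a Lie algebra. -/
def IsNilradical {L : Type*} [LieRing L] [LieAlgebra ℝ L] (N : LieIdeal ℝ L) : Prop :=
  LieRing.IsNilpotent N ∧ ∀ J : LieIdeal ℝ L, LieRing.IsNilpotent J → J ≤ N

/-- The metric Lie algebra `(L, B)` is a completely solvable sum `A + N`, where `N` is the nilradical
and `A` is an abelian subalgebra that acts fully reducibly on `N`, by symmetric maps on `L`, and
contains an element acting on `N` with positive eigenvalues. -/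
structure IsAdmissible {L : Type*} [LieRing L] [LieAlgebra ℝ L] [FiniteDimensional ℝ L]
    (B : L → L → ℝ) (A : LieSubalgebra ℝ L) (N : LieIdeal ℝ L) : Prop where
  sup_eq_top : A.toSubmodule ⊔ N.toSubmodule = ⊤
  completelySolvable : IsCompletelySolvable L
  nilradical : IsNilradical N
  abelian : IsLieAbelian A
  /-- Every `A`-stable subspace of `N` has an `A`-stable complement in `N`. -/
  fullyReducible : ComplementedLattice (LieSubmodule ℝ A N)
  symmetric : ∀ a ∈ A, ∀ X Y : L, B ⁅a, X⁆ Y = B X ⁅a, Y⁆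
  /-- For some `a` in `A`, the eigenvalues of `ad a` on `N` are positive. -/
  positive : ∃ a ∈ A, ∀ μ : ℝ, (LieModule.toEnd ℝ L N a).HasEigenvalue μ → 0 < μ

end

noncomputable section

set_option linter.unusedSectionVars false

/-! ### Orthonormal bases of joint eigenvectors -/

theorem exists_joint_eigenvector {V : Type*} [NormedAddCommGroup V] [InnerProductSpace ℝ V]
    [FiniteDimensional ℝ V] {T : Set (Module.End ℝ V)} (hsymm : ∀ f ∈ T, f.IsSymmetric)
    (hcomm : ∀ f ∈ T, ∀ g ∈ T, Commute f g) (k : ℕ) (W : Submodule ℝ V)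
    (hW : ∀ f ∈ T, ∀ x ∈ W, f x ∈ W) (hk : Module.finrank ℝ W = k) (hW0 : W ≠ ⊥) :
    ∃ v ∈ W, v ≠ 0 ∧ ∀ f ∈ T, ∃ μ : ℝ, f v = μ • v := by
  induction k using Nat.strong_induction_on generalizing W with
  | _ k ih =>
    by_cases hs : ∀ f ∈ T, ∃ μ : ℝ, ∀ x ∈ W, f x = μ • x
    · obtain ⟨v, hv, hv0⟩ := W.exists_mem_ne_zero_of_ne_bot hW0
      exact ⟨v, hv, hv0, fun f hf => (hs f hf).imp fun μ h => h v hv⟩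
    · push Not at hs
      obtain ⟨f, hf, hns⟩ := hs
      have : Nontrivial W := Submodule.nontrivial_iff_ne_bot.2 hW0
      have hfs := (hsymm f hf).restrict_invariant (hW f hf)
      obtain ⟨v, hv⟩ := hfs.hasEigenvalue_iSup_of_finiteDimensional.exists_hasEigenvector
      generalize (↑(⨆ x : { x : W // x ≠ 0 }, _) : ℝ) = μ at hv
      have hv1 : f v = μ • (v : V) := congrArg Subtype.val hv.apply_eq_smul
      obtain ⟨x, hx, hxμ⟩ := hns μ
      have hlt : W ⊓ Module.End.eigenspace f μ < W := by
        refine lt_of_le_of_ne inf_le_left fun h => hxμ ?_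
        rw [← h] at hx
        exact Module.End.mem_eigenspace_iff.1 hx.2
      obtain ⟨u, hu, hu0, hu1⟩ := ih _ (hk ▸ Submodule.finrank_lt_finrank_of_lt hlt)
        (W ⊓ Module.End.eigenspace f μ) (fun g hg x hx => ⟨hW g hg x hx.1, by
          have h1 := Module.End.mem_eigenspace_iff.1 hx.2
          refine Module.End.mem_eigenspace_iff.2 ?_
          have h2 := LinearMap.congr_fun (hcomm f hf g hg).eq x
          simp only [Module.End.mul_apply] at h2
          rw [h2, h1, map_smul]⟩) rfl
        (Submodule.ne_bot_iff _ |>.2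
          ⟨v, ⟨v.2, Module.End.mem_eigenspace_iff.2 hv1⟩, fun h => hv.2 (Subtype.ext h)⟩)
      exact ⟨u, hu.1, hu0, hu1⟩

theorem exists_orthonormal_joint_eigenvectors {V : Type*} [NormedAddCommGroup V]
    [InnerProductSpace ℝ V] [FiniteDimensional ℝ V] {T : Set (Module.End ℝ V)}
    (hsymm : ∀ f ∈ T, f.IsSymmetric) (hcomm : ∀ f ∈ T, ∀ g ∈ T, Commute f g) (k : ℕ)
    (W : Submodule ℝ V) (hW : ∀ f ∈ T, ∀ x ∈ W, f x ∈ W) (hk : Module.finrank ℝ W = k) :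
    ∃ e : Fin k → V, (∀ i, e i ∈ W) ∧ Orthonormal ℝ e ∧
      ∀ f ∈ T, ∀ i, ∃ μ : ℝ, f (e i) = μ • e i := by
  induction k generalizing W with
  | zero => exact ⟨Fin.elim0, fun i => i.elim0, ⟨fun i => i.elim0, fun i => i.elim0⟩,
      fun _ _ i => i.elim0⟩
  | succ k ih =>
    have hW0 : W ≠ ⊥ := by
      rintro rfl
      simp at hk
    obtain ⟨v, hv, hv0, hvT⟩ := exists_joint_eigenvector hsymm hcomm _ W hW rfl hW0
    have hinv : ∀ f ∈ T, ∀ x ∈ W ⊓ (ℝ ∙ v)ᗮ, f x ∈ W ⊓ (ℝ ∙ v)ᗮ := by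
      intro f hf x hx
      refine ⟨hW f hf x hx.1, ?_⟩
      have h1 := Submodule.mem_orthogonal_singleton_iff_inner_right.1 hx.2
      obtain ⟨μ, hμ⟩ := hvT f hf
      refine Submodule.mem_orthogonal_singleton_iff_inner_right.2 ?_
      rw [← hsymm f hf v x, hμ, inner_smul_left, h1, mul_zero]
    have hle : (ℝ ∙ v) ≤ W := (Submodule.span_singleton_le_iff_mem _ _).2 hv
    have hfin : Module.finrank ℝ (W ⊓ (ℝ ∙ v)ᗮ : Submodule ℝ V) = k := by
      have h1 := Submodule.finrank_add_inf_finrank_orthogonal hle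
      rw [finrank_span_singleton hv0, hk, inf_comm] at h1
      omega
    obtain ⟨e, heW, heo, heT⟩ := ih _ hinv hfin
    refine ⟨Fin.cons (‖v‖⁻¹ • v) e, ?_, ?_, ?_⟩
    · intro i
      refine Fin.cases ?_ (fun j => ?_) i
      · simpa using W.smul_mem _ hv
      · simpa using (heW j).1
    · have h0 : ∀ j, inner ℝ v (e j) = 0 := fun j =>
        Submodule.mem_orthogonal_singleton_iff_inner_right.1 (heW j).2
      rw [orthonormal_iff_ite] at heo ⊢
      intro i j
      refine Fin.cases ?_ (fun i => ?_) i <;> refine Fin.cases ?_ (fun j => ?_) j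
      · simp [norm_smul, hv0]
      · simp [inner_smul_left, h0, (Fin.succ_ne_zero j).symm]
      · rw [real_inner_comm]
        simp [inner_smul_left, h0, Fin.succ_ne_zero i]
      · simpa using heo i j
    · intro f hf i
      refine Fin.cases ?_ (fun j => ?_) i
      · obtain ⟨μ, hμ⟩ := hvT f hf
        refine ⟨μ, ?_⟩
        rw [Fin.cons_zero, map_smul, hμ, smul_comm]
      · simpa using heT f hf j

variable {L : Type*} [LieRing L] [LieAlgebra ℝ L]

/-- `e` is a `B`-orthonormal basis of `N` of joint eigenvectors of `A`, ordered by the eigenvalues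
of the element `a₀` of `A`, which are positive. -/
structure IsWeightBasis (B : L →ₗ[ℝ] L →ₗ[ℝ] ℝ) (A : LieSubalgebra ℝ L) (N : LieIdeal ℝ L)
    (a₀ : L) {m : ℕ} (e : Fin m → L) (w : Fin m → L →ₗ[ℝ] ℝ) : Prop where
  symm : ∀ X Y, B X Y = B Y X
  pos : ∀ X, X ≠ 0 → 0 < B X X
  abelian : ∀ a ∈ A, ∀ b ∈ A, ⁅a, b⁆ = 0
  exists_add : ∀ X, ∃ a ∈ A, ∃ Y ∈ N, X = a + Y
  base_mem : a₀ ∈ A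
  orthogonal : ∀ a ∈ A, ∀ Y ∈ N, B a Y = 0
  lie_symm : ∀ a ∈ A, ∀ X Y, B ⁅a, X⁆ Y = B X ⁅a, Y⁆
  mem : ∀ i, e i ∈ N
  orthonormal : ∀ i j, B (e i) (e j) = if i = j then 1 else 0
  sum_eq : ∀ Y ∈ N, Y = ∑ i, B (e i) Y • e i
  lie_eq : ∀ a ∈ A, ∀ i, ⁅a, e i⁆ = w i a • e i
  weight_pos : ∀ i, 0 < w i a₀
  monotone : Monotone fun i => w i a₀

theorem IsAdmissible.exists_isWeightBasis [FiniteDimensional ℝ L] (B : L →ₗ[ℝ] L →ₗ[ℝ] ℝ)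
    (hsymm : ∀ X Y, B X Y = B Y X) (hpos : ∀ X, X ≠ 0 → 0 < B X X) {A : LieSubalgebra ℝ L}
    {N : LieIdeal ℝ L} (h : IsAdmissible (fun X Y => B X Y) A N) :
    ∃ (a₀ : L) (m : ℕ) (e : Fin m → L) (w : Fin m → L →ₗ[ℝ] ℝ), IsWeightBasis B A N a₀ e w := by
  have habel : ∀ a ∈ A, ∀ b ∈ A, ⁅a, b⁆ = 0 := by
    intro a ha b hb
    have := h.abelian
    exact congrArg Subtype.val (LieModule.IsTrivial.trivial (⟨a, ha⟩ : A) (⟨b, hb⟩ : A))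
  have hadd : ∀ X, ∃ a ∈ A, ∃ Y ∈ N, X = a + Y := by
    intro X
    have hX : X ∈ A.toSubmodule ⊔ N.toSubmodule := by rw [h.sup_eq_top]; trivial
    obtain ⟨a, ha, Y, hY, rfl⟩ := Submodule.mem_sup.1 hX
    exact ⟨a, ha, Y, hY, rfl⟩
  obtain ⟨a₀, ha₀, hev⟩ := h.positive
  have hnn : ∀ X, 0 ≤ B X X := fun X => by
    by_cases hX : X = 0
    · simp [hX]
    · exact (hpos X hX).le
  let w (u : L) : L →ₗ[ℝ] ℝ := (B.flip u).comp ((LieModule.toEnd ℝ L L : L →ₗ[ℝ] Module.End ℝ L).flip u)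
  let core : InnerProductSpace.Core ℝ L :=
    { inner := fun X Y => B X Y
      conj_inner_symm := fun X Y => by simpa using hsymm Y X
      re_inner_nonneg := fun X => by simpa using hnn X
      add_left := fun X Y Z => by simp
      smul_left := fun X Y r => by simp
      definite := fun X hX => by
        by_contra h0
        exact (hpos X h0).ne' hX }
  let : NormedAddCommGroup L := core.toNormedAddCommGroup
  let : InnerProductSpace ℝ L := .ofCore core.toCore
  have hin : ∀ X Y : L, inner ℝ X Y = B X Y := fun _ _ => rfl
  obtain ⟨e, heN, heo, heT⟩ := exists_orthonormal_joint_eigenvectors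
    (T := {f : Module.End ℝ L | ∃ a ∈ A, f = LieAlgebra.ad ℝ L a})
    (by
      rintro _ ⟨a, ha, rfl⟩ X Y
      exact h.symmetric a ha X Y)
    (by
      rintro _ ⟨a, ha, rfl⟩ _ ⟨b, hb, rfl⟩
      refine LinearMap.ext fun X => ?_
      have := leibniz_lie a b X
      simpa [habel a ha b hb] using this)
    (Module.finrank ℝ N.toSubmodule) N.toSubmodule
    (by
      rintro _ ⟨a, ha, rfl⟩ X hX
      exact N.lie_mem hX) rfl
  let c : Fin (Module.finrank ℝ N.toSubmodule) → ℝ := fun i => B ⁅a₀, e i⁆ (e i)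
  have heo' : ∀ i j, B (e i) (e j) = if i = j then 1 else 0 := fun i j =>
    orthonormal_iff_ite.1 heo i j
  have hlie : ∀ a ∈ A, ∀ i, ⁅a, e i⁆ = B ⁅a, e i⁆ (e i) • e i := by
    intro a ha i
    obtain ⟨μ, hμ⟩ := heT _ ⟨a, ha, rfl⟩ i
    have hμ' : ⁅a, e i⁆ = μ • e i := hμ
    rw [hμ']
    simp [heo']
  have hc : ∀ i, 0 < c i := by
    intro i
    refine hev (c i) ?_
    refine Module.End.hasEigenvalue_of_hasEigenvector (x := (⟨e i, heN i⟩ : N)) ⟨?_, ?_⟩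
    · rw [Module.End.mem_eigenspace_iff]
      exact Subtype.ext (hlie a₀ ha₀ i)
    · intro h0
      have := heo' i i
      rw [show e i = 0 from congrArg Subtype.val h0] at this
      simp at this
  have hsum : ∀ Y ∈ N, Y = ∑ i, B (e i) Y • e i := by
    intro Y hY
    let e' : Fin (Module.finrank ℝ N.toSubmodule) → N.toSubmodule := fun i => ⟨e i, heN i⟩
    have he' : Orthonormal ℝ e' := by
      rw [orthonormal_iff_ite]
      exact fun i j => heo' i j
    have hspan : ⊤ ≤ Submodule.span ℝ (Set.range e') :=
      (he'.linearIndependent.span_eq_top_of_card_eq_finrank' (by simp)).ge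
    have h1 := (OrthonormalBasis.mk he' hspan).sum_repr ⟨Y, hY⟩
    have h2 := congrArg Subtype.val h1
    simp only [OrthonormalBasis.repr_apply_apply, OrthonormalBasis.coe_mk] at h2
    rw [Submodule.coe_sum] at h2
    exact h2.symm
  have horth : ∀ a ∈ A, ∀ Y ∈ N, B a Y = 0 := by
    intro a ha Y hY
    have h1 : ∀ i, B a (e i) = 0 := by
      intro i
      have h2 := h.symmetric a₀ ha₀ a (e i)
      simp only [habel a₀ ha₀ a ha] at h2
      rw [hlie a₀ ha₀ i] at h2
      simp only [map_zero, LinearMap.zero_apply, map_smul, smul_eq_mul] at h2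
      exact (mul_eq_zero.1 h2.symm).resolve_left (hc i).ne'
    rw [hsum Y hY]
    simp [h1]
  let σ := Tuple.sort c
  refine ⟨a₀, _, e ∘ σ, fun i => w (e (σ i)), ?_⟩
  exact
    { symm := hsymm
      pos := hpos
      abelian := habel
      exists_add := hadd
      base_mem := ha₀
      orthogonal := horth
      lie_symm := h.symmetric
      mem := fun i => heN _
      orthonormal := fun i j => by simp [heo']
      sum_eq := fun Y hY => by
        refine (hsum Y hY).trans ?_
        exact (Equiv.sum_comp σ fun i => B (e i) Y • e i).symm
      lie_eq := fun a ha i => hlie a ha (σ i)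
      weight_pos := fun i => hc (σ i)
      monotone := Tuple.monotone_sort c }

theorem exists_form_apply_le {V : Type*} [AddCommGroup V] [Module ℝ V] [FiniteDimensional ℝ V]
    (B : V →ₗ[ℝ] V →ₗ[ℝ] ℝ) (hsymm : ∀ X Y, B X Y = B Y X) (hpos : ∀ X, X ≠ 0 → 0 < B X X)
    (T : V →ₗ[ℝ] V) : ∃ C : ℝ, 0 ≤ C ∧ ∀ X, B (T X) (T X) ≤ C * B X X := by
  let core : InnerProductSpace.Core ℝ V :=
    { inner := fun X Y => B X Y
      conj_inner_symm := fun X Y => by simpa using hsymm Y X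
      re_inner_nonneg := fun X => by
        by_cases hX : X = 0
        · simp [hX]
        · simpa using (hpos X hX).le
      add_left := fun X Y Z => by simp
      smul_left := fun X Y r => by simp
      definite := fun X hX => by
        by_contra h0
        exact (hpos X h0).ne' hX }
  let : NormedAddCommGroup V := core.toNormedAddCommGroup
  let : InnerProductSpace ℝ V := .ofCore core.toCore
  have hin : ∀ X : V, B X X = ‖X‖ ^ 2 := fun X => real_inner_self_eq_norm_sq X
  refine ⟨‖LinearMap.toContinuousLinearMap T‖ ^ 2, by positivity, fun X => ?_⟩
  rw [hin, hin, ← mul_pow]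
  gcongr
  exact (LinearMap.toContinuousLinearMap T).le_opNorm X

theorem sq_le_mul_of_forall_nonneg {V : Type*} [AddCommGroup V] [Module ℝ V]
    (R : V →ₗ[ℝ] V →ₗ[ℝ] ℝ) {X Y : V} (hXY : R X Y = R Y X) (hX : 0 < R X X)
    (h : 0 ≤ R (Y - (R X Y / R X X) • X) (Y - (R X Y / R X X) • X)) :
    R X Y ^ 2 / R X X ≤ R Y Y := by
  simp only [map_sub, map_smul, LinearMap.sub_apply, LinearMap.smul_apply, smul_eq_mul,
    ← hXY] at h
  have h1 : R X Y / R X X * R X X = R X Y := by field_simp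
  have h2 : R X Y ^ 2 / R X X = R X Y / R X X * R X Y := by ring
  rw [h1] at h
  linarith

variable {L : Type*} [LieRing L] [LieAlgebra ℝ L]

/-! ### Representations by matrices that are diagonal on a subalgebra -/

/-- `ρ` is a Lie algebra homomorphism to square matrices, with diagonal values on `A`. -/
structure IsDiagonalRep (A : LieSubalgebra ℝ L) {ι : Type*} [Fintype ι]
    (ρ : L →ₗ[ℝ] Matrix ι ι ℝ) : Prop where
  map_lie : ∀ X Y, ρ ⁅X, Y⁆ = ρ X * ρ Y - ρ Y * ρ X
  diag : ∀ a ∈ A, ∀ i j, i ≠ j → ρ a i j = 0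

/-- The pullback of the inner product that weights diagonal entries by `2` and other entries
by `1`. -/
def pullbackForm {ι : Type*} [Fintype ι] [DecidableEq ι] (ρ : L →ₗ[ℝ] Matrix ι ι ℝ) :
    L →ₗ[ℝ] L →ₗ[ℝ] ℝ :=
  LinearMap.mk₂ ℝ
    (fun X Y => ∑ i, ∑ j, (if i = j then 2 else 1) * (ρ X i j * ρ Y i j))
    (fun X X' Y => by
      simp only [map_add, Matrix.add_apply, ← Finset.sum_add_distrib]
      congr! 2
      ring)
    (fun r X Y => by
      simp only [map_smul, Matrix.smul_apply, Finset.mul_sum, smul_eq_mul]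
      congr! 2
      ring)
    (fun X Y Y' => by
      simp only [map_add, Matrix.add_apply, ← Finset.sum_add_distrib]
      congr! 2
      ring)
    (fun r X Y => by
      simp only [map_smul, Matrix.smul_apply, Finset.mul_sum, smul_eq_mul]
      congr! 2
      ring)

section

variable {ι κ : Type*} [Fintype ι] [DecidableEq ι] [Fintype κ] [DecidableEq κ]

theorem pullbackForm_apply (ρ : L →ₗ[ℝ] Matrix ι ι ℝ) (X Y : L) : pullbackForm ρ X Y =
    ∑ i, ∑ j, (if i = j then 2 else 1) * (ρ X i j * ρ Y i j) := rfl

theorem pullbackForm_comm (ρ : L →ₗ[ℝ] Matrix ι ι ℝ) (X Y : L) :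
    pullbackForm ρ X Y = pullbackForm ρ Y X := by
  simp only [pullbackForm_apply, mul_comm (ρ X _ _)]

theorem pullbackForm_reindex (ρ : L →ₗ[ℝ] Matrix ι ι ℝ) (σ : κ ≃ ι) (X Y : L) :
    pullbackForm ((Matrix.reindexLinearEquiv ℝ ℝ σ.symm σ.symm).toLinearMap ∘ₗ ρ) X Y =
      pullbackForm ρ X Y := by
  simp only [pullbackForm_apply]
  rw [← Equiv.sum_comp σ]
  congr! 1 with i
  rw [← Equiv.sum_comp σ]
  congr! 1 with j
  simp

/-- The direct sum of two matrix representations. -/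
def blockSum (ρ : L →ₗ[ℝ] Matrix ι ι ℝ) (τ : L →ₗ[ℝ] Matrix κ κ ℝ) :
    L →ₗ[ℝ] Matrix (ι ⊕ κ) (ι ⊕ κ) ℝ where
  toFun X := Matrix.fromBlocks (ρ X) 0 0 (τ X)
  map_add' X Y := by simp [Matrix.fromBlocks_add]
  map_smul' r X := by simp [Matrix.fromBlocks_smul]

theorem pullbackForm_blockSum (ρ : L →ₗ[ℝ] Matrix ι ι ℝ) (τ : L →ₗ[ℝ] Matrix κ κ ℝ) (X Y : L) :
    pullbackForm (blockSum ρ τ) X Y = pullbackForm ρ X Y + pullbackForm τ X Y := by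
  simp [pullbackForm_apply, blockSum]

theorem IsDiagonalRep.blockSum {A : LieSubalgebra ℝ L} {ρ : L →ₗ[ℝ] Matrix ι ι ℝ}
    {τ : L →ₗ[ℝ] Matrix κ κ ℝ} (hρ : IsDiagonalRep A ρ) (hτ : IsDiagonalRep A τ) :
    IsDiagonalRep A (blockSum ρ τ) where
  map_lie X Y := by
    simp [_root_.blockSum, hρ.map_lie, hτ.map_lie, Matrix.fromBlocks_multiply, sub_eq_add_neg,
      Matrix.fromBlocks_neg, Matrix.fromBlocks_add]
  diag a ha i j hij := by
    rcases i with i | i <;> rcases j with j | j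
    · exact hρ.diag a ha i j fun h => hij (h ▸ rfl)
    · rfl
    · rfl
    · exact hτ.diag a ha i j fun h => hij (h ▸ rfl)

theorem IsDiagonalRep.lie_apply {A : LieSubalgebra ℝ L} {ρ : L →ₗ[ℝ] Matrix ι ι ℝ}
    (hρ : IsDiagonalRep A ρ) {a : L} (ha : a ∈ A) (X : L) (i j : ι) :
    ρ ⁅a, X⁆ i j = (ρ a i i - ρ a j j) * ρ X i j := by
  rw [hρ.map_lie, Matrix.sub_apply, Matrix.mul_apply, Matrix.mul_apply,
    Finset.sum_eq_single i, Finset.sum_eq_single j]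
  · ring
  · intro l _ hl
    rw [hρ.diag a ha l j hl, mul_zero]
  · simp
  · intro l _ hl
    rw [hρ.diag a ha i l hl.symm, zero_mul]
  · simp

theorem IsDiagonalRep.pullbackForm_lie {A : LieSubalgebra ℝ L} {ρ : L →ₗ[ℝ] Matrix ι ι ℝ}
    (hρ : IsDiagonalRep A ρ) {a : L} (ha : a ∈ A) (X Y : L) :
    pullbackForm ρ ⁅a, X⁆ Y = pullbackForm ρ X ⁅a, Y⁆ := by
  simp only [pullbackForm_apply, hρ.lie_apply ha]
  congr! 2
  ring

/-- The matrices of coefficients `ξ p ⁅X, v q⁆` of the adjoint representation. -/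
def coefficientMap (ξ : ι → L →ₗ[ℝ] ℝ) (v : ι → L) : L →ₗ[ℝ] Matrix ι ι ℝ where
  toFun X := Matrix.of fun p q => ξ p ⁅X, v q⁆
  map_add' X Y := by ext; simp
  map_smul' r X := by ext; simp

theorem coefficientMap_apply (ξ : ι → L →ₗ[ℝ] ℝ) (v : ι → L) (X : L) (p q : ι) :
    coefficientMap ξ v X p q = ξ p ⁅X, v q⁆ := rfl

theorem coefficientMap_lie {ξ : ι → L →ₗ[ℝ] ℝ} {v : ι → L} {N : LieIdeal ℝ L}
    (hv : ∀ (X : L) (q : ι), ⁅X, v q⁆ ∈ N)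
    (h : ∀ p, ∀ X : L, ∀ u ∈ N, ξ p ⁅X, u⁆ = ∑ r, ξ p ⁅X, v r⁆ * ξ r u) (X Y : L) :
    coefficientMap ξ v ⁅X, Y⁆ = coefficientMap ξ v X * coefficientMap ξ v Y -
      coefficientMap ξ v Y * coefficientMap ξ v X := by
  ext p q
  simp only [Matrix.sub_apply, Matrix.mul_apply, coefficientMap_apply]
  rw [← h p X _ (hv Y q), ← h p Y _ (hv X q), lie_lie, map_sub]

end

namespace IsWeightBasis

variable {B : L →ₗ[ℝ] L →ₗ[ℝ] ℝ} {A : LieSubalgebra ℝ L} {N : LieIdeal ℝ L} {a₀ : L} {m : ℕ}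
  {e : Fin m → L} {w : Fin m → L →ₗ[ℝ] ℝ}

theorem nonneg (h : IsWeightBasis B A N a₀ e w) (X : L) : 0 ≤ B X X := by
  by_cases hX : X = 0
  · simp [hX]
  · exact (h.pos X hX).le

theorem lie_mem (h : IsWeightBasis B A N a₀ e w) (X Y : L) : ⁅X, Y⁆ ∈ N := by
  obtain ⟨a, ha, U, hU, rfl⟩ := h.exists_add X
  obtain ⟨b, hb, V, hV, rfl⟩ := h.exists_add Y
  rw [lie_add, add_lie, h.abelian a ha b hb, zero_add, ← lie_skew]
  exact N.add_mem (N.neg_mem (N.lie_mem hU)) (N.lie_mem hV)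

theorem induction_mem (h : IsWeightBasis B A N a₀ e w) {P : L →ₗ[ℝ] ℝ} (hP : ∀ i, P (e i) = 0)
    {Y : L} (hY : Y ∈ N) : P Y = 0 := by
  rw [h.sum_eq Y hY]
  simp [hP]

theorem coord_lie (h : IsWeightBasis B A N a₀ e w) {a : L} (ha : a ∈ A) (i : Fin m) (X : L) :
    B (e i) ⁅a, X⁆ = w i a * B (e i) X := by
  rw [← h.lie_symm a ha, h.lie_eq a ha]
  simp

theorem sq_coord_le (h : IsWeightBasis B A N a₀ e w) (i : Fin m) (X : L) :
    B (e i) X ^ 2 ≤ B X X := by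
  have h1 : B (e i) (e i) = 1 := by simp [h.orthonormal]
  have := sq_le_mul_of_forall_nonneg B (X := e i) (Y := X) (h.symm _ _) (by rw [h1]; exact one_pos)
    (h.nonneg _)
  rwa [h1, div_one] at this

section

variable {ι : Type*} [Fintype ι] [DecidableEq ι] {ρ : L →ₗ[ℝ] Matrix ι ι ℝ}

theorem apply_basis (h : IsWeightBasis B A N a₀ e w) (hρ : IsDiagonalRep A ρ) (l : Fin m)
    (i j : ι) : (ρ a₀ i i - ρ a₀ j j - w l a₀) * ρ (e l) i j = 0 := by
  have h1 := hρ.lie_apply h.base_mem (e l) i j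
  rw [h.lie_eq a₀ h.base_mem, map_smul, Matrix.smul_apply, smul_eq_mul] at h1
  linarith

theorem apply_diag (h : IsWeightBasis B A N a₀ e w) (hρ : IsDiagonalRep A ρ) {Y : L} (hY : Y ∈ N)
    (i : ι) : ρ Y i i = 0 := by
  refine h.induction_mem (P := (Matrix.entryLinearMap ℝ ℝ i i) ∘ₗ ρ) (fun l => ?_) hY
  have := h.apply_basis hρ l i i
  rw [sub_self, zero_sub] at this
  exact (mul_eq_zero.1 this).resolve_left (neg_ne_zero.2 (h.weight_pos l).ne')

theorem pullbackForm_eq_zero (h : IsWeightBasis B A N a₀ e w) (hρ : IsDiagonalRep A ρ) {a Y : L}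
    (ha : a ∈ A) (hY : Y ∈ N) : pullbackForm ρ a Y = 0 := by
  rw [pullbackForm_apply]
  refine Finset.sum_eq_zero fun i _ => Finset.sum_eq_zero fun j _ => ?_
  by_cases hij : i = j
  · subst hij
    rw [h.apply_diag hρ hY]
    simp
  · rw [hρ.diag a ha i j hij]
    simp

end

end IsWeightBasis

variable {L : Type*} [LieRing L] [LieAlgebra ℝ L]

namespace IsWeightBasis

variable {B : L →ₗ[ℝ] L →ₗ[ℝ] ℝ} {A : LieSubalgebra ℝ L} {N : LieIdeal ℝ L} {a₀ : L} {m : ℕ}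
  {e : Fin m → L} {w : Fin m → L →ₗ[ℝ] ℝ}

/-- The rows of the representation on a one-dimensional extension of a quotient of the adjoint
representation: below the level of `e k`, the coordinates, and on the level of `e k`, only `f`. -/
def rows (B : L →ₗ[ℝ] L →ₗ[ℝ] ℝ) (a₀ : L) (e : Fin m → L) (w : Fin m → L →ₗ[ℝ] ℝ) (D : ℝ)
    (k : Fin m) (f : L →ₗ[ℝ] ℝ) : Option (Fin m) → L →ₗ[ℝ] ℝ
  | none => 0
  | some i => if i = k then f else if w i a₀ < w k a₀ then D • B (e i) else 0

/-- The vectors dual to `rows`, together with a multiple of `a₀`. -/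
def cols (a₀ : L) (e : Fin m → L) (w : Fin m → L →ₗ[ℝ] ℝ) (D : ℝ)
    (k : Fin m) (f : L →ₗ[ℝ] ℝ) : Option (Fin m) → L
  | none => (w k a₀)⁻¹ • a₀
  | some i => if i = k then (f (e k))⁻¹ • e k else if w i a₀ < w k a₀ then D⁻¹ • e i else 0

theorem eq_zero_of_weight (h : IsWeightBasis B A N a₀ e w) {f : L →ₗ[ℝ] ℝ} {k i : Fin m}
    (hf : ∀ a ∈ A, ∀ X, f ⁅a, X⁆ = w k a * f X) (hki : w i a₀ ≠ w k a₀) : f (e i) = 0 := by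
  have h1 := hf a₀ h.base_mem (e i)
  rw [h.lie_eq a₀ h.base_mem, map_smul, smul_eq_mul] at h1
  have h2 : (w i a₀ - w k a₀) * f (e i) = 0 := by linarith
  exact (mul_eq_zero.1 h2).resolve_left (sub_ne_zero.2 hki)

theorem lie_eq_zero_of_weight (h : IsWeightBasis B A N a₀ e w) {f : L →ₗ[ℝ] ℝ} {k i j : Fin m}
    (hf : ∀ a ∈ A, ∀ X, f ⁅a, X⁆ = w k a * f X) (hki : w i a₀ + w j a₀ ≠ w k a₀) :
    f ⁅e i, e j⁆ = 0 := by
  have h1 := hf a₀ h.base_mem ⁅e i, e j⁆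
  rw [leibniz_lie, h.lie_eq a₀ h.base_mem, h.lie_eq a₀ h.base_mem, smul_lie, lie_smul, map_add,
    map_smul, map_smul, smul_eq_mul, smul_eq_mul] at h1
  have h2 : (w i a₀ + w j a₀ - w k a₀) * f ⁅e i, e j⁆ = 0 := by linarith
  exact (mul_eq_zero.1 h2).resolve_left (sub_ne_zero.2 hki)

theorem lie_rows (h : IsWeightBasis B A N a₀ e w) {D : ℝ} {f : L →ₗ[ℝ] ℝ} {k : Fin m}
    (hf : ∀ a ∈ A, ∀ X, f ⁅a, X⁆ = w k a * f X) {a : L} (ha : a ∈ A) (i : Fin m) (X : L) :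
    rows B a₀ e w D k f (some i) ⁅a, X⁆ = w i a * rows B a₀ e w D k f (some i) X := by
  simp only [rows]
  split_ifs with h1 h2
  · rw [h1, hf a ha]
  · simp only [LinearMap.smul_apply, h.coord_lie ha, smul_eq_mul]
    ring
  · simp

theorem rows_eq_zero_of_mem (h : IsWeightBasis B A N a₀ e w) {D : ℝ} {f : L →ₗ[ℝ] ℝ} {k i : Fin m}
    (p : Option (Fin m)) (hki : w k a₀ ≤ w i a₀) (hfi : f (e i) = 0) : rows B a₀ e w D k f p (e i) = 0 := by
  rcases p with _ | p
  · simp [rows]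
  · simp only [rows]
    split_ifs with h1 h2
    · exact hfi
    · have : p ≠ i := by
        rintro rfl
        linarith
      simp [h.orthonormal, this]
    · simp

theorem rows_lie_eq_zero (h : IsWeightBasis B A N a₀ e w) {D : ℝ} {f : L →ₗ[ℝ] ℝ} {k : Fin m}
    (hf : ∀ a ∈ A, ∀ X, f ⁅a, X⁆ = w k a * f X) {i j : Fin m} (p : Option (Fin m))
    (hki : w k a₀ < w i a₀ + w j a₀) : rows B a₀ e w D k f p ⁅e i, e j⁆ = 0 := by
  rcases p with _ | p
  · simp [rows]
  · by_cases hp : w p a₀ ≤ w k a₀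
    · exact h.lie_eq_zero_of_weight (k := p) (fun a ha X => h.lie_rows hf ha p X)
        (by linarith : w p a₀ < w i a₀ + w j a₀).ne'
    · have h1 : p ≠ k := by
        rintro rfl
        exact hp le_rfl
      have h2 : ¬ w p a₀ < w k a₀ := fun h => hp h.le
      simp [rows, h1, h2]

theorem rows_cols (h : IsWeightBasis B A N a₀ e w) {D : ℝ} (hD : D ≠ 0) {f : L →ₗ[ℝ] ℝ}
    {k : Fin m} (hf : ∀ a ∈ A, ∀ X, f ⁅a, X⁆ = w k a * f X) (hfk : f (e k) ≠ 0) (p q : Fin m) :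
    rows B a₀ e w D k f (some p) (cols a₀ e w D k f (some q)) =
      if p = q ∧ (p = k ∨ w p a₀ < w k a₀) then 1 else 0 := by
  simp only [cols]
  split_ifs with h1 h2 h3 h4 h5
  · obtain ⟨rfl, -⟩ := h2
    subst h1
    simp [rows, hfk]
  · subst h1
    have hp : p ≠ q := by
      rintro rfl
      simp at h2
    simp only [rows, hp, if_false, map_smul, smul_eq_mul]
    split_ifs <;> simp [h.orthonormal, hp]
  · obtain ⟨rfl, -⟩ := h4
    simp [rows, h1, h3, h.orthonormal, hD]
  · have hpq : p ≠ q := by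
      rintro rfl
      exact h4 ⟨rfl, Or.inr h3⟩
    by_cases hp : p = k
    · simp [rows, hp, h.eq_zero_of_weight hf h3.ne]
    · by_cases hlt : w p a₀ < w k a₀ <;> simp [rows, hp, hlt, h.orthonormal, hpq]
  · obtain ⟨rfl, hpk | hpk⟩ := h5
    · exact absurd hpk h1
    · exact absurd hpk h3
  · simp

theorem isDiagonalRep_coefficientMap (h : IsWeightBasis B A N a₀ e w) {D : ℝ} (hD : D ≠ 0)
    {f : L →ₗ[ℝ] ℝ} {k : Fin m} (hf : ∀ a ∈ A, ∀ X, f ⁅a, X⁆ = w k a * f X) (hfk : f (e k) ≠ 0) :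
    IsDiagonalRep A (coefficientMap (rows B a₀ e w D k f) (cols a₀ e w D k f)) := by
  refine ⟨coefficientMap_lie (fun X q => h.lie_mem _ _) ?_, ?_⟩
  · intro p X u hu
    have hlin : ∀ i, rows B a₀ e w D k f p ⁅X, e i⁆ = ∑ r, rows B a₀ e w D k f p
        ⁅X, cols a₀ e w D k f r⁆ * rows B a₀ e w D k f r (e i) := by
      intro i
      by_cases hi : w i a₀ < w k a₀
      · have hik : i ≠ k := by
          rintro rfl
          exact lt_irrefl _ hi
        rw [Fintype.sum_eq_single (some i)]
        · simp [rows, cols, hik, hi, h.orthonormal]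
          field_simp
        · rintro (_ | r) hr
          · simp [rows]
          · have hri : r ≠ i := fun h => hr (h ▸ rfl)
            have : rows B a₀ e w D k f (some r) (e i) = 0 := by
              by_cases hrk : r = k
              · simp [rows, hrk, h.eq_zero_of_weight hf hi.ne]
              · by_cases hlt : w r a₀ < w k a₀ <;> simp [rows, hrk, hlt, h.orthonormal, hri]
            rw [this, mul_zero]
      · push Not at hi
        rw [Fintype.sum_eq_single (some k)]
        · have hz : rows B a₀ e w D k f p ⁅X, e i - (f (e i) / f (e k)) • e k⁆ = 0 := by
            obtain ⟨a, ha, Y, hY, rfl⟩ := h.exists_add X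
            have hsum : rows B a₀ e w D k f p ⁅a, e i - (f (e i) / f (e k)) • e k⁆ = 0 := by
              have hwi : f (e i) ≠ 0 → w i a = w k a := by
                intro hfi
                have h1 := hf a ha (e i)
                rw [h.lie_eq a ha, map_smul, smul_eq_mul] at h1
                exact mul_right_cancel₀ hfi h1
              rw [lie_sub, lie_smul, h.lie_eq a ha, h.lie_eq a ha]
              rcases p with _ | p
              · simp [rows]
              · by_cases hfi : f (e i) = 0
                · rw [hfi, zero_div, zero_smul, sub_zero, map_smul,
                    h.rows_eq_zero_of_mem (some p) hi hfi, smul_zero]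
                · by_cases hpk : p = k
                  · simp only [rows, hpk, if_true, map_sub, map_smul, smul_eq_mul, hwi hfi]
                    field_simp
                    ring
                  · have h1 : w p a₀ < w k a₀ → p ≠ i := by
                      rintro h2 rfl
                      linarith
                    by_cases hlt : w p a₀ < w k a₀
                    · simp [rows, hpk, hlt, h.orthonormal, h1 hlt]
                    · simp [rows, hpk, hlt]
            rw [add_lie, map_add, hsum, zero_add]
            have := h.induction_mem (P := rows B a₀ e w D k f p ∘ₗ
              (LieModule.toEnd ℝ L L : L →ₗ[ℝ] Module.End ℝ L).flip
                (e i - (f (e i) / f (e k)) • e k)) (fun l => ?_) hY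
            · exact this
            · change rows B a₀ e w D k f p ⁅e l, e i - (f (e i) / f (e k)) • e k⁆ = 0
              have := h.weight_pos l
              rw [lie_sub, lie_smul, map_sub, map_smul, h.rows_lie_eq_zero hf p (by linarith),
                h.rows_lie_eq_zero hf p (by linarith)]
              simp
          rw [lie_sub, map_sub, sub_eq_zero] at hz
          rw [hz]
          simp [rows, cols]
          field_simp
        · rintro (_ | r) hr
          · simp [rows]
          · have hrk : r ≠ k := fun h => hr (h ▸ rfl)
            have : rows B a₀ e w D k f (some r) (e i) = 0 := by
              by_cases hlt : w r a₀ < w k a₀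
              · have : r ≠ i := by
                  rintro rfl
                  linarith
                simp [rows, hrk, hlt, h.orthonormal, this]
              · simp [rows, hrk, hlt]
            rw [this, mul_zero]
    have := h.induction_mem (P := rows B a₀ e w D k f p ∘ₗ
      (LieModule.toEnd ℝ L L X) - ∑ r, rows B a₀ e w D k f p
        ⁅X, cols a₀ e w D k f r⁆ • rows B a₀ e w D k f r) (fun i => ?_) hu
    · simp only [LinearMap.sub_apply, LinearMap.sum_apply, LinearMap.smul_apply, smul_eq_mul,
        LinearMap.comp_apply, LieModule.toEnd_apply_apply] at this
      exact sub_eq_zero.1 this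
    · simp only [LinearMap.sub_apply, LinearMap.sum_apply, LinearMap.smul_apply, smul_eq_mul,
        LinearMap.comp_apply, LieModule.toEnd_apply_apply]
      exact sub_eq_zero.2 (hlin i)
  · intro a ha p q hpq
    rw [coefficientMap_apply]
    rcases p with _ | p
    · simp [rows]
    · rw [h.lie_rows hf ha]
      rcases q with _ | q
      · have h1 := h.lie_rows (D := D) hf h.base_mem p a₀
        rw [lie_self, map_zero, eq_comm] at h1
        have h2 := (mul_eq_zero.1 h1).resolve_left (h.weight_pos p).ne'
        simp [cols, h2]
      · have : p ≠ q := fun h => hpq (h ▸ rfl)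
        rw [h.rows_cols hD hf hfk]
        simp [this]

section

variable {D : ℝ} {f : L →ₗ[ℝ] ℝ} {k : Fin m}

theorem rows_lie_base (h : IsWeightBasis B A N a₀ e w)
    (hf : ∀ a ∈ A, ∀ X, f ⁅a, X⁆ = w k a * f X) (p : Fin m) (Y : L) :
    rows B a₀ e w D k f (some p) ⁅Y, cols a₀ e w D k f none⁆ =
      -(w p a₀ / w k a₀ * rows B a₀ e w D k f (some p) Y) := by
  rw [← lie_skew, map_neg]
  simp only [cols, smul_lie, map_smul, h.lie_rows hf h.base_mem, smul_eq_mul]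
  ring

theorem lie_cols_eq_zero {ξ : L →ₗ[ℝ] ℝ} {Y : L} {q : Fin m} (hξ : ξ ⁅Y, e q⁆ = 0) :
    ξ ⁅Y, cols a₀ e w D k f (some q)⁆ = 0 := by
  simp only [cols]
  split_ifs with h1
  · rw [h1] at hξ
    simp [hξ]
  · simp [hξ]
  · simp

theorem coefficientMap_some_none (h : IsWeightBasis B A N a₀ e w)
    (hf : ∀ a ∈ A, ∀ X, f ⁅a, X⁆ = w k a * f X) (Y : L) :
    coefficientMap (rows B a₀ e w D k f) (cols a₀ e w D k f) Y (some k) none = -f Y := by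
  rw [coefficientMap_apply, h.rows_lie_base hf, div_self (h.weight_pos k).ne', one_mul]
  simp [rows]

theorem pullbackForm_coefficientMap_basis (h : IsWeightBasis B A N a₀ e w)
    (hf : ∀ a ∈ A, ∀ X, f ⁅a, X⁆ = w k a * f X) {i : Fin m} (hki : w k a₀ ≤ w i a₀) (Y : L) :
    pullbackForm (coefficientMap (rows B a₀ e w D k f) (cols a₀ e w D k f)) (e i) Y =
      f (e i) * f Y := by
  rw [pullbackForm_apply, Fintype.sum_eq_single (some k), Fintype.sum_eq_single none]
  · simp [h.coefficientMap_some_none hf]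
  · rintro (_ | q) hq
    · exact absurd rfl hq
    · have : rows B a₀ e w D k f (some k) ⁅e i, e q⁆ = 0 :=
        h.rows_lie_eq_zero hf _ (by linarith [h.weight_pos q])
      have h0 : coefficientMap (rows B a₀ e w D k f) (cols a₀ e w D k f) (e i) (some k)
          (some q) = 0 := lie_cols_eq_zero this
      rw [h0]
      simp
  · intro p hp
    refine Finset.sum_eq_zero fun q _ => ?_
    have hz : coefficientMap (rows B a₀ e w D k f) (cols a₀ e w D k f) (e i) p q = 0 := by
      rcases p with _ | p
      · simp [coefficientMap_apply, rows]
      have hpk : p ≠ k := fun h => hp (h ▸ rfl)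
      rcases q with _ | q
      · rw [coefficientMap_apply, h.rows_lie_base hf]
        have : rows B a₀ e w D k f (some p) (e i) = 0 := by
          simp only [rows, hpk, if_false]
          split_ifs with hlt
          · have : p ≠ i := by
              rintro rfl
              linarith
            simp [h.orthonormal, this]
          · simp
        rw [this, mul_zero, neg_zero]
      · have : rows B a₀ e w D k f (some p) ⁅e i, e q⁆ = 0 :=
          h.rows_lie_eq_zero hf _ (by linarith [h.weight_pos q])
        exact lie_cols_eq_zero this
    rw [hz]
    simp

theorem sq_coefficientMap_le (h : IsWeightBasis B A N a₀ e w)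
    (hD : D ≠ 0) (hf : ∀ a ∈ A, ∀ X, f ⁅a, X⁆ = w k a * f X) {C K : ℝ} (hC : 0 ≤ C) (hK : 0 ≤ K)
    (hB : ∀ X i, B ⁅X, e i⁆ ⁅X, e i⁆ ≤ C * B X X) (hfK : ∀ Y ∈ N, f Y ^ 2 ≤ K * B Y Y)
    {Y : L} (hY : Y ∈ N) {p q : Option (Fin m)} (hpq : p ≠ some k ∨ q ≠ none) :
    coefficientMap (rows B a₀ e w D k f) (cols a₀ e w D k f) Y p q ^ 2 ≤
      (D ^ 2 + K / D ^ 2 * C + C) * B Y Y := by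
  have hBY := h.nonneg Y
  have h1 : 0 ≤ D ^ 2 * B Y Y := by positivity
  have h2 : 0 ≤ K / D ^ 2 * C * B Y Y := by positivity
  have h3 : 0 ≤ C * B Y Y := by positivity
  have hz : (0 : ℝ) ^ 2 ≤ (D ^ 2 + K / D ^ 2 * C + C) * B Y Y := by
    rw [add_mul, add_mul]
    linarith
  rcases p with _ | p
  · simpa [coefficientMap_apply, rows] using hz
  rcases q with _ | q
  · have hpk : p ≠ k := by simpa using hpq
    rw [coefficientMap_apply, h.rows_lie_base hf]
    simp only [rows, hpk, if_false]
    split_ifs with hlt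
    · have hr : (w p a₀ / w k a₀) ^ 2 ≤ 1 := by
        have := h.weight_pos p
        have := h.weight_pos k
        exact pow_le_one₀ (by positivity) ((div_le_one (by positivity)).2 hlt.le)
      simp only [LinearMap.smul_apply, smul_eq_mul]
      calc (-(w p a₀ / w k a₀ * (D * B (e p) Y))) ^ 2
          = (w p a₀ / w k a₀) ^ 2 * (D ^ 2 * B (e p) Y ^ 2) := by ring
        _ ≤ 1 * (D ^ 2 * B Y Y) := by
          gcongr
          exact h.sq_coord_le p Y
        _ ≤ _ := by
          rw [add_mul, add_mul]
          linarith
    · simpa using hz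
  · rw [coefficientMap_apply]
    by_cases hqk : q = k
    · have := h.induction_mem (P := rows B a₀ e w D k f (some p) ∘ₗ
        (LieModule.toEnd ℝ L L : L →ₗ[ℝ] Module.End ℝ L).flip (e k))
        (fun l => h.rows_lie_eq_zero hf (some p) (by linarith [h.weight_pos l])) hY
      have h4 : rows B a₀ e w D k f (some p) ⁅Y, e k⁆ = 0 := this
      simpa [cols, hqk, h4] using hz
    by_cases hqk' : w q a₀ < w k a₀
    · simp only [cols, hqk, hqk', if_false, if_true, lie_smul, map_smul, smul_eq_mul]
      by_cases hpk : p = k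
      · simp only [rows, hpk, if_true]
        calc (D⁻¹ * f ⁅Y, e q⁆) ^ 2 = (D ^ 2)⁻¹ * f ⁅Y, e q⁆ ^ 2 := by
              rw [mul_pow, inv_pow]
          _ ≤ (D ^ 2)⁻¹ * (K * (C * B Y Y)) := by
              gcongr
              exact (hfK _ (h.lie_mem _ _)).trans (by gcongr; exact hB Y q)
          _ = K / D ^ 2 * C * B Y Y := by ring
          _ ≤ _ := by
            rw [add_mul, add_mul]
            linarith
      · simp only [rows, hpk, if_false]
        split_ifs
        · simp only [LinearMap.smul_apply, smul_eq_mul, inv_mul_cancel_left₀ hD]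
          calc B (e p) ⁅Y, e q⁆ ^ 2 ≤ C * B Y Y := (h.sq_coord_le p _).trans (hB Y q)
            _ ≤ _ := by
              rw [add_mul, add_mul]
              linarith
        · simpa using hz
    · simpa [cols, hqk, hqk'] using hz

theorem pullbackForm_coefficientMap_le (h : IsWeightBasis B A N a₀ e w)
    (hD : D ≠ 0) (hf : ∀ a ∈ A, ∀ X, f ⁅a, X⁆ = w k a * f X) {C K : ℝ} (hC : 0 ≤ C) (hK : 0 ≤ K)
    (hB : ∀ X i, B ⁅X, e i⁆ ⁅X, e i⁆ ≤ C * B X X) (hfK : ∀ Y ∈ N, f Y ^ 2 ≤ K * B Y Y)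
    {Y : L} (hY : Y ∈ N) :
    pullbackForm (coefficientMap (rows B a₀ e w D k f) (cols a₀ e w D k f)) Y Y ≤
      f Y ^ 2 + (m + 1) ^ 2 * (2 * (D ^ 2 + K / D ^ 2 * C + C)) * B Y Y := by
  have hBY := h.nonneg Y
  set T := (D ^ 2 + K / D ^ 2 * C + C) * B Y Y with hT
  have hT0 : 0 ≤ T := by positivity
  have hle : ∀ p q : Option (Fin m), (if p = q then 2 else 1 : ℝ) *
      (coefficientMap (rows B a₀ e w D k f) (cols a₀ e w D k f) Y p q *
        coefficientMap (rows B a₀ e w D k f) (cols a₀ e w D k f) Y p q) ≤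
      (if p = some k then if q = none then f Y ^ 2 else 0 else 0) + 2 * T := by
    intro p q
    by_cases hpq : p = some k ∧ q = none
    · obtain ⟨rfl, rfl⟩ := hpq
      simp only [h.coefficientMap_some_none hf, reduceCtorEq, if_true, if_false, one_mul,
        ← pow_two]
      rw [neg_sq]
      linarith
    · rw [← pow_two]
      have h1 := h.sq_coefficientMap_le hD hf hC hK hB hfK hY (p := p) (q := q) (by tauto)
      have h2 : (if p = some k then if q = none then f Y ^ 2 else 0 else 0) = 0 := by
        split_ifs <;> tauto
      rw [h2, zero_add]
      refine mul_le_mul ?_ h1 (sq_nonneg _) zero_le_two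
      split_ifs <;> norm_num
  rw [pullbackForm_apply]
  refine (Finset.sum_le_sum fun p _ => Finset.sum_le_sum fun q _ => hle p q).trans (le_of_eq ?_)
  simp only [Finset.sum_add_distrib, Finset.sum_const, Finset.card_univ, Fintype.card_option,
    Fintype.card_fin, nsmul_eq_mul]
  have : ∀ p : Option (Fin m), (∑ q : Option (Fin m),
      (if p = some k then if q = none then f Y ^ 2 else 0 else 0)) =
      if p = some k then f Y ^ 2 else 0 := by
    intro p
    split_ifs <;> simp
  simp only [this, Finset.sum_ite_eq', Finset.mem_univ, if_true]
  rw [hT]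
  push_cast
  ring

theorem pullbackForm_coefficientMap_le_of_mem (h : IsWeightBasis B A N a₀ e w)
    (hD : D ≠ 0) (hf : ∀ a ∈ A, ∀ X, f ⁅a, X⁆ = w k a * f X) (hfk : f (e k) ≠ 0) {C : ℝ}
    (hC : 0 ≤ C) (hB : ∀ X i, B ⁅X, e i⁆ ⁅X, e i⁆ ≤ C * B X X) {a : L} (ha : a ∈ A) :
    pullbackForm (coefficientMap (rows B a₀ e w D k f) (cols a₀ e w D k f)) a a ≤
      2 * (m + 1) * C * B a a := by
  have hBa := h.nonneg a
  have hw : ∀ i, w i a ^ 2 ≤ C * B a a := by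
    intro i
    have := hB a i
    rw [h.lie_eq a ha] at this
    simpa [h.orthonormal, ← pow_two] using this
  have hρ := h.isDiagonalRep_coefficientMap hD hf hfk
  rw [pullbackForm_apply]
  have hle : ∀ p, (∑ q, (if p = q then 2 else 1 : ℝ) *
      (coefficientMap (rows B a₀ e w D k f) (cols a₀ e w D k f) a p q *
        coefficientMap (rows B a₀ e w D k f) (cols a₀ e w D k f) a p q)) ≤ 2 * (C * B a a) := by
    intro p
    rw [Fintype.sum_eq_single p fun q hq => by rw [hρ.diag a ha p q hq.symm]; simp]
    rw [if_pos rfl, ← pow_two]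
    gcongr
    rcases p with _ | p
    · simpa [coefficientMap_apply, rows] using mul_nonneg hC hBa
    · rw [coefficientMap_apply, h.lie_rows hf ha, h.rows_cols hD hf hfk]
      split_ifs
      · simpa using hw p
      · simpa using mul_nonneg hC hBa
  refine (Finset.sum_le_sum fun p _ => hle p).trans (le_of_eq ?_)
  simp only [Finset.sum_const, Finset.card_univ, Fintype.card_option, Fintype.card_fin,
    nsmul_eq_mul]
  push_cast
  ring

end

end IsWeightBasis

variable {L : Type*} [LieRing L] [LieAlgebra ℝ L]

namespace IsWeightBasis

variable {B : L →ₗ[ℝ] L →ₗ[ℝ] ℝ} {A : LieSubalgebra ℝ L} {N : LieIdeal ℝ L} {a₀ : L} {m : ℕ}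
  {e : Fin m → L} {w : Fin m → L →ₗ[ℝ] ℝ}

theorem nonneg_of_kernel (h : IsWeightBasis B A N a₀ e w) {R : L →ₗ[ℝ] L →ₗ[ℝ] ℝ}
    (hR : ∀ X Y, R X Y = R Y X) (P : Fin m → Prop)
    (hP : ∀ i, P i → ∀ Y ∈ N, R (e i) Y = 0)
    (hnn : ∀ Y ∈ N, (∀ i, P i → B (e i) Y = 0) → 0 ≤ R Y Y) {Y : L} (hY : Y ∈ N) :
    0 ≤ R Y Y := by
  classical
  set Z := ∑ i, (if P i then B (e i) Y else 0) • e i with hZ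
  have hZN : Z ∈ N := N.toSubmodule.sum_mem fun i _ => N.toSubmodule.smul_mem _ (h.mem i)
  have hRZ : ∀ W ∈ N, R Z W = 0 := by
    intro W hW
    simp only [hZ, map_sum, map_smul, LinearMap.sum_apply, LinearMap.smul_apply, smul_eq_mul]
    refine Finset.sum_eq_zero fun i _ => ?_
    split_ifs with hi
    · rw [hP i hi W hW, mul_zero]
    · rw [zero_mul]
  have h1 := hnn (Y - Z) (N.toSubmodule.sub_mem hY hZN) (by
    intro i hi
    rw [hZ, map_sub, map_sum, Fintype.sum_eq_single i fun j hj => by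
      rw [map_smul, h.orthonormal, if_neg hj.symm, smul_zero]]
    simp [h.orthonormal, hi])
  have h2 : R (Y - Z) (Y - Z) = R Y Y := by
    simp only [map_sub, LinearMap.sub_apply, hRZ Y hY, hRZ Z hZN, hR Y Z, sub_zero]
  rwa [h2] at h1

theorem exists_rep_partial (h : IsWeightBasis B A N a₀ e w) {C D K : ℝ} (hC : 0 ≤ C)
    (hB : ∀ X i, B ⁅X, e i⁆ ⁅X, e i⁆ ≤ C * B X X) (hD : D ≠ 0) (hK : 0 < K)
    (hDK : (m + 1) ^ 2 * (2 * (D ^ 2 + K / D ^ 2 * C + C)) ≤ K * (1 / (2 * (m + 1))))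
    (t : ℕ) (ht : t ≤ m) :
    ∃ (ι : Type) (_ : Fintype ι) (_ : DecidableEq ι) (ρ : L →ₗ[ℝ] Matrix ι ι ℝ),
      IsDiagonalRep A ρ ∧
      (∀ i : Fin m, m ≤ i + t → ∀ Y ∈ N, K * B (e i) Y = pullbackForm ρ (e i) Y) ∧
      (∀ Y ∈ N, (∀ i : Fin m, m ≤ i + t → B (e i) Y = 0) →
        K * (1 - t * (1 / (2 * (m + 1)))) * B Y Y ≤ K * B Y Y - pullbackForm ρ Y Y) ∧
      ∀ a ∈ A, pullbackForm ρ a a ≤ t * (2 * (m + 1) * C) * B a a := by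
  induction t with
  | zero =>
    refine ⟨Empty, inferInstance, inferInstance, 0, ⟨fun _ _ => by ext i; exact i.elim,
      fun _ _ i => i.elim⟩, ?_, ?_, ?_⟩
    · intro i hi
      exact absurd i.2 (by omega)
    · intro Y _ _
      simp [pullbackForm_apply]
    · intro a _
      simp [pullbackForm_apply]
  | succ t ih =>
    obtain ⟨ι, _, _, ρ, hρ, hker, hlow, hA⟩ := ih (by omega)
    let k : Fin m := ⟨m - 1 - t, by omega⟩
    have hk : (k : ℕ) + t + 1 = m := by
      simp only [k]
      omega
    set ε : ℝ := 1 / (2 * (m + 1)) with hε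
    have htε : t * ε < 1 := by
      have : (t : ℝ) ≤ m := by exact_mod_cast (by omega : t ≤ m)
      rw [hε, mul_one_div, div_lt_one (by positivity)]
      linarith
    set R : L →ₗ[ℝ] L →ₗ[ℝ] ℝ := K • B - pullbackForm ρ with hRdef
    have hRa : ∀ X Y, R X Y = K * B X Y - pullbackForm ρ X Y := fun _ _ => rfl
    have hRs : ∀ X Y, R X Y = R Y X := fun X Y => by
      rw [hRa, hRa, h.symm, pullbackForm_comm]
    have hRlie : ∀ a ∈ A, ∀ X Y, R ⁅a, X⁆ Y = R X ⁅a, Y⁆ := fun a ha X Y => by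
      rw [hRa, hRa, h.lie_symm a ha, hρ.pullbackForm_lie ha]
    have hRker : ∀ i : Fin m, m ≤ i + t → ∀ Y ∈ N, R (e i) Y = 0 := fun i hi Y hY => by
      rw [hRa, hker i hi Y hY, sub_self]
    have hRnn : ∀ Y ∈ N, 0 ≤ R Y Y := fun Y hY =>
      h.nonneg_of_kernel hRs _ hRker (fun Y hY hz => by
        refine le_trans ?_ (hlow Y hY hz)
        have := h.nonneg Y
        have : 0 ≤ 1 - t * ε := by linarith
        positivity) hY
    have hkz : ∀ i : Fin m, m ≤ i + t → i ≠ k := by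
      rintro i hi rfl
      omega
    have hRk : 0 < R (e k) (e k) := by
      refine lt_of_lt_of_le ?_ (hlow (e k) (h.mem k) fun i hi => by
        rw [h.orthonormal, if_neg (hkz i hi)])
      rw [h.orthonormal, if_pos rfl, mul_one]
      have : 0 < 1 - t * ε := by linarith
      positivity
    set f : L →ₗ[ℝ] ℝ := (Real.sqrt (R (e k) (e k)))⁻¹ • R (e k) with hf
    have hfa : ∀ X, f X = (Real.sqrt (R (e k) (e k)))⁻¹ * R (e k) X := fun _ => rfl
    have hsq : Real.sqrt (R (e k) (e k)) ^ 2 = R (e k) (e k) := Real.sq_sqrt hRk.le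
    have hsq0 : 0 < Real.sqrt (R (e k) (e k)) := Real.sqrt_pos.2 hRk
    have hff : ∀ X, f X ^ 2 = R (e k) X ^ 2 / R (e k) (e k) := fun X => by
      rw [hfa, mul_pow, inv_pow, hsq]
      ring
    have hfw : ∀ a ∈ A, ∀ X, f ⁅a, X⁆ = w k a * f X := fun a ha X => by
      rw [hfa, hfa, ← hRlie a ha, h.lie_eq a ha, map_smul, LinearMap.smul_apply, smul_eq_mul]
      ring
    have hfk : f (e k) ≠ 0 := by
      rw [hfa]
      positivity
    have hfK : ∀ Y ∈ N, f Y ^ 2 ≤ K * B Y Y := fun Y hY => by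
      rw [hff]
      refine (sq_le_mul_of_forall_nonneg R (hRs _ _) hRk (hRnn _
        (N.toSubmodule.sub_mem hY (N.toSubmodule.smul_mem _ (h.mem k))))).trans ?_
      rw [hRa]
      have : 0 ≤ pullbackForm ρ Y Y := by
        rw [pullbackForm_apply]
        refine Finset.sum_nonneg fun i _ => Finset.sum_nonneg fun j _ =>
          mul_nonneg (by split_ifs <;> norm_num) (mul_self_nonneg _)
      linarith
    set τ := coefficientMap (rows B a₀ e w D k f) (cols a₀ e w D k f) with hτ
    have hlev : ∀ i : Fin m, m ≤ i + (t + 1) → w k a₀ ≤ w i a₀ := fun i hi =>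
      h.monotone (Fin.le_def.2 (by omega))
    refine ⟨ι ⊕ Option (Fin m), inferInstance, inferInstance, blockSum ρ τ,
      hρ.blockSum (h.isDiagonalRep_coefficientMap hD hfw hfk), ?_, ?_, ?_⟩
    · intro i hi Y hY
      rw [pullbackForm_blockSum, hτ, h.pullbackForm_coefficientMap_basis hfw (hlev i hi)]
      rcases (show m ≤ i + t ∨ i = k from
        (le_or_gt m (i + t)).imp_right fun h => Fin.ext (by omega)) with hi' | rfl
      · have : f (e i) = 0 := by
          rw [hfa, hRs (e k) (e i), hRker i hi' _ (h.mem k), mul_zero]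
        rw [hker i hi' Y hY, this, zero_mul, add_zero]
      · have : f (e k) * f Y = R (e k) Y := by
          rw [hfa, hfa, mul_mul_mul_comm, ← mul_inv, ← pow_two, hsq]
          field_simp
        rw [this, hRa]
        ring
    · intro Y hY hz
      rw [pullbackForm_blockSum]
      have hYk : B (e k) Y = 0 := hz k (by omega)
      set Z := Y - (R (e k) Y / R (e k) (e k)) • e k with hZ
      have hZN : Z ∈ N := N.toSubmodule.sub_mem hY (N.toSubmodule.smul_mem _ (h.mem k))
      have h1 := hlow Z hZN fun i hi => by
        rw [hZ, map_sub, map_smul, hz i (by omega), h.orthonormal, if_neg (hkz i hi)]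
        simp
      rw [← hRa Z Z] at h1
      have h2 : R Z Z = R Y Y - f Y ^ 2 := by
        rw [hff, hZ]
        simp only [map_sub, map_smul, LinearMap.sub_apply, LinearMap.smul_apply, smul_eq_mul,
          hRs Y (e k)]
        field_simp
        ring
      have h3 : B Y Y ≤ B Z Z := by
        rw [hZ]
        simp only [map_sub, map_smul, LinearMap.sub_apply, LinearMap.smul_apply, smul_eq_mul,
          h.symm Y (e k), hYk, h.orthonormal, if_true]
        have := sq_nonneg (R (e k) Y / R (e k) (e k))
        nlinarith
      have h4 := h.pullbackForm_coefficientMap_le hD hfw hC hK.le hB hfK hY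
      have h5 := mul_le_mul_of_nonneg_right hDK (h.nonneg Y)
      have h6 : K * (1 - t * ε) * B Y Y ≤ K * (1 - t * ε) * B Z Z :=
        mul_le_mul_of_nonneg_left h3 (mul_nonneg hK.le (by linarith))
      rw [h2, hRa] at h1
      push_cast
      rw [← hτ] at h4
      linarith
    · intro a ha
      rw [pullbackForm_blockSum]
      have h1 := hA a ha
      have h2 := h.pullbackForm_coefficientMap_le_of_mem hD hfw hfk hC hB ha
      rw [← hτ] at h2
      push_cast
      linarith

theorem exists_rep_residual [FiniteDimensional ℝ L] (h : IsWeightBasis B A N a₀ e w) :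
    ∃ (K : ℝ) (ι : Type) (_ : Fintype ι) (_ : DecidableEq ι) (ρ : L →ₗ[ℝ] Matrix ι ι ℝ),
      0 < K ∧ IsDiagonalRep A ρ ∧
      (∀ X ∈ N, ∀ Y, K * B X Y = pullbackForm ρ X Y) ∧
      ∀ X, pullbackForm ρ X X ≤ K * B X X := by
  have hC : ∃ C : ℝ, 0 ≤ C ∧ ∀ X i, B ⁅X, e i⁆ ⁅X, e i⁆ ≤ C * B X X := by
    choose C hC0 hC using fun i => exists_form_apply_le B h.symm h.pos
      ((LieModule.toEnd ℝ L L : L →ₗ[ℝ] Module.End ℝ L).flip (e i))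
    refine ⟨∑ i, C i, Finset.sum_nonneg fun i _ => hC0 i, fun X i => (hC i X).trans ?_⟩
    exact mul_le_mul_of_nonneg_right
      (Finset.single_le_sum (fun i _ => hC0 i) (Finset.mem_univ i)) (h.nonneg X)
  obtain ⟨C, hC0, hC⟩ := hC
  set M : ℝ := (m + 1 : ℝ) with hM
  have hM1 : 1 ≤ M := by
    rw [hM]
    have : (0 : ℝ) ≤ m := Nat.cast_nonneg m
    linarith
  set D : ℝ := Real.sqrt (12 * M ^ 3 * (C + 1)) with hD
  have hD2 : D ^ 2 = 12 * M ^ 3 * (C + 1) := Real.sq_sqrt (by positivity)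
  have hD0 : 0 < D := Real.sqrt_pos.2 (by positivity)
  set K : ℝ := 12 * M ^ 3 * (D ^ 2 + C) + m * (2 * M * C) with hK
  have hm0 : (0 : ℝ) ≤ m := Nat.cast_nonneg m
  have hK0 : 0 < K := by positivity
  have hDK : M ^ 2 * (2 * (D ^ 2 + K / D ^ 2 * C + C)) ≤ K * (1 / (2 * M)) := by
    have h1 : M ^ 2 * (2 * (K / D ^ 2 * C)) ≤ K / (6 * M) := by
      have : K / D ^ 2 * C ≤ K / (12 * M ^ 3) := by
        rw [hD2, div_mul_eq_mul_div, div_le_div_iff₀ (by positivity) (by positivity)]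
        nlinarith [mul_pos hK0 (show 0 < 12 * M ^ 3 by positivity)]
      calc M ^ 2 * (2 * (K / D ^ 2 * C)) ≤ M ^ 2 * (2 * (K / (12 * M ^ 3))) := by gcongr
        _ = K / (6 * M) := by
          field_simp
          norm_num
    have h2 : M ^ 2 * (2 * (D ^ 2 + C)) ≤ K / (6 * M) := by
      rw [le_div_iff₀ (by positivity)]
      have : 0 ≤ m * (2 * M * C) := by positivity
      calc M ^ 2 * (2 * (D ^ 2 + C)) * (6 * M) = 12 * M ^ 3 * (D ^ 2 + C) := by ring
        _ ≤ K := by linarith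
    have h3 : K / (6 * M) + K / (6 * M) ≤ K * (1 / (2 * M)) := by
      have h4 : K * (1 / (2 * M)) = 3 * (K / (6 * M)) := by
        field_simp
        norm_num
      have : 0 ≤ K / (6 * M) := by positivity
      linarith
    calc _ = M ^ 2 * (2 * (K / D ^ 2 * C)) + M ^ 2 * (2 * (D ^ 2 + C)) := by ring
      _ ≤ _ := by linarith
  obtain ⟨ι, i1, i2, ρ, hρ, hker, -, hA⟩ := h.exists_rep_partial hC0 hC hD0.ne' hK0 hDK m le_rfl
  have hN : ∀ X ∈ N, ∀ Y ∈ N, K * B X Y = pullbackForm ρ X Y := by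
    intro X hX Y hY
    have := h.induction_mem (P := (K • B - pullbackForm ρ).flip Y) (fun i => by
      have := hker i (by omega) Y hY
      simp [this]) hX
    simpa [sub_eq_zero] using this
  have hNA : ∀ X ∈ N, ∀ Y, K * B X Y = pullbackForm ρ X Y := by
    intro X hX Y
    obtain ⟨a, ha, U, hU, rfl⟩ := h.exists_add Y
    rw [map_add, map_add, mul_add, hN X hX U hU, h.symm X a, h.orthogonal a ha X hX,
      pullbackForm_comm ρ X a, h.pullbackForm_eq_zero hρ ha hX, mul_zero]
  refine ⟨K, ι, i1, i2, ρ, hK0, hρ, hNA, ?_⟩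
  intro X
  obtain ⟨a, ha, Y, hY, rfl⟩ := h.exists_add X
  have h1 := hA a ha
  have h2 := hNA Y hY a
  have h3 := hNA Y hY Y
  have h4 : m * (2 * M * C) * B a a ≤ K * B a a := by
    refine mul_le_mul_of_nonneg_right ?_ (h.nonneg a)
    have : 0 ≤ 12 * M ^ 3 * (D ^ 2 + C) := by positivity
    linarith
  simp only [map_add, LinearMap.add_apply, h.symm a Y, pullbackForm_comm ρ a Y]
  linarith

/-- The key algebraic statement: a multiple of the inner product is induced by a faithful
representation by lower triangular matrices. -/
theorem exists_rep [FiniteDimensional ℝ L] (h : IsWeightBasis B A N a₀ e w) :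
    ∃ (K : ℝ) (n : ℕ) (ρ : L →ₗ[ℝ] Matrix (Fin n) (Fin n) ℝ), 0 < K ∧ IsDiagonalRep A ρ ∧
      (∀ X i j, i < j → ρ X i j = 0) ∧ ∀ X Y, pullbackForm ρ X Y = K * B X Y := by
  obtain ⟨K, ι, _, _, ρ, hK, hρ, hN, hle⟩ := h.exists_rep_residual
  set R : LinearMap.BilinForm ℝ L := K • B - pullbackForm ρ with hR
  have hRa : ∀ X Y, R X Y = K * B X Y - pullbackForm ρ X Y := fun _ _ => rfl
  have hRs : ∀ X Y, R X Y = R Y X := fun X Y => by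
    rw [hRa, hRa, h.symm, pullbackForm_comm]
  obtain ⟨v, hv⟩ := LinearMap.BilinForm.exists_orthogonal_basis (B := R) ⟨hRs⟩
  have hexp : ∀ X Y, R X Y = ∑ i, R (v i) (v i) * (v.repr X i * v.repr Y i) := by
    intro X Y
    conv_lhs => rw [← v.sum_repr X, ← v.sum_repr Y]
    simp only [map_sum, map_smul, LinearMap.sum_apply, LinearMap.smul_apply, smul_eq_mul]
    refine Finset.sum_congr rfl fun i _ => ?_
    rw [Finset.sum_eq_single i]
    · ring
    · intro j _ hj
      have : R (v j) (v i) = 0 := hv hj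
      simp [this]
    · simp
  have hr : ∀ i, 0 ≤ R (v i) (v i) := fun i => by
    rw [hRa]
    linarith [hle (v i)]
  let lam (i) : L →ₗ[ℝ] ℝ := Real.sqrt (R (v i) (v i) / 2) • v.coord i
  have hlam : ∀ i X, lam i X = Real.sqrt (R (v i) (v i) / 2) * v.repr X i := fun _ _ => rfl
  have hlamN : ∀ i, ∀ X ∈ N, lam i X = 0 := by
    intro i X hX
    have h1 : R X (v i) = 0 := by rw [hRa, hN X hX, sub_self]
    rw [hexp, Finset.sum_eq_single i] at h1
    · rw [hlam]
      rcases mul_eq_zero.1 h1 with h2 | h2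
      · simp [h2]
      · have : v.repr X i = 0 := by simpa using h2
        rw [this, mul_zero]
    · intro j _ hj
      simp [Finsupp.single_eq_of_ne hj]
    · simp
  let δ : L →ₗ[ℝ] Matrix (Fin (Module.finrank ℝ L)) (Fin (Module.finrank ℝ L)) ℝ :=
    (Matrix.diagonalLinearMap _ ℝ ℝ) ∘ₗ LinearMap.pi lam
  have hδ : ∀ X, δ X = Matrix.diagonal fun i => lam i X := fun _ => rfl
  have hδA : IsDiagonalRep A δ := by
    refine ⟨fun X Y => ?_, fun a _ i j hij => ?_⟩
    · rw [hδ, hδ, hδ, Matrix.diagonal_mul_diagonal, Matrix.diagonal_mul_diagonal]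
      have : (fun i => lam i ⁅X, Y⁆) = 0 := funext fun i => hlamN i _ (h.lie_mem X Y)
      rw [this]
      simp [mul_comm]
    · rw [hδ, Matrix.diagonal_apply_ne _ hij]
  have hδform : ∀ X Y, pullbackForm δ X Y = R X Y := by
    intro X Y
    rw [hexp, pullbackForm_apply]
    refine Finset.sum_congr rfl fun i _ => ?_
    rw [Finset.sum_eq_single i]
    · simp only [hδ, Matrix.diagonal_apply_eq, if_true, hlam]
      have := Real.mul_self_sqrt (div_nonneg (hr i) zero_le_two)
      calc _ = 2 * (Real.sqrt (R (v i) (v i) / 2) * Real.sqrt (R (v i) (v i) / 2)) *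
            (v.repr X i * v.repr Y i) := by ring
        _ = _ := by
          rw [this]
          ring
    · intro j _ hj
      simp [hδ, Matrix.diagonal_apply_ne _ hj.symm]
    · simp
  have hρδ := hρ.blockSum hδA
  set τ := blockSum ρ δ
  have hτ : ∀ X Y, pullbackForm τ X Y = K * B X Y := by
    intro X Y
    rw [pullbackForm_blockSum, hδform, hRa]
    ring
  let κ := ι ⊕ Fin (Module.finrank ℝ L)
  let s : Fin (Fintype.card κ) ≃ κ := (Tuple.sort fun i =>
    τ a₀ ((Fintype.equivFin κ).symm i) ((Fintype.equivFin κ).symm i)).trans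
      (Fintype.equivFin κ).symm
  have hs : Monotone fun i => τ a₀ (s i) (s i) := Tuple.monotone_sort fun i =>
    τ a₀ ((Fintype.equivFin κ).symm i) ((Fintype.equivFin κ).symm i)
  refine ⟨K, Fintype.card κ, (Matrix.reindexLinearEquiv ℝ ℝ s.symm s.symm).toLinearMap ∘ₗ τ, hK,
    ⟨?_, ?_⟩, ?_, ?_⟩
  · intro X Y
    simp [hρδ.map_lie]
    rfl
  · intro a ha i j hij
    exact hρδ.diag a ha _ _ (s.injective.ne hij)
  · intro X i j hij
    obtain ⟨a, ha, Y, hY, rfl⟩ := h.exists_add X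
    have h1 : τ a (s i) (s j) = 0 := hρδ.diag a ha _ _ (s.injective.ne hij.ne)
    have h2 : τ Y (s i) (s j) = 0 := by
      refine h.induction_mem (P := (Matrix.entryLinearMap ℝ ℝ (s i) (s j)) ∘ₗ τ) (fun l => ?_) hY
      refine (mul_eq_zero.1 (h.apply_basis hρδ l (s i) (s j))).resolve_left ?_
      have := hs hij.le
      have := h.weight_pos l
      simp only at *
      linarith
    change τ (a + Y) (s i) (s j) = 0
    rw [map_add, Matrix.add_apply, h1, h2, add_zero]
  · intro X Y
    rw [pullbackForm_reindex, hτ]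

end IsWeightBasis

/-! ### Left-invariant fields in charts -/

section LeftInvariant

variable {E : Type*} [NormedAddCommGroup E] [NormedSpace ℝ E] [FiniteDimensional ℝ E]
  {G : Type*} [Group G] [TopologicalSpace G] [ChartedSpace E G] [LieGroup 𝓘(ℝ, E) ∞ G]

theorem mulInvariantVectorField_toLieAlg (x : G) (v : TangentSpace 𝓘(ℝ, E) x) :
    mulInvariantVectorField (toLieAlg 𝓘(ℝ, E) x v) x = v := by
  have h : (mfderiv 𝓘(ℝ, E) 𝓘(ℝ, E) (fun y : G => x * y) (x⁻¹ * x)).comp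
      (toLieAlg 𝓘(ℝ, E) x) = ContinuousLinearMap.id ℝ (TangentSpace 𝓘(ℝ, E) x) := by
    unfold toLieAlg
    rw [← mfderiv_comp (I' := 𝓘(ℝ, E)) x
      ((contMDiff_mul_left (n := ∞)).contMDiffAt.mdifferentiableAt (by simp))
      ((contMDiff_mul_left (n := ∞)).contMDiffAt.mdifferentiableAt (by simp))]
    have : (fun y : G => x * y) ∘ (fun y : G => x⁻¹ * y) = id := by
      funext y
      simp
    rw [this, mfderiv_id]
  let M : G → E →L[ℝ] E := fun y => mfderiv 𝓘(ℝ, E) 𝓘(ℝ, E) (fun z : G => x * z) y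
  have h1 : M (x⁻¹ * x) = M 1 := congrArg M (inv_mul_cancel x)
  have h2 := DFunLike.congr_fun h v
  exact (DFunLike.congr_fun h1 (toLieAlg 𝓘(ℝ, E) x v)).symm.trans h2

/-- The derivative of `f` at `x` along the left-invariant vector field with value `X` at `1`. -/
def lieD {F : Type*} [NormedAddCommGroup F] [NormedSpace ℝ F] (f : G → F) (x : G)
    (X : GroupLieAlgebra 𝓘(ℝ, E) G) : F :=
  mfderiv 𝓘(ℝ, E) 𝓘(ℝ, F) f x (mulInvariantVectorField X x)

variable (E) in
/-- The pullback of the Maurer-Cartan form to a chart. -/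
def chartForm (x₀ : G) (z : E) : E →L[ℝ] E :=
  (toLieAlg 𝓘(ℝ, E) ((extChartAt 𝓘(ℝ, E) x₀).symm z)).comp
    (mfderiv 𝓘(ℝ, E) 𝓘(ℝ, E) (extChartAt 𝓘(ℝ, E) x₀).symm z)

theorem mulInvariantVectorField_chartForm (x₀ : G) (z v : E) :
    mulInvariantVectorField (chartForm E x₀ z v) ((extChartAt 𝓘(ℝ, E) x₀).symm z) =
      mfderiv 𝓘(ℝ, E) 𝓘(ℝ, E) (extChartAt 𝓘(ℝ, E) x₀).symm z v :=
  mulInvariantVectorField_toLieAlg _ _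

theorem contMDiffAt_extChartAt_symm' (x₀ : G) {z : E} (hz : z ∈ (extChartAt 𝓘(ℝ, E) x₀).target) :
    ContMDiffAt 𝓘(ℝ, E) 𝓘(ℝ, E) ∞ (extChartAt 𝓘(ℝ, E) x₀).symm z :=
  (contMDiffOn_extChartAt_symm x₀).contMDiffAt ((isOpen_extChartAt_target x₀).mem_nhds hz)

theorem hasFDerivAt_comp_chart {F : Type*} [NormedAddCommGroup F] [NormedSpace ℝ F] (x₀ : G) {z : E}
    (hz : z ∈ (extChartAt 𝓘(ℝ, E) x₀).target) {f : G → F}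
    (hf : MDifferentiableAt 𝓘(ℝ, E) 𝓘(ℝ, F) f ((extChartAt 𝓘(ℝ, E) x₀).symm z)) (v : E) :
    HasDerivAt (fun t : ℝ => f ((extChartAt 𝓘(ℝ, E) x₀).symm (z + t • v)))
      (lieD f ((extChartAt 𝓘(ℝ, E) x₀).symm z) (chartForm E x₀ z v)) 0 ∧
    DifferentiableAt ℝ (f ∘ (extChartAt 𝓘(ℝ, E) x₀).symm) z ∧
    fderiv ℝ (f ∘ (extChartAt 𝓘(ℝ, E) x₀).symm) z v =
      lieD f ((extChartAt 𝓘(ℝ, E) x₀).symm z) (chartForm E x₀ z v) := by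
  have h1 : MDifferentiableAt 𝓘(ℝ, E) 𝓘(ℝ, E) (extChartAt 𝓘(ℝ, E) x₀).symm z :=
    (contMDiffAt_extChartAt_symm' x₀ hz).mdifferentiableAt (by simp)
  have h2 := (hf.comp z h1).differentiableAt
  have h3 : fderiv ℝ (f ∘ (extChartAt 𝓘(ℝ, E) x₀).symm) z v =
      lieD f ((extChartAt 𝓘(ℝ, E) x₀).symm z) (chartForm E x₀ z v) := by
    rw [← mfderiv_eq_fderiv, mfderiv_comp z hf h1]
    exact congrArg (mfderiv 𝓘(ℝ, E) 𝓘(ℝ, F) f _) (mulInvariantVectorField_chartForm x₀ z v).symm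
  refine ⟨?_, h2, h3⟩
  rw [← h3]
  have h4 : HasDerivAt (fun t : ℝ => z + t • v) v 0 := by
    simpa using ((hasDerivAt_id (0 : ℝ)).smul_const v).const_add z
  have h5 : HasFDerivAt (f ∘ (extChartAt 𝓘(ℝ, E) x₀).symm)
      (fderiv ℝ (f ∘ (extChartAt 𝓘(ℝ, E) x₀).symm) z) (z + (0 : ℝ) • v) := by
    simpa using h2.hasFDerivAt
  exact h5.comp_hasDerivAt 0 h4

theorem injective_chartForm (x₀ : G) {z : E} (hz : z ∈ (extChartAt 𝓘(ℝ, E) x₀).target) :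
    Function.Injective (chartForm E x₀ z) := by
  have h1 := isInvertible_mfderivWithin_extChartAt_symm (I := 𝓘(ℝ, E)) hz
  rw [modelWithCornersSelf_coe, Set.range_id, mfderivWithin_univ] at h1
  exact (toLieAlg_injective 𝓘(ℝ, E) _).comp h1.injective

theorem isInvertible_chartForm (x₀ : G) {z : E} (hz : z ∈ (extChartAt 𝓘(ℝ, E) x₀).target) :
    (chartForm E x₀ z).IsInvertible :=
  ⟨(LinearEquiv.ofInjectiveEndo (chartForm E x₀ z : E →ₗ[ℝ] E)
    (injective_chartForm x₀ hz)).toContinuousLinearEquiv, by ext; rfl⟩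

theorem contDiffAt_chartForm (x₀ : G) :
    ContDiffAt ℝ ∞ (chartForm E x₀) (extChartAt 𝓘(ℝ, E) x₀ x₀) := by
  obtain ⟨A, hA, hA'⟩ := exists_toLieAlg_coordinates 𝓘(ℝ, E) x₀
  have h1 : ContDiffAt ℝ ∞ (A ∘ (extChartAt 𝓘(ℝ, E) x₀).symm) (extChartAt 𝓘(ℝ, E) x₀ x₀) := by
    rw [← contMDiffAt_iff_contDiffAt]
    refine ContMDiffAt.comp _ ?_ (contMDiffAt_extChartAt_symm' x₀ (mem_extChartAt_target x₀))
    rwa [extChartAt_to_inv]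
  refine h1.congr_of_eventuallyEq ?_
  filter_upwards [(isOpen_extChartAt_target (I := 𝓘(ℝ, E)) x₀).mem_nhds (mem_extChartAt_target x₀)]
    with z hz
  have hs : (extChartAt 𝓘(ℝ, E) x₀).symm z ∈ (chartAt E x₀).source := by
    have := (extChartAt 𝓘(ℝ, E) x₀).map_target hz
    rwa [extChartAt_source] at this
  ext v
  have h2 := TangentBundle.symmL_trivializationAt (I := 𝓘(ℝ, E)) hs
  rw [modelWithCornersSelf_coe, Set.range_id, mfderivWithin_univ,
    (extChartAt 𝓘(ℝ, E) x₀).right_inv hz] at h2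
  have h3 := hA' _ hs v
  rw [Function.comp_apply, h3]
  refine congrArg (toLieAlg 𝓘(ℝ, E) _) ?_
  refine (DFunLike.congr_fun h2 v).symm.trans ?_
  exact Trivialization.symmL_apply (R := ℝ) _ (by simpa using hs) v

end LeftInvariant

/-! ### The Maurer-Cartan equation -/

section MaurerCartan

variable {E : Type*} [NormedAddCommGroup E] [NormedSpace ℝ E] [FiniteDimensional ℝ E]
  {G : Type*} [Group G] [TopologicalSpace G] [ChartedSpace E G] [LieGroup 𝓘(ℝ, E) ∞ G]

theorem mpullback_mulInvariantVectorField_chart (x₀ : G) {z : E}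
    (hz : z ∈ (extChartAt 𝓘(ℝ, E) x₀).target) (X : GroupLieAlgebra 𝓘(ℝ, E) G) :
    VectorField.mpullback 𝓘(ℝ, E) 𝓘(ℝ, E) (extChartAt 𝓘(ℝ, E) x₀).symm
      (mulInvariantVectorField X) z = (chartForm E x₀ z).inverse X := by
  have h1 : (mfderiv 𝓘(ℝ, E) 𝓘(ℝ, E) (extChartAt 𝓘(ℝ, E) x₀).symm z).IsInvertible := by
    have h1 := isInvertible_mfderivWithin_extChartAt_symm (I := 𝓘(ℝ, E)) hz
    rwa [modelWithCornersSelf_coe, Set.range_id, mfderivWithin_univ] at h1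
  have h2 : chartForm E x₀ z ((chartForm E x₀ z).inverse X) = X :=
    (isInvertible_chartForm x₀ hz).self_apply_inverse X
  have h3 := mulInvariantVectorField_chartForm x₀ z ((chartForm E x₀ z).inverse X)
  have h4 : mulInvariantVectorField X ((extChartAt 𝓘(ℝ, E) x₀).symm z) =
      mfderiv 𝓘(ℝ, E) 𝓘(ℝ, E) (extChartAt 𝓘(ℝ, E) x₀).symm z ((chartForm E x₀ z).inverse X) :=
    (congrArg (fun Y : GroupLieAlgebra 𝓘(ℝ, E) G =>
      mulInvariantVectorField Y ((extChartAt 𝓘(ℝ, E) x₀).symm z)) h2).symm.trans h3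
  rw [VectorField.mpullback_apply, h4]
  exact h1.inverse_apply_self _

theorem mlieBracket_inverse_chartForm (x₀ : G) {z : E}
    (hz : z ∈ (extChartAt 𝓘(ℝ, E) x₀).target) (X Y : GroupLieAlgebra 𝓘(ℝ, E) G) :
    VectorField.lieBracket ℝ (fun y => (chartForm E x₀ y).inverse X)
      (fun y => (chartForm E x₀ y).inverse Y) z =
      (chartForm E x₀ z).inverse (⁅X, Y⁆ : GroupLieAlgebra 𝓘(ℝ, E) G) := by
  have hn := (isOpen_extChartAt_target (I := 𝓘(ℝ, E)) x₀).mem_nhds hz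
  have hE : ∀ X : GroupLieAlgebra 𝓘(ℝ, E) G, (fun y => (chartForm E x₀ y).inverse X) =ᶠ[𝓝 z]
      VectorField.mpullback 𝓘(ℝ, E) 𝓘(ℝ, E) (extChartAt 𝓘(ℝ, E) x₀).symm
        (mulInvariantVectorField X) := by
    intro X
    filter_upwards [hn] with y hy
    exact (mpullback_mulInvariantVectorField_chart x₀ hy X).symm
  have h := VectorField.mpullback_mlieBracket (n := ∞) (f := (extChartAt 𝓘(ℝ, E) x₀).symm)
    (mdifferentiableAt_mulInvariantVectorField X) (mdifferentiableAt_mulInvariantVectorField Y)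
    (contMDiffAt_extChartAt_symm' x₀ hz) (by simp; exact WithTop.coe_le_coe.2 le_top)
  rw [← mulInvariantVector_mlieBracket] at h
  refine (Filter.EventuallyEq.lieBracket_vectorField_eq (hE X) (hE Y)).trans ?_
  refine Eq.trans ?_ (h.symm.trans (mpullback_mulInvariantVectorField_chart x₀ hz _))
  rw [← VectorField.mlieBracketWithin_univ, VectorField.mlieBracketWithin_eq_lieBracketWithin]
  exact congrFun VectorField.lieBracketWithin_univ.symm z

theorem fderiv_chartForm_sub (x₀ : G) {z : E} (hz : z ∈ (extChartAt 𝓘(ℝ, E) x₀).target)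
    (hd : DifferentiableAt ℝ (chartForm E x₀) z) {v w : E}
    {X Y : GroupLieAlgebra 𝓘(ℝ, E) G} (hX : chartForm E x₀ z v = X) (hY : chartForm E x₀ z w = Y) :
    fderiv ℝ (chartForm E x₀) z w v - fderiv ℝ (chartForm E x₀) z v w =
      (⁅X, Y⁆ : GroupLieAlgebra 𝓘(ℝ, E) G) := by
  subst hX hY
  have hinv := isInvertible_chartForm x₀ hz
  have hn := (isOpen_extChartAt_target (I := 𝓘(ℝ, E)) x₀).mem_nhds hz
  have hV : ∀ X : E, DifferentiableAt ℝ (fun y => (chartForm E x₀ y).inverse X) z := by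
    intro X
    obtain ⟨e, he⟩ := hinv
    have h1 : DifferentiableAt ℝ (ContinuousLinearMap.inverse : (E →L[ℝ] E) → E →L[ℝ] E)
        (chartForm E x₀ z) := by
      rw [← he]
      exact (contDiffAt_map_inverse (n := 1) e).differentiableAt (by simp)
    exact (h1.comp z hd).clm_apply (differentiableAt_const X)
  have key : ∀ X u : E, fderiv ℝ (chartForm E x₀) z u ((chartForm E x₀ z).inverse X) +
      chartForm E x₀ z (fderiv ℝ (fun y => (chartForm E x₀ y).inverse X) z u) = 0 := by
    intro X u
    have h1 : (fun y => chartForm E x₀ y ((chartForm E x₀ y).inverse X)) =ᶠ[𝓝 z] fun _ => X := by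
      filter_upwards [hn] with y hy
      exact (isInvertible_chartForm x₀ hy).self_apply_inverse X
    have h2 := h1.fderiv_eq (𝕜 := ℝ)
    rw [fderiv_clm_apply hd (hV X)] at h2
    have h3 := DFunLike.congr_fun h2 u
    simp at h3
    rw [← h3]
    abel
  have h1 := mlieBracket_inverse_chartForm x₀ hz (chartForm E x₀ z v) (chartForm E x₀ z w)
  have h2 := congrArg (chartForm E x₀ z) h1
  refine Eq.trans ?_ (h2.trans (hinv.self_apply_inverse _))
  have e1 : (chartForm E x₀ z).inverse (chartForm E x₀ z v) = v := hinv.inverse_apply_self v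
  have e2 : (chartForm E x₀ z).inverse (chartForm E x₀ z w) = w := hinv.inverse_apply_self w
  have k1 := key (chartForm E x₀ z v) w
  have k2 := key (chartForm E x₀ z w) v
  rw [e1] at k1
  rw [e2] at k2
  rw [VectorField.lieBracket_eq]
  simp only [e1, e2, map_sub]
  rw [eq_neg_of_add_eq_zero_left k1, eq_neg_of_add_eq_zero_left k2]
  abel

end MaurerCartan

/-! ### Linear differential systems along left-invariant fields -/

section LinearSystem

variable {E : Type*} [NormedAddCommGroup E] [NormedSpace ℝ E] [FiniteDimensional ℝ E]
  {G : Type*} [Group G] [TopologicalSpace G] [ChartedSpace E G] [LieGroup 𝓘(ℝ, E) ∞ G]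
  {F : Type*} [NormedAddCommGroup F] [NormedSpace ℝ F]

theorem mdifferentiable_mul_left' (a : G) :
    MDifferentiable 𝓘(ℝ, E) 𝓘(ℝ, E) (fun y : G => a * y) :=
  (contMDiff_mul_left (n := ∞)).mdifferentiable (by simp)

theorem mfderiv_mul_left_mulInvariantVectorField (a x : G) (X : GroupLieAlgebra 𝓘(ℝ, E) G) :
    mfderiv 𝓘(ℝ, E) 𝓘(ℝ, E) (fun y : G => a * y) x (mulInvariantVectorField X x) =
      mulInvariantVectorField X (a * x) := by
  let M : G → E →L[ℝ] E := fun y => mfderiv 𝓘(ℝ, E) 𝓘(ℝ, E) (fun z : G => a * z) y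
  have h1 : mfderiv 𝓘(ℝ, E) 𝓘(ℝ, E) (fun y : G => a * x * y) 1 =
      (mfderiv 𝓘(ℝ, E) 𝓘(ℝ, E) (fun y : G => a * y) (x * 1)).comp
        (mfderiv 𝓘(ℝ, E) 𝓘(ℝ, E) (fun y : G => x * y) 1) := by
    rw [← mfderiv_comp (I' := 𝓘(ℝ, E)) 1 (mdifferentiable_mul_left' a _)
      (mdifferentiable_mul_left' x _)]
    congr 1
    funext y
    exact mul_assoc a x y
  have h2 : M (x * 1) = M x := congrArg M (mul_one x)
  have h3 := DFunLike.congr_fun h1 X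
  exact ((DFunLike.congr_fun h2 (mulInvariantVectorField X x)).symm).trans h3.symm

theorem lieD_comp_mul_left {f : G → F} {a x : G}
    (hf : MDifferentiableAt 𝓘(ℝ, E) 𝓘(ℝ, F) f (a * x)) (X : GroupLieAlgebra 𝓘(ℝ, E) G) :
    lieD (fun y => f (a * y)) x X = lieD f (a * x) X := by
  have h := mfderiv_comp (I' := 𝓘(ℝ, E)) x hf (mdifferentiable_mul_left' a x)
  have h1 := DFunLike.congr_fun h (mulInvariantVectorField X x)
  exact h1.trans (congrArg (mfderiv 𝓘(ℝ, E) 𝓘(ℝ, F) f (a * x))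
    (mfderiv_mul_left_mulInvariantVectorField a x X))

theorem eventually_eq_zero_of_lieD_eq {r : G → F} (hr : MDifferentiable 𝓘(ℝ, E) 𝓘(ℝ, F) r)
    (C : E →L[ℝ] F →L[ℝ] F) (hC : ∀ x X, lieD r x X = C X (r x)) (h1 : r 1 = 0) :
    ∀ᶠ x in 𝓝 (1 : G), r x = 0 := by
  set z₀ := extChartAt 𝓘(ℝ, E) (1 : G) 1 with hz₀
  have ht := (isOpen_extChartAt_target (I := 𝓘(ℝ, E)) (1 : G)).mem_nhds (mem_extChartAt_target 1)
  have hb : ∀ᶠ z in 𝓝 z₀, ‖chartForm E (1 : G) z‖ < ‖chartForm E (1 : G) z₀‖ + 1 :=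
    (contDiffAt_chartForm (1 : G)).continuousAt.norm.eventually (gt_mem_nhds (by linarith))
  obtain ⟨ε, hε, hball⟩ := Metric.eventually_nhds_iff_ball.1 (hb.and ht)
  set M := ‖chartForm E (1 : G) z₀‖ + 1
  have hM : 0 ≤ M := by positivity
  have key : ∀ z ∈ Metric.ball z₀ ε, r ((extChartAt 𝓘(ℝ, E) (1 : G)).symm z) = 0 := by
    intro z hz
    set v := z - z₀ with hv
    have hseg : ∀ t ∈ Set.Icc (0 : ℝ) 1, z₀ + t • v ∈ Metric.ball z₀ ε := by
      intro t ht
      have h2 := (convex_ball z₀ ε).add_smul_sub_mem (Metric.mem_ball_self hε) hz ht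
      exact h2
    have hd : ∀ t ∈ Set.Icc (0 : ℝ) 1,
        HasDerivAt (fun t : ℝ => r ((extChartAt 𝓘(ℝ, E) (1 : G)).symm (z₀ + t • v)))
          (C (chartForm E (1 : G) (z₀ + t • v) v)
            (r ((extChartAt 𝓘(ℝ, E) (1 : G)).symm (z₀ + t • v)))) t := by
      intro t ht
      obtain ⟨-, h3, h4⟩ := hasFDerivAt_comp_chart (1 : G) (hball _ (hseg t ht)).2 (hr _) v
      have h5 : HasDerivAt (fun t : ℝ => z₀ + t • v) v t := by
        simpa using ((hasDerivAt_id t).smul_const v).const_add z₀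
      have h6 := h3.hasFDerivAt.comp_hasDerivAt t h5
      exact (h4.trans (hC _ _)) ▸ h6
    have h7 := norm_le_gronwallBound_of_norm_deriv_right_le (δ := 0) (K := ‖C‖ * (M * ‖v‖))
      (ε := 0) (a := 0) (b := 1)
      (fun t ht => (hd t ht).continuousAt.continuousWithinAt)
      (fun t ht => (hd t ⟨ht.1, ht.2.le⟩).hasDerivWithinAt)
      (by simp [hz₀, h1]) (fun t ht => by
        rw [add_zero]
        refine (ContinuousLinearMap.le_opNorm _ _).trans ?_
        refine mul_le_mul_of_nonneg_right ?_ (norm_nonneg _)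
        refine (ContinuousLinearMap.le_opNorm _ _).trans ?_
        refine mul_le_mul_of_nonneg_left ?_ (norm_nonneg _)
        refine (ContinuousLinearMap.le_opNorm _ _).trans ?_
        exact mul_le_mul_of_nonneg_right (hball _ (hseg t ⟨ht.1, ht.2.le⟩)).1.le (norm_nonneg _))
      1 ⟨zero_le_one, le_rfl⟩
    rw [gronwallBound_ε0_δ0, one_smul, hv, add_sub_cancel] at h7
    simpa using h7
  filter_upwards [(continuousAt_extChartAt (I := 𝓘(ℝ, E)) (1 : G)).preimage_mem_nhds
    (Metric.ball_mem_nhds _ hε), extChartAt_source_mem_nhds (I := 𝓘(ℝ, E)) (1 : G)] with x hx hx'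
  have := key _ hx
  rwa [(extChartAt 𝓘(ℝ, E) (1 : G)).left_inv hx'] at this

theorem eq_zero_of_lieD_eq [PreconnectedSpace G] {r : G → F}
    (hr : MDifferentiable 𝓘(ℝ, E) 𝓘(ℝ, F) r) (C : E →L[ℝ] F →L[ℝ] F)
    (hC : ∀ x X, lieD r x X = C X (r x)) (h1 : r 1 = 0) (x : G) : r x = 0 := by
  have hT : IsTopologicalGroup G := topologicalGroup_of_lieGroup 𝓘(ℝ, E) ∞
  have hclosed : IsClosed {x | r x = 0} := isClosed_singleton.preimage hr.continuous
  have hopen : IsOpen {x | r x = 0} := by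
    rw [isOpen_iff_mem_nhds]
    intro a ha
    have h2 := eventually_eq_zero_of_lieD_eq (r := fun y => r (a * y))
      (hr.comp (mdifferentiable_mul_left' a)) C
      (fun x X => (lieD_comp_mul_left (hr _) X).trans (hC _ X)) (by simpa using ha)
    have h3 : Filter.Tendsto (fun y => a⁻¹ * y) (𝓝 a) (𝓝 1) := by
      have : ContinuousAt (fun y => a⁻¹ * y) a := by fun_prop
      simpa [ContinuousAt] using this
    filter_upwards [h3.eventually h2] with y hy
    simpa using hy
  have := IsClopen.eq_univ ⟨hclosed, hopen⟩ ⟨1, h1⟩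
  exact (Set.ext_iff.1 this x).2 trivial

theorem lieD_add {f f' : G → F} {x : G} (hf : MDifferentiableAt 𝓘(ℝ, E) 𝓘(ℝ, F) f x)
    (hf' : MDifferentiableAt 𝓘(ℝ, E) 𝓘(ℝ, F) f' x) (X : GroupLieAlgebra 𝓘(ℝ, E) G) :
    lieD (fun y => f y + f' y) x X = lieD f x X + lieD f' x X :=
  DFunLike.congr_fun (mfderiv_add hf hf') (mulInvariantVectorField X x)

theorem lieD_comp {F' : Type*} [NormedAddCommGroup F'] [NormedSpace ℝ F'] {f : G → F} {x : G}
    {k : F → F'} {k' : F →L[ℝ] F'} (hk : HasFDerivAt k k' (f x))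
    (hf : MDifferentiableAt 𝓘(ℝ, E) 𝓘(ℝ, F) f x) (X : GroupLieAlgebra 𝓘(ℝ, E) G) :
    lieD (fun y => k (f y)) x X = k' (lieD f x X) := by
  have h := mfderiv_comp (I' := 𝓘(ℝ, F)) x hk.differentiableAt.mdifferentiableAt hf
  rw [mfderiv_eq_fderiv, hk.fderiv] at h
  exact DFunLike.congr_fun h (mulInvariantVectorField X x)

theorem lieD_congr {f f' : G → F} {x : G} (h : f =ᶠ[𝓝 x] f') (X : GroupLieAlgebra 𝓘(ℝ, E) G) :
    lieD f x X = lieD f' x X := by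
  have := h.mfderiv_eq (I := 𝓘(ℝ, E)) (I' := 𝓘(ℝ, F))
  exact DFunLike.congr_fun this (mulInvariantVectorField X x)

theorem lieD_const (c : F) (x : G) (X : GroupLieAlgebra 𝓘(ℝ, E) G) :
    lieD (fun _ => c) x X = 0 := by
  have := mfderiv_const (I := 𝓘(ℝ, E)) (I' := 𝓘(ℝ, F)) (x := x) (c := c)
  exact DFunLike.congr_fun this (mulInvariantVectorField X x)

theorem lieD_mul {f f' : G → ℝ} {x : G} (hf : MDifferentiableAt 𝓘(ℝ, E) 𝓘(ℝ, ℝ) f x)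
    (hf' : MDifferentiableAt 𝓘(ℝ, E) 𝓘(ℝ, ℝ) f' x) (X : GroupLieAlgebra 𝓘(ℝ, E) G) :
    lieD (fun y => f y * f' y) x X = f x * lieD f' x X + f' x * lieD f x X :=
  DFunLike.congr_fun (hf.hasMFDerivAt.mul hf'.hasMFDerivAt).mfderiv (mulInvariantVectorField X x)

theorem lieD_pi {J : Type*} [Fintype J] {f : J → G → ℝ}
    {x : G} (hf : ∀ j, ContMDiffAt 𝓘(ℝ, E) 𝓘(ℝ, ℝ) ∞ (f j) x)
    (X : GroupLieAlgebra 𝓘(ℝ, E) G) (j : J) :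
    lieD (fun y => (fun j => f j y : J → ℝ)) x X j = lieD (f j) x X := by
  have h1 : MDifferentiableAt 𝓘(ℝ, E) 𝓘(ℝ, J → ℝ) (fun y => (fun j => f j y : J → ℝ)) x :=
    (contMDiffAt_pi_space.2 hf).mdifferentiableAt (by simp)
  exact (lieD_comp (k := fun p : J → ℝ => p j)
    (ContinuousLinearMap.proj (R := ℝ) (φ := fun _ : J => ℝ) j).hasFDerivAt h1 X).symm

theorem eq_zero_of_lieD_eq_sum [PreconnectedSpace G] {J : Type*} [Fintype J] {r : J → G → ℝ}
    (hr : ∀ j, ContMDiff 𝓘(ℝ, E) 𝓘(ℝ, ℝ) ∞ (r j)) (C : E →ₗ[ℝ] J → J → ℝ)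
    (hC : ∀ j x X, lieD (r j) x X = ∑ k, C X j k * r k x) (h1 : ∀ j, r j 1 = 0) (j : J) (x : G) :
    r j x = 0 := by
  let C' : E →ₗ[ℝ] (J → ℝ) →L[ℝ] (J → ℝ) :=
    { toFun := fun X => ContinuousLinearMap.pi fun j =>
        ∑ k, C X j k • ContinuousLinearMap.proj (R := ℝ) (φ := fun _ : J => ℝ) k
      map_add' := by
        intro X Y
        ext v j
        simp [add_mul, Finset.sum_add_distrib]
      map_smul' := by
        intro c X
        ext v j
        simp [mul_assoc, Finset.mul_sum] }
  have h := eq_zero_of_lieD_eq (E := E) (r := fun y => (fun j => r j y : J → ℝ))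
    ((contMDiff_pi_space.2 hr).mdifferentiable (by simp)) (LinearMap.toContinuousLinearMap C')
    (fun x X => by
      funext j
      rw [lieD_pi (E := E) (fun j => hr j x), hC]
      simp [C']) (funext h1) x
  exact congrFun h j

theorem eq_of_lieD_eq [PreconnectedSpace G] {r s : G → ℝ}
    (hr : ContMDiff 𝓘(ℝ, E) 𝓘(ℝ, ℝ) ∞ r) (hs : ContMDiff 𝓘(ℝ, E) 𝓘(ℝ, ℝ) ∞ s)
    (h : ∀ x (X : GroupLieAlgebra 𝓘(ℝ, E) G), lieD r x X = lieD s x X) (h1 : r 1 = s 1) (x : G) : r x = s x := by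
  have hr' := hr.mdifferentiable (by simp)
  have hs' := hs.mdifferentiable (by simp)
  have hc : MDifferentiable 𝓘(ℝ, E) 𝓘(ℝ, ℝ) fun _ : G => (-1 : ℝ) := mdifferentiable_const
  have h2 := eq_zero_of_lieD_eq (E := E) (r := fun y => r y + (-1) * s y)
    (hr'.add (hc.mul hs')) 0 (fun x X => by
      refine (lieD_add (hr' x) ((hc.mul hs') x) X).trans ?_
      refine (congrArg (lieD r x X + ·) (lieD_mul (hc x) (hs' x) X)).trans ?_
      change _ = (0 : ℝ)
      simp only [lieD_const, h]
      simp) (by simp [h1]) x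
  linarith

end LinearSystem

/-! ### Closed left-invariant systems of one-forms are exact -/

/-- On a simply connected space, local functions with locally constant differences can be glued
to a global one, up to locally constant terms. -/
theorem exists_eventually_eq_add_of_simplyConnected {X F : Type*} [TopologicalSpace X]
    [SimplyConnectedSpace X] [LocallyPathConnectedSpace X] [AddCommGroup F] (V : X → Set X)
    (hV : ∀ x, IsOpen (V x)) (hmem : ∀ x, x ∈ V x) (P : X → X → F)
    (hP : ∀ a b, ∀ x ∈ V a ∩ V b, ∀ᶠ y in 𝓝 x, P a y - P b y = P a x - P b x) :
    ∃ u : X → F, ∀ x, ∃ c : F, ∀ᶠ y in 𝓝 x, u y = P x y + c := by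
  let _ : TopologicalSpace F := ⊥
  have _ : DiscreteTopology F := ⟨rfl⟩
  let Z : FiberBundleCore X X F :=
    { baseSet := V
      isOpen_baseSet := hV
      indexAt := id
      mem_baseSet_at := hmem
      coordChange := fun i j x v => v + (P i x - P j x)
      coordChange_self := by simp
      continuousOn_coordChange := by
        rintro i j ⟨x, v⟩ ⟨hx, -⟩
        refine ContinuousAt.continuousWithinAt ?_
        have h1 : ∀ᶠ p : X × F in 𝓝 (x, v), p.2 + (P i p.1 - P j p.1) = v + (P i x - P j x) := by
          rw [nhds_prod_eq, nhds_discrete F]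
          filter_upwards [(hP i j x hx).prod_mk (Filter.eventually_pure.2 rfl :
            ∀ᶠ w in (pure v : Filter F), w = v)] with p hp
          rw [hp.1, hp.2]
        exact (continuousAt_const (y := v + (P i x - P j x))).congr
          (h1.mono fun p hp => hp.symm)
      coordChange_comp := by
        intro i j k x _ v
        abel }
  have hcov : IsCoveringMap Z.proj := FiberBundle.isCoveringMap (F := F) (E := Z.Fiber)
  obtain ⟨x₀⟩ : Nonempty X := inferInstance
  obtain ⟨σ, ⟨-, hσ⟩, -⟩ := hcov.existsUnique_continuousMap_lifts (ContinuousMap.id X) x₀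
    (⟨x₀, (0 : F)⟩ : Z.TotalSpace) rfl
  have hσ' : ∀ x, (σ x).1 = x := fun x => congrFun hσ x
  refine ⟨fun x => P x x + (show F from (σ x).2), fun x => ⟨((Z.localTriv x) (σ x)).2, ?_⟩⟩
  have h1 : ContinuousAt (fun y => ((Z.localTriv x) (σ y)).2) x := by
    refine continuousAt_snd.comp (ContinuousAt.comp (g := Z.localTriv x) ?_ σ.continuous.continuousAt)
    refine (Z.localTriv x).continuousAt ?_
    change (σ x).1 ∈ V x
    rw [hσ']
    exact hmem x
  have h2 : ∀ᶠ y in 𝓝 x, ((Z.localTriv x) (σ y)).2 = ((Z.localTriv x) (σ x)).2 :=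
    h1.eventually_mem ((isOpen_discrete {((Z.localTriv x) (σ x)).2}).mem_nhds rfl)
  filter_upwards [h2] with y hy
  rw [← hy]
  change P y y + (show F from (σ y).2) =
    P x y + ((show F from (σ y).2) + (P (σ y).1 (σ y).1 - P x (σ y).1))
  rw [hσ' y]
  abel

section Exact

variable {E : Type*} [NormedAddCommGroup E] [NormedSpace ℝ E] [FiniteDimensional ℝ E]
  {G : Type*} [Group G] [TopologicalSpace G] [ChartedSpace E G] [LieGroup 𝓘(ℝ, E) ∞ G]

/-- The one-form with left-invariant components `h` in a chart. -/
def formInChart (h : G → E →L[ℝ] ℝ) (x₀ : G) (z : E) : E →L[ℝ] ℝ :=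
  (h ((extChartAt 𝓘(ℝ, E) x₀).symm z)).comp (chartForm E x₀ z)

theorem contDiffAt_formInChart {h : G → E →L[ℝ] ℝ}
    (hh : ContMDiff 𝓘(ℝ, E) 𝓘(ℝ, E →L[ℝ] ℝ) ∞ h) (x₀ : G) :
    ContDiffAt ℝ ∞ (formInChart h x₀) (extChartAt 𝓘(ℝ, E) x₀ x₀) := by
  have h1 : ContDiffAt ℝ ∞ (h ∘ (extChartAt 𝓘(ℝ, E) x₀).symm) (extChartAt 𝓘(ℝ, E) x₀ x₀) := by
    rw [← contMDiffAt_iff_contDiffAt]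
    exact hh.contMDiffAt.comp _ (contMDiffAt_extChartAt_symm' x₀ (mem_extChartAt_target x₀))
  exact h1.clm_comp (contDiffAt_chartForm x₀)

theorem fderiv_formInChart_symm {h : G → E →L[ℝ] ℝ}
    (hh : ContMDiff 𝓘(ℝ, E) 𝓘(ℝ, E →L[ℝ] ℝ) ∞ h)
    (hclosed : ∀ x (X Y : GroupLieAlgebra 𝓘(ℝ, E) G),
      lieD (fun y => h y Y) x X - lieD (fun y => h y X) x Y =
        h x (⁅X, Y⁆ : GroupLieAlgebra 𝓘(ℝ, E) G))
    (x₀ : G) {z : E} (hz : z ∈ (extChartAt 𝓘(ℝ, E) x₀).target)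
    (hd : DifferentiableAt ℝ (chartForm E x₀) z) (v w : E) :
    fderiv ℝ (formInChart h x₀) z v w = fderiv ℝ (formInChart h x₀) z w v := by
  set φ := (extChartAt 𝓘(ℝ, E) x₀).symm with hφ
  have hm := (hh.mdifferentiable (by simp)) (φ z)
  have h1 : DifferentiableAt ℝ (h ∘ φ) z := (hasFDerivAt_comp_chart x₀ hz hm v).2.1
  have h2 : ∀ u Y : E, fderiv ℝ (h ∘ φ) z u Y = lieD (fun y => h y Y) (φ z) (chartForm E x₀ z u) := by
    intro u Y
    have h3 : MDifferentiableAt 𝓘(ℝ, E) 𝓘(ℝ, ℝ) (fun y => h y Y) (φ z) :=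
      (ContinuousLinearMap.apply ℝ ℝ Y).hasFDerivAt.differentiableAt.mdifferentiableAt.comp
        (φ z) hm
    refine Eq.trans ?_ (hasFDerivAt_comp_chart x₀ hz h3 u).2.2
    have h4 : (fun y => h y Y) ∘ φ = fun y => (h ∘ φ) y Y := rfl
    rw [h4, fderiv_clm_apply h1 (differentiableAt_const Y)]
    simp
  have h5 : ∀ u u' : E, fderiv ℝ (formInChart h x₀) z u u' =
      lieD (fun y => h y (chartForm E x₀ z u')) (φ z) (chartForm E x₀ z u) +
        h (φ z) (fderiv ℝ (chartForm E x₀) z u u') := by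
    intro u u'
    have h6 : formInChart h x₀ = fun z => ((h ∘ φ) z).comp (chartForm E x₀ z) := rfl
    rw [h6, fderiv_clm_comp h1 hd]
    simp only [add_apply, ContinuousLinearMap.comp_apply,
      ContinuousLinearMap.compL_apply, ContinuousLinearMap.flip_apply]
    rw [h2, add_comm]
    rfl
  have h7 := fderiv_chartForm_sub x₀ hz hd (v := v) (w := w) rfl rfl
  have h8 := hclosed (φ z) (chartForm E x₀ z v) (chartForm E x₀ z w)
  have h9 := congrArg (h (φ z)) h7
  rw [h5, h5]
  have h10 : h (φ z) (fderiv ℝ (chartForm E x₀) z w v) - h (φ z) (fderiv ℝ (chartForm E x₀) z v w) =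
    lieD (fun y => h y (chartForm E x₀ z w)) (φ z) (chartForm E x₀ z v) -
      lieD (fun y => h y (chartForm E x₀ z v)) (φ z) (chartForm E x₀ z w) :=
    (map_sub (h (φ z)) _ _).symm.trans (h9.trans h8.symm)
  linarith

theorem exists_local_primitive {h : G → E →L[ℝ] ℝ}
    (hh : ContMDiff 𝓘(ℝ, E) 𝓘(ℝ, E →L[ℝ] ℝ) ∞ h)
    (hclosed : ∀ x (X Y : GroupLieAlgebra 𝓘(ℝ, E) G),
      lieD (fun y => h y Y) x X - lieD (fun y => h y X) x Y =
        h x (⁅X, Y⁆ : GroupLieAlgebra 𝓘(ℝ, E) G)) (x₀ : G) :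
    ∃ (V : Set G) (P : G → ℝ), IsOpen V ∧ x₀ ∈ V ∧
      ContMDiffAt 𝓘(ℝ, E) 𝓘(ℝ, ℝ) ∞ P x₀ ∧ ∀ x ∈ V, MDifferentiableAt 𝓘(ℝ, E) 𝓘(ℝ, ℝ) P x ∧
        ∀ X : GroupLieAlgebra 𝓘(ℝ, E) G, lieD P x X = h x X := by
  set z₀ := extChartAt 𝓘(ℝ, E) x₀ x₀ with hz₀
  have ht := (isOpen_extChartAt_target (I := 𝓘(ℝ, E)) x₀).mem_nhds (mem_extChartAt_target x₀)
  have hd : ∀ᶠ z in 𝓝 z₀, DifferentiableAt ℝ (chartForm E x₀) z := by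
    have h1 : ContDiffAt ℝ 1 (chartForm E x₀) z₀ := (contDiffAt_chartForm x₀).of_le (by simp)
    filter_upwards [h1.eventually (by simp)] with z hz
    exact hz.differentiableAt (by simp)
  obtain ⟨ε, hε, hball⟩ := Metric.eventually_nhds_iff_ball.1 (hd.and ht)
  have hη : ∀ z ∈ Metric.ball z₀ ε, DifferentiableAt ℝ (formInChart h x₀) z := fun z hz =>
    (hasFDerivAt_comp_chart x₀ (hball z hz).2 (hh.mdifferentiable (by simp) _) 0).2.1.clm_comp
      (hball z hz).1
  obtain ⟨p, hp⟩ := (convex_ball z₀ ε).exists_forall_hasFDerivAt_of_fderiv_symmetric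
    Metric.isOpen_ball (fun z hz => (hη z hz).differentiableWithinAt)
    (fun z hz v w => fderiv_formInChart_symm hh hclosed x₀ (hball z hz).2 (hball z hz).1 v w)
  have hps : ContDiffAt ℝ ∞ p z₀ := by
    rw [contDiffAt_infty]
    intro n
    refine ContDiffAt.of_le (n := n + 1) ?_ (by exact_mod_cast Nat.le_succ n)
    rw [contDiffAt_succ_iff_hasFDerivAt]
    exact ⟨formInChart h x₀, ⟨_, Metric.ball_mem_nhds z₀ hε, hp⟩,
      (contDiffAt_formInChart hh x₀).of_le (by exact_mod_cast le_top)⟩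
  have hnhds : ∀ x ∈ (extChartAt 𝓘(ℝ, E) x₀).source, ContMDiffAt 𝓘(ℝ, E) 𝓘(ℝ, E) ∞
      (extChartAt 𝓘(ℝ, E) x₀) x := fun x hx =>
    contMDiffAt_extChartAt' (by rwa [extChartAt_source] at hx)
  refine ⟨(extChartAt 𝓘(ℝ, E) x₀).source ∩ extChartAt 𝓘(ℝ, E) x₀ ⁻¹' Metric.ball z₀ ε,
    p ∘ extChartAt 𝓘(ℝ, E) x₀,
    (continuousOn_extChartAt x₀).isOpen_inter_preimage (isOpen_extChartAt_source x₀)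
      Metric.isOpen_ball,
    ⟨mem_extChartAt_source x₀, Metric.mem_ball_self hε⟩,
    hps.contMDiffAt.comp x₀ (hnhds x₀ (mem_extChartAt_source x₀)), ?_⟩
  rintro x ⟨hx, hx'⟩
  have hz := (extChartAt 𝓘(ℝ, E) x₀).map_source hx
  have hmd : MDifferentiableAt 𝓘(ℝ, E) 𝓘(ℝ, ℝ) (p ∘ extChartAt 𝓘(ℝ, E) x₀) x :=
    (hp _ hx').differentiableAt.mdifferentiableAt.comp x ((hnhds x hx).mdifferentiableAt (by simp))
  refine ⟨hmd, fun X => ?_⟩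
  have hl := (extChartAt 𝓘(ℝ, E) x₀).left_inv hx
  have h1 : fderiv ℝ ((p ∘ extChartAt 𝓘(ℝ, E) x₀) ∘ (extChartAt 𝓘(ℝ, E) x₀).symm)
      (extChartAt 𝓘(ℝ, E) x₀ x) = formInChart h x₀ (extChartAt 𝓘(ℝ, E) x₀ x) := by
    refine (Filter.EventuallyEq.fderiv_eq (f := p) ?_).trans (hp _ hx').fderiv
    filter_upwards [(isOpen_extChartAt_target (I := 𝓘(ℝ, E)) x₀).mem_nhds hz] with z hz
    exact congrArg p ((extChartAt 𝓘(ℝ, E) x₀).right_inv hz)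
  have h2 := (isInvertible_chartForm x₀ hz).self_apply_inverse X
  have h3 := (hasFDerivAt_comp_chart x₀ hz (f := p ∘ extChartAt 𝓘(ℝ, E) x₀)
    (by rwa [hl]) ((chartForm E x₀ (extChartAt 𝓘(ℝ, E) x₀ x)).inverse X)).2.2
  rw [h1, formInChart, ContinuousLinearMap.comp_apply] at h3
  let k : G → E → ℝ := fun y => h y
  let l : G → E → ℝ := fun y => lieD (p ∘ extChartAt 𝓘(ℝ, E) x₀) y
  change k _ _ = l _ _ at h3
  rw [h2, hl] at h3
  exact h3.symm

theorem eventually_eq_of_lieD_eq_zero {f : G → ℝ} {x : G} (hf : ∀ᶠ y in 𝓝 x,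
    MDifferentiableAt 𝓘(ℝ, E) 𝓘(ℝ, ℝ) f y ∧ ∀ X : GroupLieAlgebra 𝓘(ℝ, E) G, lieD f y X = 0) :
    ∀ᶠ y in 𝓝 x, f y = f x := by
  have ht := (isOpen_extChartAt_target (I := 𝓘(ℝ, E)) x).mem_nhds (mem_extChartAt_target x)
  have h1 := ((continuousAt_extChartAt_symm (I := 𝓘(ℝ, E)) x).eventually
    (by rwa [extChartAt_to_inv])).and ht
  obtain ⟨ε, hε, hball⟩ := Metric.eventually_nhds_iff_ball.1 h1
  have key : ∀ z ∈ Metric.ball (extChartAt 𝓘(ℝ, E) x x) ε,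
      f ((extChartAt 𝓘(ℝ, E) x).symm z) = f x := by
    intro z hz
    have h2 := (convex_ball (extChartAt 𝓘(ℝ, E) x x) ε).is_const_of_fderivWithin_eq_zero
      (𝕜 := ℝ) (f := f ∘ (extChartAt 𝓘(ℝ, E) x).symm)
      (fun z hz => (hasFDerivAt_comp_chart x (hball z hz).2
        (hball z hz).1.1 0).2.1.differentiableWithinAt)
      (fun z hz => by
        rw [fderivWithin_of_isOpen Metric.isOpen_ball hz]
        ext v
        exact (hasFDerivAt_comp_chart x (hball z hz).2 (hball z hz).1.1 v).2.2.trans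
          ((hball z hz).1.2 _)) hz (Metric.mem_ball_self hε)
    simpa using h2
  filter_upwards [(continuousAt_extChartAt (I := 𝓘(ℝ, E)) x).preimage_mem_nhds
    (Metric.ball_mem_nhds _ hε), extChartAt_source_mem_nhds (I := 𝓘(ℝ, E)) x] with y hy hy'
  have := key _ hy
  rwa [(extChartAt 𝓘(ℝ, E) x).left_inv hy'] at this

theorem exists_primitive [SimplyConnectedSpace G] {h : G → E →L[ℝ] ℝ}
    (hh : ContMDiff 𝓘(ℝ, E) 𝓘(ℝ, E →L[ℝ] ℝ) ∞ h)
    (hclosed : ∀ x (X Y : GroupLieAlgebra 𝓘(ℝ, E) G),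
      lieD (fun y => h y Y) x X - lieD (fun y => h y X) x Y =
        h x (⁅X, Y⁆ : GroupLieAlgebra 𝓘(ℝ, E) G)) (c : ℝ) :
    ∃ u : G → ℝ, u 1 = c ∧ ContMDiff 𝓘(ℝ, E) 𝓘(ℝ, ℝ) ∞ u ∧
      ∀ x (X : GroupLieAlgebra 𝓘(ℝ, E) G), lieD u x X = h x X := by
  have hlpc : LocallyPathConnectedSpace G := ChartedSpace.locallyPathConnectedSpace E G
  choose V P hV hmem hs hP using exists_local_primitive hh hclosed
  obtain ⟨u, hu⟩ := exists_eventually_eq_add_of_simplyConnected V hV hmem P (by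
    rintro a b x ⟨ha, hb⟩
    refine eventually_eq_of_lieD_eq_zero (E := E) (f := fun y => P a y - P b y) ?_
    filter_upwards [(hV a).mem_nhds ha, (hV b).mem_nhds hb] with y hya hyb
    refine ⟨(hP a y hya).1.sub (hP b y hyb).1, fun X => ?_⟩
    have h1 := mfderiv_sub (hP a y hya).1 (hP b y hyb).1
    refine (DFunLike.congr_fun h1 (mulInvariantVectorField X y)).trans ?_
    exact sub_eq_zero.2 (((hP a y hya).2 X).trans ((hP b y hyb).2 X).symm))
  refine ⟨fun x => u x + (c - u 1), by simp, fun x => ?_, fun x X => ?_⟩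
  · obtain ⟨d, hd⟩ := hu x
    refine (((hs x).add (contMDiffAt_const (c := d))).congr_of_eventuallyEq hd).add
      contMDiffAt_const
  · obtain ⟨d, hd⟩ := hu x
    have h1 : (fun x => u x + (c - u 1)) =ᶠ[𝓝 x] fun y => P x y + (d + (c - u 1)) := by
      filter_upwards [hd] with y hy
      rw [hy, add_assoc]
    rw [lieD_congr h1, lieD_add (hP x x (hmem x)).1 mdifferentiableAt_const, lieD_const, add_zero]
    exact (hP x x (hmem x)).2 X

end Exact

/-! ### Integration of triangular representations -/

section Integration

variable {E : Type*} [NormedAddCommGroup E] [NormedSpace ℝ E] [FiniteDimensional ℝ E]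
  {G : Type*} [Group G] [TopologicalSpace G] [ChartedSpace E G] [LieGroup 𝓘(ℝ, E) ∞ G]
  {ι : Type*} [Fintype ι]

theorem lieD_sum_mul {f : ι → G → ℝ} {x : G}
    (hf : ∀ k, ContMDiffAt 𝓘(ℝ, E) 𝓘(ℝ, ℝ) ∞ (f k) x) (c : ι → ℝ)
    (X : GroupLieAlgebra 𝓘(ℝ, E) G) :
    lieD (fun y => ∑ k, f k y * c k) x X = ∑ k, lieD (f k) x X * c k := by
  let l : (ι → ℝ) →L[ℝ] ℝ :=
    ∑ k, c k • ContinuousLinearMap.proj (R := ℝ) (φ := fun _ : ι => ℝ) k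
  have hl : ∀ v, l v = ∑ k, v k * c k := by
    intro v
    simp [l, mul_comm]
  have h1 : MDifferentiableAt 𝓘(ℝ, E) 𝓘(ℝ, ι → ℝ) (fun y => (fun j => f j y : ι → ℝ)) x :=
    (contMDiffAt_pi_space.2 hf).mdifferentiableAt (by simp)
  have h2 := lieD_comp (k := l) l.hasFDerivAt h1 X
  simp only [hl, lieD_pi hf X] at h2
  exact h2

/-- `f` is a row vector of functions that solves the linear system with coefficients `ρ`. -/
structure IsRowSolution (ρ : GroupLieAlgebra 𝓘(ℝ, E) G →ₗ[ℝ] Matrix ι ι ℝ) (f : ι → G → ℝ) :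
    Prop where
  contMDiff : ∀ j, ContMDiff 𝓘(ℝ, E) 𝓘(ℝ, ℝ) ∞ (f j)
  lieD_eq : ∀ j x (X : GroupLieAlgebra 𝓘(ℝ, E) G), lieD (f j) x X = ∑ k, f k x * ρ X k j

namespace IsRowSolution

variable {ρ : GroupLieAlgebra 𝓘(ℝ, E) G →ₗ[ℝ] Matrix ι ι ℝ} {f f' : ι → G → ℝ}

theorem comp_mul_left (hf : IsRowSolution ρ f) (a : G) :
    IsRowSolution ρ fun j y => f j (a * y) where
  contMDiff j := (hf.contMDiff j).comp contMDiff_mul_left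
  lieD_eq j x X := by
    have h1 := lieD_comp_mul_left ((hf.contMDiff j).mdifferentiable (by simp) (a * x)) X
    rw [h1, hf.lieD_eq]

theorem sum_mul {κ : Type*} [Fintype κ] {g : κ → ι → G → ℝ} (hg : ∀ k, IsRowSolution ρ (g k))
    (c : κ → ℝ) : IsRowSolution ρ fun j y => ∑ k, g k j y * c k where
  contMDiff j := contMDiff_finsetSum fun k _ => ((hg k).contMDiff j).mul contMDiff_const
  lieD_eq j x X := by
    rw [lieD_sum_mul fun k => ((hg k).contMDiff j).contMDiffAt]
    simp only [(hg _).lieD_eq, Finset.sum_mul]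
    rw [Finset.sum_comm]
    exact Finset.sum_congr rfl fun _ _ => Finset.sum_congr rfl fun _ _ => by ring

theorem eq [PreconnectedSpace G] (hf : IsRowSolution ρ f) (hf' : IsRowSolution ρ f')
    (h1 : ∀ j, f j 1 = f' j 1) (j : ι) (x : G) : f j x = f' j x := by
  have hd : ∀ j, MDifferentiable 𝓘(ℝ, E) 𝓘(ℝ, ℝ) (f j) := fun j =>
    (hf.contMDiff j).mdifferentiable (by simp)
  let C : E →ₗ[ℝ] ι → ι → ℝ :=
    { toFun := fun X j k => ρ X k j
      map_add' := fun X Y => by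
        funext j k
        exact congrFun (congrFun (map_add ρ X Y) k) j
      map_smul' := fun c X => by
        funext j k
        exact congrFun (congrFun (map_smul ρ c X) k) j }
  have hs := sum_mul (ρ := ρ) (g := ![f, f']) (fun k => by fin_cases k; exacts [hf, hf']) ![1, -1]
  simp only [Fin.sum_univ_two, Matrix.cons_val_zero, Matrix.cons_val_one, Matrix.cons_val_fin_one]
    at hs
  have := eq_zero_of_lieD_eq_sum hs.contMDiff C (fun j x X => by
    rw [hs.lieD_eq]
    exact Finset.sum_congr rfl fun _ _ => mul_comm _ _) (fun j => by rw [h1]; ring) j x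
  linarith

end IsRowSolution

variable {n : ℕ} {ρ : GroupLieAlgebra 𝓘(ℝ, E) G →ₗ[ℝ] Matrix (Fin n) (Fin n) ℝ}

/-- A matrix entry of a linear map as a continuous functional. -/
def entryCLM (ρ : GroupLieAlgebra 𝓘(ℝ, E) G →ₗ[ℝ] Matrix ι ι ℝ) (i j : ι) : E →L[ℝ] ℝ :=
  LinearMap.toContinuousLinearMap (E := E)
    { toFun := fun X => ρ X i j
      map_add' := fun X Y => congrFun (congrFun (map_add ρ X Y) i) j
      map_smul' := fun c X => congrFun (congrFun (map_smul ρ c X) i) j }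

theorem entryCLM_apply (ρ : GroupLieAlgebra 𝓘(ℝ, E) G →ₗ[ℝ] Matrix ι ι ℝ) (i j : ι)
    (X : GroupLieAlgebra 𝓘(ℝ, E) G) : entryCLM ρ i j X = ρ X i j := rfl

theorem mul_apply_diag_of_lower {X Y : Matrix (Fin n) (Fin n) ℝ} (hX : ∀ i j, i < j → X i j = 0)
    (hY : ∀ i j, i < j → Y i j = 0) (j : Fin n) : (X * Y) j j = X j j * Y j j := by
  rw [Matrix.mul_apply, Finset.sum_eq_single j]
  · intro k _ hk
    rcases lt_or_gt_of_ne hk with hk | hk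
    · rw [hY k j hk, mul_zero]
    · rw [hX j k hk, zero_mul]
  · simp

theorem exists_lieD_eq_diag [SimplyConnectedSpace G]
    (hlie : ∀ X Y, ρ ⁅X, Y⁆ = ρ X * ρ Y - ρ Y * ρ X) (htri : ∀ X i j, i < j → ρ X i j = 0)
    (j : Fin n) : ∃ u : G → ℝ, u 1 = 0 ∧ ContMDiff 𝓘(ℝ, E) 𝓘(ℝ, ℝ) ∞ u ∧
      ∀ x (X : GroupLieAlgebra 𝓘(ℝ, E) G), lieD u x X = ρ X j j := by
  refine exists_primitive (h := fun _ => entryCLM ρ j j) contMDiff_const (fun x X Y => ?_) 0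
  rw [lieD_const, lieD_const, sub_self, entryCLM_apply, hlie, Matrix.sub_apply,
    mul_apply_diag_of_lower (htri X) (htri Y), mul_apply_diag_of_lower (htri Y) (htri X)]
  ring

theorem exists_isRowSolution_aux [SimplyConnectedSpace G]
    (hlie : ∀ X Y, ρ ⁅X, Y⁆ = ρ X * ρ Y - ρ Y * ρ X) (htri : ∀ X i j, i < j → ρ X i j = 0)
    (c : Fin n → ℝ) (p : ℕ) : ∃ f : Fin n → G → ℝ, (∀ j, ContMDiff 𝓘(ℝ, E) 𝓘(ℝ, ℝ) ∞ (f j)) ∧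
      (∀ j : Fin n, (j : ℕ) + p < n → f j = fun _ => 0) ∧
      ∀ j : Fin n, n ≤ j + p → f j 1 = c j ∧
        ∀ x (X : GroupLieAlgebra 𝓘(ℝ, E) G), lieD (f j) x X = ∑ k, f k x * ρ X k j := by
  induction p with
  | zero => exact ⟨fun _ _ => 0, fun _ => contMDiff_const, fun _ _ => rfl, fun j hj => by omega⟩
  | succ p ih =>
    obtain ⟨f, hf, hf0, hf1⟩ := ih
    rcases le_or_gt n p with hp | hp
    · exact ⟨f, hf, fun j hj => by omega, fun j hj => hf1 j (by omega)⟩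
    let q : Fin n := ⟨n - 1 - p, by omega⟩
    have hq : (q : ℕ) + p + 1 = n := by simp only [q]; omega
    have hfq : f q = fun _ => 0 := hf0 q (by omega)
    obtain ⟨u, hu1, hu, hud⟩ := exists_lieD_eq_diag hlie htri q
    have hum := hu.mdifferentiable (by simp)
    have hexp : ContMDiff 𝓘(ℝ, E) 𝓘(ℝ, ℝ) ∞ fun x => Real.exp (-u x) :=
      Real.contDiff_exp.contMDiff.comp hu.neg
    have hexp' : ContMDiff 𝓘(ℝ, E) 𝓘(ℝ, ℝ) ∞ fun x => Real.exp (u x) :=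
      Real.contDiff_exp.contMDiff.comp hu
    have hed : ∀ x (X : GroupLieAlgebra 𝓘(ℝ, E) G), lieD (fun x => Real.exp (-u x)) x X =
        -(Real.exp (-u x) * ρ X q q) := by
      intro x X
      have h1 : HasDerivAt (fun t => Real.exp (-t)) (-Real.exp (-u x)) (u x) := by
        simpa using (hasDerivAt_neg (u x)).exp
      rw [lieD_comp (k := fun t => Real.exp (-t)) h1.hasFDerivAt (hum x), hud]
      simp [mul_comm]
    have hed' : ∀ x (X : GroupLieAlgebra 𝓘(ℝ, E) G), lieD (fun x => Real.exp (u x)) x X =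
        Real.exp (u x) * ρ X q q := by
      intro x X
      rw [lieD_comp (k := Real.exp) (Real.hasDerivAt_exp (u x)).hasFDerivAt (hum x), hud]
      simp [mul_comm]
    have hs : ∀ Y : GroupLieAlgebra 𝓘(ℝ, E) G,
        ContMDiff 𝓘(ℝ, E) 𝓘(ℝ, ℝ) ∞ fun y => ∑ k, f k y * ρ Y k q := fun Y =>
      contMDiff_finsetSum fun k _ => (hf k).mul contMDiff_const
    have hsd : ∀ x (X Y : GroupLieAlgebra 𝓘(ℝ, E) G), lieD (fun y => ∑ k, f k y * ρ Y k q) x X =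
        ∑ l, f l x * (ρ X * ρ Y) l q - (∑ l, f l x * ρ X l q) * ρ Y q q := by
      intro x X Y
      rw [lieD_sum_mul fun k => (hf k).contMDiffAt]
      have h1 : ∀ k, lieD (f k) x X * ρ Y k q = (∑ l, f l x * ρ X l k) * ρ Y k q -
          if k = q then (∑ l, f l x * ρ X l q) * ρ Y q q else 0 := by
        intro k
        rcases lt_trichotomy k q with hk | rfl | hk
        · rw [htri Y k q hk, if_neg hk.ne]
          ring
        · rw [hfq, lieD_const, if_pos rfl]
          ring
        · have hk' : (q : ℕ) < k := hk
          rw [(hf1 k (by omega)).2, if_neg hk.ne']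
          ring
      simp only [h1, Finset.sum_sub_distrib, Finset.sum_ite_eq', Finset.mem_univ, if_true]
      congr 1
      simp only [Finset.sum_mul, Matrix.mul_apply, Finset.mul_sum]
      rw [Finset.sum_comm]
      exact Finset.sum_congr rfl fun _ _ => Finset.sum_congr rfl fun _ _ => by ring
    let h : G → E →L[ℝ] ℝ := fun x => Real.exp (-u x) • ∑ k, f k x • entryCLM ρ k q
    have hh : ∀ x (X : GroupLieAlgebra 𝓘(ℝ, E) G),
        h x X = Real.exp (-u x) * ∑ k, f k x * ρ X k q := by
      intro x X
      have h1 : ∀ Y : E, h x Y = Real.exp (-u x) * ∑ k, f k x * entryCLM ρ k q Y := fun Y => by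
        simp [h]
      exact h1 X
    obtain ⟨g, hg1, hg, hgd⟩ := exists_primitive (h := h)
      (hexp.smul (contMDiff_finsetSum fun k _ => (hf k).smul contMDiff_const))
      (fun x X Y => by
        simp only [hh]
        rw [lieD_mul (hexp.mdifferentiable (by simp) x) ((hs Y).mdifferentiable (by simp) x),
          lieD_mul (hexp.mdifferentiable (by simp) x) ((hs X).mdifferentiable (by simp) x),
          hsd, hsd, hed, hed, hlie]
        simp only [Matrix.sub_apply, mul_sub, Finset.sum_sub_distrib]
        ring) (c q)
    have hne : ∀ j : Fin n, n ≤ j + p → j ≠ q := by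
      rintro j hj rfl
      omega
    refine ⟨Function.update f q fun x => Real.exp (u x) * g x, fun j => ?_, fun j hj => ?_,
      fun j hj => ?_⟩
    · rcases eq_or_ne j q with rfl | hj
      · rw [Function.update_self]
        exact hexp'.mul hg
      · rw [Function.update_of_ne hj]
        exact hf j
    · rw [Function.update_of_ne (by rintro rfl; omega)]
      exact hf0 j (by omega)
    · rcases eq_or_ne j q with rfl | hjq
      · rw [Function.update_self]
        refine ⟨by rw [hu1, hg1, Real.exp_zero, one_mul], fun x X => ?_⟩
        rw [lieD_mul (hexp'.mdifferentiable (by simp) x) (hg.mdifferentiable (by simp) x),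
          hgd, hh, hed', ← mul_assoc, ← Real.exp_add, add_neg_cancel, Real.exp_zero, one_mul,
          ← Finset.add_sum_erase _ _ (Finset.mem_univ q),
          ← Finset.add_sum_erase _ _ (Finset.mem_univ q), hfq, Function.update_self, zero_mul,
          zero_add, add_comm]
        congr 1
        · ring
        · refine Finset.sum_congr rfl fun k hk => ?_
          rw [Function.update_of_ne (Finset.ne_of_mem_erase hk)]
      · have hj' : n ≤ j + p := by
          have : (j : ℕ) ≠ q := fun h => hjq (Fin.ext h)
          omega
        rw [Function.update_of_ne hjq]
        refine ⟨(hf1 j hj').1, fun x X => ?_⟩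
        rw [(hf1 j hj').2]
        refine Finset.sum_congr rfl fun k _ => ?_
        rcases eq_or_ne k q with rfl | hk
        · have : q < j := Fin.lt_def.2 (by omega)
          rw [htri X q j this, mul_zero, mul_zero]
        · rw [Function.update_of_ne hk]

theorem exists_isRowSolution [SimplyConnectedSpace G]
    (hlie : ∀ X Y, ρ ⁅X, Y⁆ = ρ X * ρ Y - ρ Y * ρ X) (htri : ∀ X i j, i < j → ρ X i j = 0)
    (c : Fin n → ℝ) : ∃ f : Fin n → G → ℝ, IsRowSolution ρ f ∧ ∀ j, f j 1 = c j := by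
  obtain ⟨f, hf, -, h⟩ := exists_isRowSolution_aux hlie htri c n
  exact ⟨f, ⟨hf, fun j => (h j (by omega)).2⟩, fun j => (h j (by omega)).1⟩

/-- A Lie algebra homomorphism to lower triangular matrices integrates to a group homomorphism. -/
theorem exists_monoidHom [SimplyConnectedSpace G]
    (hlie : ∀ X Y, ρ ⁅X, Y⁆ = ρ X * ρ Y - ρ Y * ρ X) (htri : ∀ X i j, i < j → ρ X i j = 0) :
    ∃ φ : G →* LowerTriangularGroup n, ∀ i, IsRowSolution ρ fun j x => (φ x : GL (Fin n) ℝ) i j := by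
  have : PreconnectedSpace G := inferInstance
  choose f hf hf1 using fun i : Fin n => exists_isRowSolution hlie htri (fun j => (1 : Matrix _ _ ℝ) i j)
  have hmul : ∀ x y i j, f i j (x * y) = ∑ k, f i k x * f k j y := by
    intro x y i j
    have h1 := ((hf i).comp_mul_left x).eq (IsRowSolution.sum_mul hf fun k => f i k x)
      (fun j => by simp [hf1, Matrix.one_apply]) j y
    rw [h1]
    exact Finset.sum_congr rfl fun _ _ => mul_comm _ _
  let Φ : G →* Matrix (Fin n) (Fin n) ℝ :=
    { toFun := fun x => Matrix.of fun i j => f i j x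
      map_one' := by
        ext i j
        exact hf1 i j
      map_mul' := fun x y => by
        ext i j
        rw [Matrix.mul_apply]
        exact hmul x y i j }
  have hup : ∀ x i j, i < j → f i j x = 0 := by
    intro x i j hij
    let C : E →ₗ[ℝ] Fin n → Fin n → ℝ :=
      { toFun := fun X j k => if i < j then entryCLM ρ k j X else 0
        map_add' := fun X Y => by
          funext j k
          by_cases h : i < j <;> simp [h]
        map_smul' := fun c X => by
          funext j k
          by_cases h : i < j <;> simp [h] }
    have h1 := eq_zero_of_lieD_eq_sum (r := fun j x => if i < j then f i j x else 0) (fun j => by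
        by_cases h : i < j
        · simp only [h, if_true]
          exact (hf i).contMDiff j
        · simp only [h, if_false]
          exact contMDiff_const) C (fun j x X => by
        by_cases h : i < j
        · simp only [h, if_true]
          rw [(hf i).lieD_eq]
          refine Finset.sum_congr rfl fun k _ => ?_
          change _ = (if i < j then entryCLM ρ k j X else 0) * _
          rw [if_pos h, entryCLM_apply]
          by_cases hk : i < k
          · rw [if_pos hk, mul_comm]
          · rw [htri X k j (lt_of_le_of_lt (not_lt.1 hk) h), mul_zero, zero_mul]
        · simp only [h, if_false]
          rw [lieD_const]
          refine (Finset.sum_eq_zero fun k _ => ?_).symm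
          change (if i < j then entryCLM ρ k j X else 0) * _ = 0
          rw [if_neg h, zero_mul]) (fun j => by
        by_cases h : i < j
        · simp [h, hf1, h.ne]
        · simp [h]) j x
    simpa [hij] using h1
  have hne : ∀ x i, f i i x ≠ 0 := by
    intro x i h0
    have h1 := hmul x x⁻¹ i i
    rw [mul_inv_cancel, hf1, Matrix.one_apply_eq, Finset.sum_eq_single i] at h1
    · rw [h0, zero_mul] at h1
      exact one_ne_zero h1
    · intro k _ hk
      rcases lt_or_gt_of_ne hk with hk | hk
      · rw [hup x⁻¹ k i hk, mul_zero]
      · rw [hup x i k hk, zero_mul]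
    · simp
  have hpos : ∀ x i, 0 < f i i x := by
    intro x i
    by_contra hx
    obtain ⟨y, hy⟩ := mem_range_of_exists_le_of_exists_ge ((hf i).contMDiff i).continuous
      ⟨x, not_lt.1 hx⟩ ⟨1, by rw [hf1, Matrix.one_apply_eq]; exact zero_le_one⟩
    exact hne y i hy
  refine ⟨Φ.toHomUnits.codRestrict (LowerTriangularGroup n)
    fun x => ⟨fun i j h => hup x i j h, fun i => hpos x i⟩, hf⟩

end Integration

/-! ### The metric induced by a homomorphism to the triangular group -/

open LowerTriangularGroup

theorem einsteinForm_eq_sum {n : ℕ} (X Y : Matrix (Fin n) (Fin n) ℝ) :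
    einsteinForm X Y = ∑ i, ∑ j, (if i = j then 2 else 1) * (X i j * Y i j) := by
  rw [einsteinForm, frobenius_eq, frobenius_eq, Finset.mul_sum, ← Finset.sum_add_distrib]
  refine Finset.sum_congr rfl fun i _ => ?_
  rw [Finset.mul_sum, ← Finset.sum_add_distrib]
  refine Finset.sum_congr rfl fun j _ => ?_
  by_cases h : i = j
  · subst h
    simp [diagPart]
  · simp [diagPart, h]

section Pullback

variable {E : Type*} [NormedAddCommGroup E] [NormedSpace ℝ E] [FiniteDimensional ℝ E]
  {G : Type*} [Group G] [TopologicalSpace G] [ChartedSpace E G] [LieGroup 𝓘(ℝ, E) ∞ G]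

theorem mulInvariantVectorField_one' (X : GroupLieAlgebra 𝓘(ℝ, E) G) :
    mulInvariantVectorField X (1 : G) = X := by
  have h : (fun y : G => (1 : G) * y) = id := funext one_mul
  change mfderiv 𝓘(ℝ, E) 𝓘(ℝ, E) (fun y : G => (1 : G) * y) 1 X = X
  rw [h, mfderiv_id]
  rfl

theorem toLieAlg_mfderiv_monoidHom {E' : Type*} [NormedAddCommGroup E'] [NormedSpace ℝ E']
    [FiniteDimensional ℝ E'] {G' : Type*} [Group G'] [TopologicalSpace G'] [ChartedSpace E' G']
    [LieGroup 𝓘(ℝ, E') ∞ G'] (φ : G →* G') (hφ : ContMDiff 𝓘(ℝ, E) 𝓘(ℝ, E') ∞ φ) (x : G)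
    (v : TangentSpace 𝓘(ℝ, E) x) :
    toLieAlg 𝓘(ℝ, E') (φ x) (mfderiv 𝓘(ℝ, E) 𝓘(ℝ, E') φ x v) =
      mfderiv 𝓘(ℝ, E) 𝓘(ℝ, E') φ 1 (toLieAlg 𝓘(ℝ, E) x v) := by
  have hd := hφ.mdifferentiable (by simp)
  have h1 := mfderiv_comp (I' := 𝓘(ℝ, E')) x (mdifferentiable_mul_left' (E := E') (φ x)⁻¹ (φ x))
    (hd x)
  have h2 := mfderiv_comp (I' := 𝓘(ℝ, E)) x (hd (x⁻¹ * x)) (mdifferentiable_mul_left' x⁻¹ x)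
  have h3 : (fun y => (φ x)⁻¹ * y) ∘ φ = φ ∘ fun y => x⁻¹ * y := by
    funext y
    simp
  rw [h3, h2] at h1
  let M : G → E →L[ℝ] E' := fun y => mfderiv 𝓘(ℝ, E) 𝓘(ℝ, E') φ y
  have h4 : M (x⁻¹ * x) = M 1 := congrArg M (inv_mul_cancel x)
  have h5 := DFunLike.congr_fun h1 v
  exact h5.symm.trans (DFunLike.congr_fun h4 (toLieAlg 𝓘(ℝ, E) x v))

theorem IsLeftInvariant.inner_toLieAlg {g : SmoothMetric 𝓘(ℝ, E) G} (hg : IsLeftInvariant g)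
    (x : G) (v w : TangentSpace 𝓘(ℝ, E) x) :
    g.inner 1 (toLieAlg 𝓘(ℝ, E) x v) (toLieAlg 𝓘(ℝ, E) x w) = g.inner x v w := by
  let M : G → E →L[ℝ] E →L[ℝ] ℝ := fun y => g.inner y
  have h1 : M (x⁻¹ * x) = M 1 := congrArg M (inv_mul_cancel x)
  refine Eq.trans ?_ (hg x⁻¹ x v w)
  exact (DFunLike.congr_fun (DFunLike.congr_fun h1 (toLieAlg 𝓘(ℝ, E) x v))
    (toLieAlg 𝓘(ℝ, E) x w)).symm

variable {n : ℕ} {ρ : GroupLieAlgebra 𝓘(ℝ, E) G →ₗ[ℝ] Matrix (Fin n) (Fin n) ℝ}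
  {φ : G →* LowerTriangularGroup n}

theorem contMDiff_coords_comp
    (hφ : ∀ i, IsRowSolution ρ fun j x => (φ x : GL (Fin n) ℝ) i j) :
    ContMDiff 𝓘(ℝ, E) 𝓘(ℝ, Model n) ∞ fun x => coords (φ x) := by
  have h1 : ContMDiff 𝓘(ℝ, E) 𝓘(ℝ, Pos n → ℝ) ∞
      fun x => fun p : Pos n => (φ x : GL (Fin n) ℝ) p.1.1 p.1.2 :=
    contMDiff_pi_space.2 fun p => (hφ p.1.1).contMDiff p.1.2
  exact (PiLp.continuousLinearEquiv 2 ℝ (fun _ : Pos n => ℝ)).symm.contDiff.contMDiff.comp h1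

theorem contMDiff_of_isRowSolution
    (hφ : ∀ i, IsRowSolution ρ fun j x => (φ x : GL (Fin n) ℝ) i j) :
    ContMDiff 𝓘(ℝ, E) 𝓘(ℝ, Model n) ∞ φ :=
  ContMDiff.of_comp_isOpenEmbedding isOpenEmbedding_coords (contMDiff_coords_comp hφ)

theorem mfderiv_coords_comp {f : G → LowerTriangularGroup n} {x : G}
    (hf : MDifferentiableAt 𝓘(ℝ, E) 𝓘(ℝ, Model n) f x) :
    mfderiv 𝓘(ℝ, E) 𝓘(ℝ, Model n) (fun y => coords (f y)) x =
      mfderiv 𝓘(ℝ, E) 𝓘(ℝ, Model n) f x := by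
  have hf' : MDifferentiableAt 𝓘(ℝ, E) 𝓘(ℝ, Model n) (fun y => coords (f y)) x :=
    (contMDiff_coords.mdifferentiable (by simp) (f x)).comp x hf
  exact hf'.mfderiv.trans hf.mfderiv.symm

theorem toMatrix_mfderiv_one (hφ : ∀ i, IsRowSolution ρ fun j x => (φ x : GL (Fin n) ℝ) i j)
    (htri : ∀ X i j, i < j → ρ X i j = 0) (X : GroupLieAlgebra 𝓘(ℝ, E) G) :
    toMatrix (mfderiv 𝓘(ℝ, E) 𝓘(ℝ, Model n) φ 1 X : Model n) = ρ X := by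
  have h1 := mfderiv_coords_comp ((contMDiff_of_isRowSolution hφ).mdifferentiable (by simp) 1)
  ext i j
  by_cases h : j ≤ i
  · let l : Model n →L[ℝ] ℝ := EuclideanSpace.proj (⟨(i, j), h⟩ : Pos n)
    have h2 := lieD_comp (k := l) l.hasFDerivAt
      ((contMDiff_coords_comp hφ).mdifferentiable (by simp) 1) X
    have h3 := (hφ i).lieD_eq j 1 X
    have h4 : ∑ k, (φ 1 : GL (Fin n) ℝ) i k * ρ X k j = ρ X i j := by
      rw [map_one]
      simp [Matrix.one_apply]
    have h5 : lieD (fun x => coords (φ x)) 1 X = mfderiv 𝓘(ℝ, E) 𝓘(ℝ, Model n) φ 1 X :=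
      (congrArg (mfderiv 𝓘(ℝ, E) 𝓘(ℝ, Model n) (fun x => coords (φ x)) 1)
        (mulInvariantVectorField_one' X)).trans (DFunLike.congr_fun h1 X)
    have h6 : l (mfderiv 𝓘(ℝ, E) 𝓘(ℝ, Model n) φ 1 X) = ρ X i j :=
      (congrArg l h5).symm.trans (h2.symm.trans (h3.trans h4))
    simp only [toMatrix, Matrix.of_apply, h, dite_true]
    exact h6
  · simp only [toMatrix, Matrix.of_apply, h, dite_false]
    exact (htri X i j (not_le.1 h)).symm

theorem einsteinMetric_inner_mfderiv
    (hφ : ∀ i, IsRowSolution ρ fun j x => (φ x : GL (Fin n) ℝ) i j)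
    (htri : ∀ X i j, i < j → ρ X i j = 0) (c : ℝ) (hc : 0 < c) (x : G)
    (v w : TangentSpace 𝓘(ℝ, E) x) :
    (einsteinMetric n c hc).inner (φ x) (mfderiv 𝓘(ℝ, E) 𝓘(ℝ, Model n) φ x v)
      (mfderiv 𝓘(ℝ, E) 𝓘(ℝ, Model n) φ x w) =
      c * pullbackForm ρ (toLieAlg 𝓘(ℝ, E) x v) (toLieAlg 𝓘(ℝ, E) x w) := by
  have hs := contMDiff_of_isRowSolution hφ
  refine (leftForm_apply 𝓘(ℝ, Model n) (einsteinInner n c) (φ x) _ _).trans ?_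
  rw [toLieAlg_mfderiv_monoidHom φ hs, toLieAlg_mfderiv_monoidHom φ hs]
  refine (einsteinInner_apply n c _ _).trans ?_
  rw [toMatrix_mfderiv_one hφ htri, toMatrix_mfderiv_one hφ htri, einsteinForm_eq_sum,
    pullbackForm_apply]

end Pullback

/-! ### Locally simply transitive actions on simply connected spaces -/

section Action

variable {G L : Type*} [Group G] [TopologicalSpace G] [IsTopologicalGroup G]
  [TopologicalSpace L] [MulAction G L] [ContinuousConstSMul G L]

theorem map_smul_nhds (hopen : ∀ p : L, Filter.map (fun x : G => x • p) (𝓝 1) = 𝓝 p) (p : L)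
    (x : G) : Filter.map (fun x : G => x • p) (𝓝 x) = 𝓝 (x • p) := by
  rw [← map_mul_left_nhds_one x, Filter.map_map]
  have h1 : (fun y : G => y • p) ∘ (fun y => x * y) = (fun q : L => x • q) ∘ fun y : G => y • p := by
    funext y
    exact mul_smul x y p
  rw [h1, ← Filter.map_map, hopen]
  exact (Homeomorph.smul x).map_nhds_eq p

theorem surjective_smul_of_map_nhds [PreconnectedSpace L]
    (hopen : ∀ p : L, Filter.map (fun x : G => x • p) (𝓝 1) = 𝓝 p) (p₀ : L) :
    Function.Surjective fun x : G => x • p₀ := by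
  have horb : ∀ p : L, IsOpen (MulAction.orbit G p) := by
    intro p
    rw [isOpen_iff_mem_nhds]
    rintro _ ⟨x, rfl⟩
    change MulAction.orbit G p ∈ 𝓝 (x • p)
    rw [← map_smul_nhds hopen]
    exact Filter.mem_map.2 (Filter.univ_mem' fun y => ⟨y, rfl⟩)
  have hclosed : IsClosed (MulAction.orbit G p₀) := by
    rw [← isOpen_compl_iff, isOpen_iff_mem_nhds]
    intro q hq
    refine Filter.mem_of_superset ((horb q).mem_nhds (MulAction.mem_orbit_self q)) ?_
    intro r hr hr'
    refine hq ?_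
    rw [← MulAction.orbit_eq_iff] at hr hr' ⊢
    rw [← hr, hr']
  have := IsClopen.eq_univ ⟨hclosed, horb p₀⟩ ⟨p₀, MulAction.mem_orbit_self p₀⟩
  exact fun q => (Set.ext_iff.1 this q).2 trivial

/-- A locally simply transitive continuous action of a connected group on a simply connected space
is simply transitive. -/
theorem isEmbedding_smul_of_map_nhds [PreconnectedSpace G] [SimplyConnectedSpace L]
    [LocallyPathConnectedSpace L] (hcont : ∀ p : L, Continuous fun x : G => x • p)
    (hopen : ∀ p : L, Filter.map (fun x : G => x • p) (𝓝 1) = 𝓝 p) (p₀ : L)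
    (hinj : ∃ U ∈ 𝓝 (1 : G), Set.InjOn (fun x : G => x • p₀) U) :
    Topology.IsEmbedding fun x : G => x • p₀ := by
  have hmap : IsOpenMap fun x : G => x • p₀ :=
    IsOpenMap.of_nhds_le fun x => (map_smul_nhds hopen p₀ x).ge
  have hquot : Topology.IsQuotientMap fun x : G => x • p₀ :=
    hmap.isQuotientMap (hcont p₀) (surjective_smul_of_map_nhds hopen p₀)
  have hdisc : IsDiscrete (MulAction.stabilizer G p₀ : Set G) := by
    obtain ⟨U, hU, hUi⟩ := hinj
    have : DiscreteTopology (MulAction.stabilizer G p₀) := by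
      refine discreteTopology_of_isOpen_singleton_one ?_
      rw [isOpen_iff_mem_nhds]
      rintro _ rfl
      filter_upwards [continuous_subtype_val.continuousAt.preimage_mem_nhds
        (x := (1 : MulAction.stabilizer G p₀)) hU] with x hx
      exact Subtype.ext (hUi hx (mem_of_mem_nhds hU) (x.2.trans (one_smul G p₀).symm))
    exact ⟨this⟩
  have hcov : IsCoveringMap fun x : G => x • p₀ :=
    (hquot.isQuotientCoveringMap_of_subgroupOp (MulAction.stabilizer G p₀) hdisc (by
      intro x y
      rw [MulAction.mem_stabilizer_iff, mul_smul, inv_smul_eq_iff]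
      exact eq_comm)).isCoveringMap
  obtain ⟨s, ⟨hs1, hs⟩, -⟩ := hcov.existsUnique_continuousMap_lifts (ContinuousMap.id L) p₀
    (1 : G) (one_smul G p₀)
  have h1 := hcov.eq_of_comp_eq (g₁ := fun x : G => s (x • p₀)) (g₂ := id)
    (s.continuous.comp (hcont p₀)) continuous_id (by
      funext x
      exact congrFun hs (x • p₀)) 1 (by simpa using hs1)
  exact (Topology.IsOpenEmbedding.of_continuous_injective_isOpenMap (hcont p₀)
    (Function.LeftInverse.injective (g := s) fun x => congrFun h1 x) hmap).isEmbedding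

end Action

section LocalDiffeo

variable {E : Type*} [NormedAddCommGroup E] [NormedSpace ℝ E] [FiniteDimensional ℝ E]
  {G : Type*} [Group G] [TopologicalSpace G] [ChartedSpace E G] [LieGroup 𝓘(ℝ, E) ∞ G]

theorem map_nhds_eq_and_injOn_of_injective_lieD {F : G → E} {x₀ : G}
    (hF : ContMDiff 𝓘(ℝ, E) 𝓘(ℝ, E) ∞ F)
    (hinj : ∀ X : GroupLieAlgebra 𝓘(ℝ, E) G, lieD F x₀ X = 0 → X = 0) :
    Filter.map F (𝓝 x₀) = 𝓝 (F x₀) ∧ ∃ U ∈ 𝓝 x₀, Set.InjOn F U := by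
  have hz := mem_extChartAt_target (I := 𝓘(ℝ, E)) x₀
  have hc : ContDiffAt ℝ ∞ (F ∘ (extChartAt 𝓘(ℝ, E) x₀).symm) (extChartAt 𝓘(ℝ, E) x₀ x₀) := by
    rw [← contMDiffAt_iff_contDiffAt]
    exact hF.contMDiffAt.comp _ (contMDiffAt_extChartAt_symm' x₀ hz)
  have hs := hc.hasStrictFDerivAt (by simp)
  set f' := fderiv ℝ (F ∘ (extChartAt 𝓘(ℝ, E) x₀).symm) (extChartAt 𝓘(ℝ, E) x₀ x₀) with hf'
  have hi : Function.Injective f' := by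
    rw [injective_iff_map_eq_zero]
    intro v hv
    have h1 := (hasFDerivAt_comp_chart x₀ hz (hF.mdifferentiable (by simp) _) v).2.2
    rw [← hf', hv] at h1
    let k : G → E → E := fun y => lieD F y
    have h2 : k ((extChartAt 𝓘(ℝ, E) x₀).symm (extChartAt 𝓘(ℝ, E) x₀ x₀)) = k x₀ :=
      congrArg k (extChartAt_to_inv x₀)
    have h3 := hinj _ ((congrFun h2 _).symm.trans h1.symm)
    exact injective_chartForm x₀ hz (h3.trans (map_zero _).symm)
  let e : E ≃L[ℝ] E := (LinearEquiv.ofInjectiveEndo (f' : E →ₗ[ℝ] E) hi).toContinuousLinearEquiv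
  have he : (e : E →L[ℝ] E) = f' := by ext; rfl
  rw [← he] at hs
  have hloc : F =ᶠ[𝓝 x₀] (F ∘ (extChartAt 𝓘(ℝ, E) x₀).symm) ∘ extChartAt 𝓘(ℝ, E) x₀ := by
    filter_upwards [extChartAt_source_mem_nhds (I := 𝓘(ℝ, E)) x₀] with x hx
    simp only [Function.comp_apply, (extChartAt 𝓘(ℝ, E) x₀).left_inv hx]
  constructor
  · rw [Filter.map_congr hloc, ← Filter.map_map, map_extChartAt_nhds_of_boundaryless,
      hs.map_nhds_eq_of_equiv]
    simp
  · have h1 := hs.mem_toOpenPartialHomeomorph_source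
    have h2 := (hs.toOpenPartialHomeomorph _).injOn
    have h3 := (hs.toOpenPartialHomeomorph _).open_source.mem_nhds h1
    refine ⟨_, Filter.inter_mem (extChartAt_source_mem_nhds (I := 𝓘(ℝ, E)) x₀)
      ((continuousAt_extChartAt (I := 𝓘(ℝ, E)) x₀).preimage_mem_nhds h3), ?_⟩
    rintro x ⟨hx, hx'⟩ y ⟨hy, hy'⟩ hxy
    refine (extChartAt 𝓘(ℝ, E) x₀).injOn hx hy (h2 hx' hy' ?_)
    simp only [HasStrictFDerivAt.toOpenPartialHomeomorph_coe, Function.comp_apply,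
      (extChartAt 𝓘(ℝ, E) x₀).left_inv hx, (extChartAt 𝓘(ℝ, E) x₀).left_inv hy]
    exact hxy

end LocalDiffeo

/-! ### The action of the group on its Lie algebra -/

namespace IsWeightBasis

variable {L : Type*} [LieRing L] [LieAlgebra ℝ L]
  {B : L →ₗ[ℝ] L →ₗ[ℝ] ℝ} {A : LieSubalgebra ℝ L} {N : LieIdeal ℝ L} {a₀ : L} {m : ℕ}
  {e : Fin m → L} {w : Fin m → L →ₗ[ℝ] ℝ}

theorem eq_zero_of_mem (h : IsWeightBasis B A N a₀ e w) {X : L} (hA : X ∈ A) (hN : X ∈ N) :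
    X = 0 := by
  by_contra hX
  exact (h.pos X hX).ne' (h.orthogonal X hA X hN)

theorem eq_zero_of_lie_eq_zero (h : IsWeightBasis B A N a₀ e w) {X Y : L} (hX : X ∈ N) (hY : Y ∈ N)
    (hXY : ⁅X, a₀ + Y⁆ = 0) : X = 0 := by
  have key : ∀ i, B (e i) X = 0 := by
    intro i
    induction i using WellFoundedLT.induction with
    | _ i ih =>
    have h1 : B (e i) ⁅X, a₀⁆ = -(w i a₀ * B (e i) X) := by
      rw [← lie_skew, map_neg, h.coord_lie h.base_mem]
    have h2 : B (e i) ⁅X, Y⁆ = 0 := by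
      rw [h.sum_eq X hX, sum_lie, map_sum]
      refine Finset.sum_eq_zero fun j _ => ?_
      rw [smul_lie, map_smul, smul_eq_mul]
      rcases lt_or_ge j i with hj | hj
      · rw [ih j hj, zero_mul]
      · have h3 := h.induction_mem (P := B (e i) ∘ₗ (LieAlgebra.ad ℝ L (e j))) (fun k =>
          h.lie_eq_zero_of_weight (fun a ha X => h.coord_lie ha i X)
            (ne_of_gt (by linarith [h.monotone hj, h.weight_pos k]))) hY
        exact mul_eq_zero_of_right _ h3
    have h4 := congrArg (B (e i)) hXY
    rw [lie_add, map_add, h1, h2, add_zero, map_zero] at h4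
    exact (mul_eq_zero.1 (neg_eq_zero.1 h4)).resolve_left (h.weight_pos i).ne'
  rw [h.sum_eq X hX]
  simp [key]

/-- Up to terms in `N`, the bracket with `a₀ + Y` is injective. -/
theorem eq_zero_of_add_lie_eq_zero (h : IsWeightBasis B A N a₀ e w) {a X Y : L} (ha : a ∈ A)
    (hX : X ∈ N) (hY : Y ∈ N) (h0 : a + ⁅a + X, a₀ + Y⁆ = 0) : a + X = 0 := by
  have h1 : a = -⁅a + X, a₀ + Y⁆ := eq_neg_of_add_eq_zero_left h0
  have ha0 : a = 0 := h.eq_zero_of_mem ha (h1 ▸ N.neg_mem (h.lie_mem _ _))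
  subst ha0
  rw [zero_add, zero_add] at h0
  rw [h.eq_zero_of_lie_eq_zero hX hY h0, add_zero]

end IsWeightBasis

section HasLieD

variable {E : Type*} [NormedAddCommGroup E] [NormedSpace ℝ E] [FiniteDimensional ℝ E]
  {G : Type*} [Group G] [TopologicalSpace G] [ChartedSpace E G] [LieGroup 𝓘(ℝ, E) ∞ G]
  {ι : Type*} [Fintype ι]

/-- The matrix-valued function `P` is smooth, with derivatives `P'` along left-invariant fields. -/
structure HasLieD (P : G → Matrix ι ι ℝ)
    (P' : G → GroupLieAlgebra 𝓘(ℝ, E) G → Matrix ι ι ℝ) : Prop where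
  contMDiff : ∀ i j, ContMDiff 𝓘(ℝ, E) 𝓘(ℝ, ℝ) ∞ fun x => P x i j
  lieD_eq : ∀ i j x (X : GroupLieAlgebra 𝓘(ℝ, E) G), lieD (fun y => P y i j) x X = P' x X i j

namespace HasLieD

variable {P Q : G → Matrix ι ι ℝ} {P' Q' : G → GroupLieAlgebra 𝓘(ℝ, E) G → Matrix ι ι ℝ}

theorem const (C : Matrix ι ι ℝ) :
    HasLieD (fun _ : G => C) fun _ (_ : GroupLieAlgebra 𝓘(ℝ, E) G) => 0 where
  contMDiff _ _ := contMDiff_const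
  lieD_eq _ _ _ _ := lieD_const _ _ _

theorem mdifferentiableAt (hP : HasLieD P P') (i j : ι) (x : G) :
    MDifferentiableAt 𝓘(ℝ, E) 𝓘(ℝ, ℝ) (fun x => P x i j) x :=
  (hP.contMDiff i j).mdifferentiable (by simp) x

theorem add (hP : HasLieD P P') (hQ : HasLieD Q Q') :
    HasLieD (fun x => P x + Q x) fun x X => P' x X + Q' x X where
  contMDiff i j := (hP.contMDiff i j).add (hQ.contMDiff i j)
  lieD_eq i j x X := by
    rw [Matrix.add_apply, ← hP.lieD_eq, ← hQ.lieD_eq]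
    exact lieD_add (hP.mdifferentiableAt i j x) (hQ.mdifferentiableAt i j x) X

theorem mul (hP : HasLieD P P') (hQ : HasLieD Q Q') :
    HasLieD (fun x => P x * Q x) fun x X => P' x X * Q x + P x * Q' x X where
  contMDiff i j := by
    simp only [Matrix.mul_apply]
    exact contMDiff_finsetSum fun k _ => (hP.contMDiff i k).mul (hQ.contMDiff k j)
  lieD_eq i j x X := by
    simp only [Matrix.mul_apply, Matrix.add_apply]
    have h1 := lieD_sum_mul (f := fun k y => P y i k * Q y k j) (x := x)
      (fun k => ((hP.contMDiff i k).mul (hQ.contMDiff k j)).contMDiffAt) (fun _ => 1) X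
    simp only [mul_one] at h1
    rw [h1, ← Finset.sum_add_distrib]
    refine Finset.sum_congr rfl fun k _ => ?_
    rw [lieD_mul (hP.mdifferentiableAt i k x) (hQ.mdifferentiableAt k j x), hP.lieD_eq,
      hQ.lieD_eq]
    ring

theorem congr (hP : HasLieD P P') {R' : G → GroupLieAlgebra 𝓘(ℝ, E) G → Matrix ι ι ℝ}
    (h : ∀ x X, P' x X = R' x X) : HasLieD P R' where
  contMDiff := hP.contMDiff
  lieD_eq i j x X := by rw [hP.lieD_eq, h]

theorem unique (hP : HasLieD P P') (hP' : HasLieD P Q') (x : G)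
    (X : GroupLieAlgebra 𝓘(ℝ, E) G) : P' x X = Q' x X := by
  ext i j
  rw [← hP.lieD_eq, hP'.lieD_eq]

theorem linearMap_apply {F : Type*} [NormedAddCommGroup F] [NormedSpace ℝ F]
    (hP : HasLieD P P') (l : Matrix ι ι ℝ →ₗ[ℝ] F) :
    ContMDiff 𝓘(ℝ, E) 𝓘(ℝ, F) ∞ (fun x => l (P x)) ∧
      ∀ x (X : GroupLieAlgebra 𝓘(ℝ, E) G), lieD (fun y => l (P y)) x X = l (P' x X) := by
  let l' : (ι × ι → ℝ) →ₗ[ℝ] F :=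
    l ∘ₗ { toFun := fun p => Matrix.of fun i j => p (i, j)
           map_add' := fun _ _ => rfl
           map_smul' := fun _ _ => rfl }
  let k : (ι × ι → ℝ) →L[ℝ] F := LinearMap.toContinuousLinearMap l'
  have hk : ∀ M : Matrix ι ι ℝ, k (fun p => M p.1 p.2) = l M := fun M => rfl
  have h1 : ContMDiff 𝓘(ℝ, E) 𝓘(ℝ, ι × ι → ℝ) ∞ fun x => fun p : ι × ι => P x p.1 p.2 :=
    contMDiff_pi_space.2 fun p => hP.contMDiff p.1 p.2
  refine ⟨k.contDiff.contMDiff.comp h1, fun x X => ?_⟩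
  refine (lieD_comp (k := k) k.hasFDerivAt (h1.mdifferentiable (by simp) x) X).trans ?_
  rw [← hk]
  congr 1
  funext p
  rw [lieD_pi (f := fun p : ι × ι => fun y => P y p.1 p.2)
    (fun p => (hP.contMDiff p.1 p.2).contMDiffAt), hP.lieD_eq]

theorem mem_of_forall_mem [PreconnectedSpace G] (hP : HasLieD P P')
    (W : Submodule ℝ (Matrix ι ι ℝ)) (h1 : P 1 ∈ W) (hW : ∀ x X, P' x X ∈ W) (x : G) :
    P x ∈ W := by
  by_contra hx
  obtain ⟨l, hl, hWl⟩ := Submodule.exists_le_ker_of_notMem hx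
  obtain ⟨hc, hd⟩ := hP.linearMap_apply l
  refine hl ?_
  have := eq_of_lieD_eq (r := fun y => l (P y)) (s := fun _ => 0) hc contMDiff_const (fun x X => by
    rw [hd, lieD_const]
    exact hWl (hW x X)) (hWl h1) x
  exact this

/-- The solutions of a closed linear system stay in a subspace that contains their values at `1`. -/
theorem mem_of_forall_eq_sum [PreconnectedSpace G] {J : Type*} [Fintype J]
    {R : J → G → Matrix ι ι ℝ} {R' : J → G → GroupLieAlgebra 𝓘(ℝ, E) G → Matrix ι ι ℝ}
    (hR : ∀ j, HasLieD (R j) (R' j))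
    (C : E →ₗ[ℝ] J → J → ℝ) (hC : ∀ j x X, R' j x X = ∑ k, C X j k • R k x)
    (W : Submodule ℝ (Matrix ι ι ℝ)) (h1 : ∀ j, R j 1 ∈ W) (j : J) (x : G) : R j x ∈ W := by
  by_contra hx
  obtain ⟨l, hl, hWl⟩ := Submodule.exists_le_ker_of_notMem hx
  refine hl ?_
  refine eq_zero_of_lieD_eq_sum (r := fun j y => l (R j y)) (fun j => ((hR j).linearMap_apply l).1) C
    (fun j x X => ?_) (fun j => hWl (h1 j)) j x
  rw [((hR j).linearMap_apply l).2, hC, map_sum]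
  simp

end HasLieD

end HasLieD

namespace LowerTriangularGroup

variable {n : ℕ}

/-- The matrix of an element of `T(n, ℝ)`. -/
def mat (g : LowerTriangularGroup n) : Matrix (Fin n) (Fin n) ℝ :=
  ((g : GL (Fin n) ℝ) : Matrix (Fin n) (Fin n) ℝ)

theorem mat_mul (g h : LowerTriangularGroup n) : mat (g * h) = mat g * mat h := rfl

theorem mat_one : mat (1 : LowerTriangularGroup n) = 1 := rfl

theorem mat_mul_inv (g : LowerTriangularGroup n) : mat g * mat g⁻¹ = 1 := by
  rw [← mat_mul, mul_inv_cancel, mat_one]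

theorem mat_inv_mul (g : LowerTriangularGroup n) : mat g⁻¹ * mat g = 1 := by
  rw [← mat_mul, inv_mul_cancel, mat_one]

theorem mat_lower (g : LowerTriangularGroup n) (i j : Fin n) (h : i < j) : mat g i j = 0 :=
  g.2.1 i j h

theorem mat_pos (g : LowerTriangularGroup n) (i : Fin n) : 0 < mat g i i := g.2.2 i

theorem continuous_mat : Continuous (mat (n := n)) :=
  Units.continuous_val.comp continuous_subtype_val

theorem mat_mul_diag (g h : LowerTriangularGroup n) (i : Fin n) :
    mat (g * h) i i = mat g i i * mat h i i :=
  mul_apply_diag_of_lower (mat_lower g) (mat_lower h) i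

/-- The diagonal matrix of the logarithms of the diagonal entries. -/
def logDiag (g : LowerTriangularGroup n) : Matrix (Fin n) (Fin n) ℝ :=
  Matrix.diagonal fun i => Real.log (mat g i i)

theorem logDiag_mul (g h : LowerTriangularGroup n) :
    logDiag (g * h) = logDiag g + logDiag h := by
  simp only [logDiag, mat_mul_diag, Matrix.diagonal_add]
  congr 1
  funext i
  exact Real.log_mul (mat_pos g i).ne' (mat_pos h i).ne'

theorem logDiag_one : logDiag (1 : LowerTriangularGroup n) = 0 := by
  simp [logDiag, mat_one]

theorem diagPart_apply_of_ne (Z : Matrix (Fin n) (Fin n) ℝ) {i j : Fin n} (h : i ≠ j) :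
    diagPart Z i j = 0 := by
  simp [diagPart, h]

theorem diagPart_apply_self (Z : Matrix (Fin n) (Fin n) ℝ) (i : Fin n) :
    diagPart Z i i = Z i i := by
  simp [diagPart]

theorem diagPart_add (Z W : Matrix (Fin n) (Fin n) ℝ) :
    diagPart (Z + W) = diagPart Z + diagPart W := by
  simp [diagPart]

theorem diagPart_sub (Z W : Matrix (Fin n) (Fin n) ℝ) :
    diagPart (Z - W) = diagPart Z - diagPart W := by
  ext i j
  by_cases h : i = j
  · subst h
    simp [diagPart]
  · simp [diagPart, h]

theorem diagPart_diagPart (Z : Matrix (Fin n) (Fin n) ℝ) : diagPart (diagPart Z) = diagPart Z := by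
  simp [diagPart]

theorem diagPart_logDiag (g : LowerTriangularGroup n) : diagPart (logDiag g) = logDiag g := by
  simp [diagPart, logDiag]

theorem mul_lower {X Y : Matrix (Fin n) (Fin n) ℝ} (hX : ∀ i j, i < j → X i j = 0)
    (hY : ∀ i j, i < j → Y i j = 0) (i j : Fin n) (h : i < j) : (X * Y) i j = 0 := by
  rw [Matrix.mul_apply]
  refine Finset.sum_eq_zero fun k _ => ?_
  rcases lt_or_ge i k with hk | hk
  · rw [hX i k hk, zero_mul]
  · rw [hY k j (lt_of_le_of_lt hk h), mul_zero]

theorem diagPart_conj (g : LowerTriangularGroup n) {Z : Matrix (Fin n) (Fin n) ℝ}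
    (hZ : ∀ i j, i < j → Z i j = 0) : diagPart (mat g * Z * mat g⁻¹) = diagPart Z := by
  ext i j
  rcases eq_or_ne i j with rfl | h
  · rw [diagPart_apply_self, diagPart_apply_self,
      mul_apply_diag_of_lower (mul_lower (mat_lower g) hZ) (mat_lower _),
      mul_apply_diag_of_lower (mat_lower g) hZ]
    have h1 := mat_mul_diag g g⁻¹ i
    rw [mul_inv_cancel, mat_one, Matrix.one_apply_eq] at h1
    linear_combination (-Z i i) * h1
  · rw [diagPart_apply_of_ne _ h, diagPart_apply_of_ne _ h]

/-- The affine action of `T(n, ℝ)` on triangular matrices, by translations on the diagonal part and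
by conjugation, with base point `D`, on the strictly triangular part. -/
def affineAct (D : Matrix (Fin n) (Fin n) ℝ) (g : LowerTriangularGroup n)
    (Z : Matrix (Fin n) (Fin n) ℝ) : Matrix (Fin n) (Fin n) ℝ :=
  logDiag g + diagPart Z + mat g * (D + (Z - diagPart Z)) * mat g⁻¹ - D

theorem affineAct_one (D Z : Matrix (Fin n) (Fin n) ℝ) : affineAct D 1 Z = Z := by
  rw [affineAct, logDiag_one, inv_one, mat_one, one_mul, mul_one]
  abel

theorem affineAct_mul {D Z : Matrix (Fin n) (Fin n) ℝ} (hD : diagPart D = D)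
    (hZ : ∀ i j, i < j → Z i j = 0) (g h : LowerTriangularGroup n) :
    affineAct D (g * h) Z = affineAct D g (affineAct D h Z) := by
  have hlow : ∀ i j, i < j → (D + (Z - diagPart Z)) i j = 0 := by
    intro i j hij
    have h1 := diagPart_apply_of_ne D hij.ne
    rw [hD] at h1
    simp [h1, hZ i j hij, diagPart_apply_of_ne Z hij.ne]
  have h1 : diagPart (affineAct D h Z) = logDiag h + diagPart Z := by
    rw [affineAct, diagPart_sub, diagPart_add, diagPart_conj h hlow, diagPart_add, diagPart_add,
      diagPart_sub, diagPart_diagPart, diagPart_logDiag]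
    abel
  have h2 : D + (affineAct D h Z - diagPart (affineAct D h Z)) = mat h * (D + (Z - diagPart Z)) * mat h⁻¹ := by
    rw [h1, affineAct]
    abel
  rw [affineAct.eq_def D g, h2, h1, affineAct, logDiag_mul, mat_mul, mul_inv_rev, mat_mul]
  simp only [Matrix.mul_assoc, add_assoc]

theorem continuous_affineAct (D : Matrix (Fin n) (Fin n) ℝ) (g : LowerTriangularGroup n) :
    Continuous (affineAct D g) := by
  have h : Continuous (diagPart (n := n)) := continuous_id.matrix_diag.matrix_diagonal
  unfold affineAct
  exact ((continuous_const.add h).add ((continuous_const.matrix_mul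
    (continuous_const.add (continuous_id.sub h))).matrix_mul continuous_const)).sub continuous_const

theorem continuous_affineAct_zero (D : Matrix (Fin n) (Fin n) ℝ) :
    Continuous fun g : LowerTriangularGroup n => affineAct D g 0 := by
  have h1 : Continuous (logDiag (n := n)) := by
    refine Continuous.matrix_diagonal (continuous_pi fun i => ?_)
    exact (continuous_mat.matrix_elem i i).log fun g => (mat_pos g i).ne'
  have h2 : Continuous fun g : LowerTriangularGroup n => mat g⁻¹ :=
    continuous_mat.comp continuous_inv
  unfold affineAct
  exact ((h1.add continuous_const).add ((continuous_mat.matrix_mul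
    continuous_const).matrix_mul h2)).sub continuous_const

end LowerTriangularGroup

section Embedding

variable {E : Type*} [NormedAddCommGroup E] [NormedSpace ℝ E] [FiniteDimensional ℝ E]
  {G : Type*} [Group G] [TopologicalSpace G] [ChartedSpace E G] [LieGroup 𝓘(ℝ, E) ∞ G]
  {n : ℕ} {ρ : GroupLieAlgebra 𝓘(ℝ, E) G →ₗ[ℝ] Matrix (Fin n) (Fin n) ℝ}
  {φ : G →* LowerTriangularGroup n}

theorem hasLieD_mat (hφ : ∀ i, IsRowSolution ρ fun j x => (φ x : GL (Fin n) ℝ) i j) :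
    HasLieD (fun x => mat (φ x)) fun x X => mat (φ x) * ρ X where
  contMDiff i j := (hφ i).contMDiff j
  lieD_eq i j x X := by
    rw [Matrix.mul_apply]
    exact (hφ i).lieD_eq j x X

theorem hasLieD_mat_inv (hφ : ∀ i, IsRowSolution ρ fun j x => (φ x : GL (Fin n) ℝ) i j) :
    HasLieD (fun x => mat (φ x)⁻¹) fun x X => -(ρ X * mat (φ x)⁻¹) := by
  have h1 : HasLieD (fun x => mat (φ x)⁻¹)
      fun x (X : GroupLieAlgebra 𝓘(ℝ, E) G) => Matrix.of fun i j => lieD (fun y => mat (φ y)⁻¹ i j) x X :=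
    { contMDiff := fun i j => by
        have h2 := ((hφ i).contMDiff j).comp (contMDiff_inv 𝓘(ℝ, E) ∞ (G := G))
        refine h2.congr fun x => ?_
        simp only [Function.comp_apply, map_inv]
        rfl
      lieD_eq := fun i j x X => rfl }
  refine h1.congr fun x X => ?_
  have h3 := (hasLieD_mat hφ).mul h1
  simp only [mat_mul_inv] at h3
  have h4 := h3.unique (HasLieD.const 1) x X
  have h5 := congrArg (mat (φ x)⁻¹ * ·) h4
  simp only [mul_add, mul_zero, ← Matrix.mul_assoc, mat_inv_mul, one_mul] at h5
  exact eq_neg_of_add_eq_zero_right h5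

theorem hasLieD_conj (hφ : ∀ i, IsRowSolution ρ fun j x => (φ x : GL (Fin n) ℝ) i j)
    (hlie : ∀ X Y, ρ ⁅X, Y⁆ = ρ X * ρ Y - ρ Y * ρ X) (Y : GroupLieAlgebra 𝓘(ℝ, E) G) :
    HasLieD (fun x => mat (φ x) * ρ Y * mat (φ x)⁻¹)
      fun x (X : GroupLieAlgebra 𝓘(ℝ, E) G) => mat (φ x) * ρ ⁅X, Y⁆ * mat (φ x)⁻¹ := by
  refine (((hasLieD_mat hφ).mul (HasLieD.const (ρ Y))).mul (hasLieD_mat_inv hφ)).congr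
    fun x X => ?_
  rw [hlie]
  noncomm_ring

theorem hasLieD_logDiag (hφ : ∀ i, IsRowSolution ρ fun j x => (φ x : GL (Fin n) ℝ) i j)
    (htri : ∀ X i j, i < j → ρ X i j = 0) :
    HasLieD (fun x => logDiag (φ x)) fun _ X => diagPart (ρ X) where
  contMDiff i j := by
    by_cases h : i = j
    · subst h
      simp only [logDiag, Matrix.diagonal_apply_eq]
      intro x
      exact (Real.contDiffAt_log.2 (mat_pos (φ x) i).ne').contMDiffAt.comp x
        ((hφ i).contMDiff i x)
    · simp only [logDiag, Matrix.diagonal_apply_ne _ h]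
      exact contMDiff_const
  lieD_eq i j x X := by
    by_cases h : i = j
    · subst h
      simp only [logDiag, Matrix.diagonal_apply_eq, diagPart_apply_self]
      have h1 := (Real.hasDerivAt_log (mat_pos (φ x) i).ne').hasFDerivAt
      rw [lieD_comp (k := Real.log) (f := fun x => mat (φ x) i i) h1 ((hasLieD_mat hφ).mdifferentiableAt i i x),
        (hasLieD_mat hφ).lieD_eq, mul_apply_diag_of_lower (mat_lower (φ x)) (htri X)]
      have := (mat_pos (φ x) i).ne'
      simp
      field_simp
    · simp only [logDiag, Matrix.diagonal_apply_ne _ h, diagPart_apply_of_ne _ h]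
      exact lieD_const _ _ _

variable {B : GroupLieAlgebra 𝓘(ℝ, E) G →ₗ[ℝ] GroupLieAlgebra 𝓘(ℝ, E) G →ₗ[ℝ] ℝ}
  {A : LieSubalgebra ℝ (GroupLieAlgebra 𝓘(ℝ, E) G)} {N : LieIdeal ℝ (GroupLieAlgebra 𝓘(ℝ, E) G)}
  {a₀ : GroupLieAlgebra 𝓘(ℝ, E) G} {m : ℕ} {e : Fin m → GroupLieAlgebra 𝓘(ℝ, E) G}
  {w : Fin m → GroupLieAlgebra 𝓘(ℝ, E) G →ₗ[ℝ] ℝ}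

theorem conj_mem_range [PreconnectedSpace G]
    (hφ : ∀ i, IsRowSolution ρ fun j x => (φ x : GL (Fin n) ℝ) i j)
    (hlie : ∀ X Y, ρ ⁅X, Y⁆ = ρ X * ρ Y - ρ Y * ρ X) (Y : GroupLieAlgebra 𝓘(ℝ, E) G) (x : G) :
    mat (φ x) * ρ Y * mat (φ x)⁻¹ ∈ LinearMap.range ρ := by
  let b := Module.finBasis ℝ (GroupLieAlgebra 𝓘(ℝ, E) G)
  let C : GroupLieAlgebra 𝓘(ℝ, E) G →ₗ[ℝ] Fin _ → Fin _ → ℝ :=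
    { toFun := fun X j k => b.repr ⁅X, b j⁆ k
      map_add' := fun X X' => by
        funext j k
        simp
      map_smul' := fun c X => by
        funext j k
        simp }
  have h1 : ∀ j, mat (φ x) * ρ (b j) * mat (φ x)⁻¹ ∈ LinearMap.range ρ := fun j =>
    HasLieD.mem_of_forall_eq_sum (fun j => hasLieD_conj hφ hlie (b j)) C (fun j x X => by
      have h2 := (b.sum_repr ⁅X, b j⁆).symm
      conv_lhs => rw [h2]
      simp only [map_sum, map_smul, Finset.mul_sum, Finset.sum_mul, Matrix.mul_smul,
        Matrix.smul_mul]
      rfl) (LinearMap.range ρ) (fun j => by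
        simp only [map_one, inv_one, mat_one, one_mul, mul_one]
        exact LinearMap.mem_range_self ρ _) j x
  rw [← b.sum_repr Y]
  simp only [map_sum, map_smul, Finset.mul_sum, Finset.sum_mul, Matrix.mul_smul, Matrix.smul_mul]
  exact Submodule.sum_mem _ fun j _ => Submodule.smul_mem _ _ (h1 j)

theorem IsWeightBasis.diagPart_eq (h : IsWeightBasis B A N a₀ e w) (hρ : IsDiagonalRep A ρ)
    {a Y : GroupLieAlgebra 𝓘(ℝ, E) G} (ha : a ∈ A) (hY : Y ∈ N) :
    diagPart (ρ (a + Y)) = ρ a := by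
  ext i j
  rcases eq_or_ne i j with rfl | hij
  · rw [diagPart_apply_self, map_add, Matrix.add_apply, h.apply_diag hρ hY, add_zero]
  · rw [diagPart_apply_of_ne _ hij, hρ.diag a ha i j hij]

theorem IsWeightBasis.affineAct_eq (h : IsWeightBasis B A N a₀ e w) (hρ : IsDiagonalRep A ρ)
    {a Y : GroupLieAlgebra 𝓘(ℝ, E) G} (ha : a ∈ A) (hY : Y ∈ N) (g : LowerTriangularGroup n) :
    affineAct (ρ a₀) g (ρ (a + Y)) =
      logDiag g + ρ a + mat g * ρ (a₀ + Y) * mat g⁻¹ - ρ a₀ := by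
  rw [affineAct, h.diagPart_eq hρ ha hY, map_add, map_add, add_sub_cancel_left]

theorem IsWeightBasis.affineAct_mem_range [PreconnectedSpace G] (h : IsWeightBasis B A N a₀ e w)
    (hρ : IsDiagonalRep A ρ) (htri : ∀ X i j, i < j → ρ X i j = 0)
    (hφ : ∀ i, IsRowSolution ρ fun j x => (φ x : GL (Fin n) ℝ) i j) (x : G)
    (W : GroupLieAlgebra 𝓘(ℝ, E) G) :
    affineAct (ρ a₀) (φ x) (ρ W) ∈ LinearMap.range ρ := by
  obtain ⟨a, ha, Y, hY, rfl⟩ := h.exists_add W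
  rw [h.affineAct_eq hρ ha hY]
  refine Submodule.sub_mem _ (Submodule.add_mem _ (Submodule.add_mem _ ?_
    (LinearMap.mem_range_self ρ _)) (conj_mem_range hφ hρ.map_lie _ x))
    (LinearMap.mem_range_self ρ _)
  refine (hasLieD_logDiag hφ htri).mem_of_forall_mem _ ?_ (fun x X => ?_) x
  · rw [map_one, logDiag_one]
    exact Submodule.zero_mem _
  · obtain ⟨b, hb, Z, hZ, rfl⟩ := h.exists_add X
    rw [h.diagPart_eq hρ hb hZ]
    exact LinearMap.mem_range_self ρ _

theorem IsWeightBasis.isEmbedding [PreconnectedSpace G] (h : IsWeightBasis B A N a₀ e w)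
    (hρ : IsDiagonalRep A ρ) (hinj : Function.Injective ρ)
    (htri : ∀ X i j, i < j → ρ X i j = 0)
    (hφ : ∀ i, IsRowSolution ρ fun j x => (φ x : GL (Fin n) ℝ) i j) :
    Topology.IsEmbedding φ := by
  have hT : IsTopologicalGroup G := topologicalGroup_of_lieGroup 𝓘(ℝ, E) ∞
  obtain ⟨κ, hκ⟩ := LinearMap.exists_leftInverse_of_injective ρ (LinearMap.ker_eq_bot.2 hinj)
  let σ : E →ₗ[ℝ] Matrix (Fin n) (Fin n) ℝ := ρ
  let τ : Matrix (Fin n) (Fin n) ℝ →ₗ[ℝ] E := κ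
  have hτσ : ∀ W, τ (σ W) = W := fun W => DFunLike.congr_fun hκ W
  have hστ : ∀ x W, σ (τ (affineAct (ρ a₀) (φ x) (σ W))) = affineAct (ρ a₀) (φ x) (σ W) := by
    intro x W
    obtain ⟨V, hV⟩ := h.affineAct_mem_range hρ htri hφ x W
    exact (congrArg (fun Z => σ (τ Z)) hV).symm.trans ((congrArg σ (hτσ V)).trans hV)
  have hD : diagPart (ρ a₀) = ρ a₀ := by
    have := h.diagPart_eq hρ h.base_mem N.zero_mem
    rwa [add_zero] at this
  let _ : MulAction G E :=
    { smul := fun x W => τ (affineAct (ρ a₀) (φ x) (σ W))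
      one_smul := fun W => by
        change τ (affineAct (ρ a₀) (φ 1) (σ W)) = W
        rw [map_one, affineAct_one, hτσ]
      mul_smul := fun x y W => by
        change τ (affineAct (ρ a₀) (φ (x * y)) (σ W)) =
          τ (affineAct (ρ a₀) (φ x) (σ (τ (affineAct (ρ a₀) (φ y) (σ W)))))
        rw [hστ, map_mul]
        exact congrArg τ (affineAct_mul hD (htri W) _ _) }
  have hsmul : ∀ (x : G) (W : E), x • W = τ (affineAct (ρ a₀) (φ x) (σ W)) := fun _ _ => rfl
  have hσ : Continuous σ := σ.continuous_of_finiteDimensional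
  have hτ : Continuous τ := τ.continuous_of_finiteDimensional
  have hcs : ContinuousConstSMul G E :=
    ⟨fun x => hτ.comp ((continuous_affineAct _ _).comp hσ)⟩
  have hd : ∀ W : E, ∃ b ∈ A, ∃ Y ∈ N,
      HasLieD (fun x => affineAct (ρ a₀) (φ x) (σ W))
        (fun x (X : GroupLieAlgebra 𝓘(ℝ, E) G) => diagPart (ρ X) +
        mat (φ x) * ρ ⁅X, a₀ + Y⁆ * mat (φ x)⁻¹) := by
    intro W
    obtain ⟨a, ha, Y, hY, hW⟩ := h.exists_add W
    refine ⟨a, ha, Y, hY, ?_⟩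
    have h1 := (((hasLieD_logDiag hφ htri).add (HasLieD.const (ρ a))).add
      (hasLieD_conj hφ hρ.map_lie (a₀ + Y))).add (HasLieD.const (-ρ a₀))
    have h2 : (fun x => affineAct (ρ a₀) (φ x) (σ W)) = fun x =>
        logDiag (φ x) + ρ a + mat (φ x) * ρ (a₀ + Y) * mat (φ x)⁻¹ + -ρ a₀ := by
      funext x
      rw [← sub_eq_add_neg, ← h.affineAct_eq hρ ha hY, ← hW]
      rfl
    rw [h2]
    exact h1.congr fun x X => by rw [add_zero, add_zero]
  have hsm : ∀ W : E, ContMDiff 𝓘(ℝ, E) 𝓘(ℝ, E) ∞ fun x : G => x • W := by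
    intro W
    obtain ⟨b, hb, Y, hY, h1⟩ := hd W
    exact (h1.linearMap_apply τ).1
  have hloc : ∀ W : E, ∀ X : GroupLieAlgebra 𝓘(ℝ, E) G,
      lieD (fun x : G => x • W) 1 X = 0 → X = 0 := by
    intro W X hX
    obtain ⟨b, hb, Y, hY, h1⟩ := hd W
    have h2 := ((h1.linearMap_apply τ).2 1 X).symm.trans hX
    obtain ⟨a, ha, Z, hZ, rfl⟩ := h.exists_add X
    rw [h.diagPart_eq hρ ha hZ, map_one, inv_one, mat_one, one_mul, mul_one, ← map_add] at h2
    exact h.eq_zero_of_add_lie_eq_zero ha hZ hY ((hτσ _).symm.trans h2)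
  have hLD := fun W : E => map_nhds_eq_and_injOn_of_injective_lieD (hsm W) (hloc W)
  have hemb := isEmbedding_smul_of_map_nhds (G := G) (L := E) (fun W => (hsm W).continuous)
    (fun W => by simpa using (hLD W).1) 0 (hLD 0).2
  have hΘ : Continuous fun g : LowerTriangularGroup n => τ (affineAct (ρ a₀) g 0) :=
    hτ.comp (continuous_affineAct_zero _)
  refine Topology.IsEmbedding.of_comp (contMDiff_of_isRowSolution hφ).continuous hΘ ?_
  convert hemb using 1
  funext x
  rw [hsmul, map_zero]
  rfl

end Embedding

end

theorem mainTheorem1 {d : ℕ} {S : Type*} [Group S] [TopologicalSpace S]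
    [ChartedSpace (EuclideanSpace ℝ (Fin d)) S] [LieGroup (𝓡 d) ∞ S] [SimplyConnectedSpace S]
    (g : SmoothMetric (𝓡 d) S) (hg : IsLeftInvariant g)
    (A : LieSubalgebra ℝ (GroupLieAlgebra (𝓡 d) S)) (N : LieIdeal ℝ (GroupLieAlgebra (𝓡 d) S))
    (hS : IsAdmissible (fun X Y : GroupLieAlgebra (𝓡 d) S => g.inner 1 X Y) A N) :
    ∃ (n : ℕ) (c : ℝ) (hc : 0 < c) (φ : S →* LowerTriangularGroup n),
      IsIsometricEmbedding g (LowerTriangularGroup.einsteinMetric n c hc) φ := by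
  let B : GroupLieAlgebra (𝓡 d) S →ₗ[ℝ] GroupLieAlgebra (𝓡 d) S →ₗ[ℝ] ℝ :=
    LinearMap.mk₂ ℝ (fun X Y => g.inner 1 X Y) (fun X X' Y => by simp) (fun r X Y => by simp)
      (fun X Y Y' => by simp) (fun r X Y => by simp)
  have hB : ∀ X Y, B X Y = g.inner 1 X Y := fun _ _ => rfl
  obtain ⟨a₀, m, e, w, h⟩ := IsAdmissible.exists_isWeightBasis B (fun X Y => g.symm 1 X Y)
    (fun X hX => g.pos 1 X hX) hS
  obtain ⟨K, n, ρ, hK, hρ, htri, hform⟩ := h.exists_rep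
  obtain ⟨φ, hφ⟩ := exists_monoidHom hρ.map_lie htri
  have hinj : Function.Injective ρ := by
    rw [injective_iff_map_eq_zero]
    intro X hX
    by_contra hX0
    have h1 : pullbackForm ρ X X = 0 := by simp [pullbackForm_apply, hX]
    rw [hform] at h1
    exact (mul_pos hK (h.pos X hX0)).ne' h1
  refine ⟨n, K⁻¹, inv_pos.2 hK, φ, contMDiff_of_isRowSolution hφ, h.isEmbedding hρ hinj htri hφ,
    fun x v w => ?_⟩
  rw [einsteinMetric_inner_mfderiv hφ htri, hform, hB, inv_mul_cancel_left₀ hK.ne']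
  exact hg.inner_toLieAlg x v w
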